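/- Let $\mathbb K$ be an algebraic number field. For a place $v$ of $\mathbb K$ let $|\alpha|_v=|\sigma(\alpha)|$ if $v$ belongs to a real embedding $\sigma$, $|\alpha|_v=|\sigma(\alpha)|^2$ if $v$ belongs to a complex embedding $\sigma$, and $|\alpha|_v=\mathrm{Norm}(P)^{-\mathrm{ord}_P(\alpha)}$ if $v$ belongs to a prime ideal $P$ (with $|0|_v=0$). Let $S=\{v_1,\dots,v_s\}$ be a finite set of places containing all infinite places, and let $U_S$ be the group of $S$-units, i.e. of the $\varepsilon\in\mathbb K^*$ with $|\varepsilon|_v=1$ for all $v\notin S$. A system of fundamental $S$-units is a tuple $F=(\varepsilon_1,\dots,\varepsilon_{s-1})$ of $S$-units such that every $S$-unit is a root of unity times $\varepsilon_1^{b_1}\cdots\varepsilon_{s-1}^{b_{s-1}}$ with uniquely determined $b_i\in\mathbb Z$. Put $R_F=(\log|\varepsilon_j|_{v_i})_{1\le i\le s,\,1\le j\le s-1}$ and $$N(F)=\min\{\|R'\| : R'\in\mathbb R^{(s-1)\times s},\ R'R_F=E_{s-1}\},\qquad \|(a_{ij})\|=\max_i\sum_j|a_{ij}|$$ (with $N(F)=0$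 if $s=1$). The system $F$ is called optimal if $N(F)$ is minimal among all systems of fundamental $S$-units. Theorem. The minimum defining $N(F)$ exists, and for every real $c>0$ there are only finitely many systems $F$ of fundamental $S$-units with $N(F)\le c$. In particular an optimal system exists. Further, all such systems can be effectively determined. Here, relative to a given system $T=(\eta_1,\dots,\eta_{s-1})$ of fundamental $S$-units, systems are determined by listing the integer matrices $A=(a_{ij})$ for which the systems are exactly those with $\varepsilon_j=\zeta_j\prod_i\eta_i^{a_{ij}}$, where $\zeta_1,\dots,\zeta_{s-1}$ are arbitrary roots of unity of $\mathbb K$, and "algorithm" means a Turing machine (a partial recursive function): (a) for all fixed $\mathbb K$, $S$, $T$ there is an algorithm which always halts and which computes from a rational number $c>0$ all systems $F$ with $N(F)\le c$; (b) there is one algorithm, the same for all $\mathbb K,S,T$, with the following property. Its input is the table of the numbers $|\eta_j|_{v_i}$, given as real algebraic numbers by integer polynomials and isolating intervals with rational endpoints, and two rational numbers $0<q_1\le q_2$. If it halts, its output lists exactly the systems $F$ with $N(F)\le c$, for every real $c\in[q_1,q_2]$; and it halts whenever no $F$ has $N(F)\in[q_1,q_2]$; (c) there is one algorithm, the same for all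 $\mathbb K,S,T$, which computes from the same table and any integer $n\ge 0$ a list of systems of fundamental $S$-units that contains all optimal systems, in which every system $F$ satisfies $N(F)\le\min_G N(G)+1/(n+1)$, and which, for all sufficiently large $n$ (depending on the table), consists exactly of the optimal systems. -/

import Mathlib

open NumberField IsDedekindDomain

universe u

/-! ### Valuations, S-units and fundamental systems

`S` is always the set of finite places in the finite set of places under consideration;
all infinite places belong to that set. -/

section SUnits

variable {K : Type u} [Field K] [NumberField K]

/-- The places of `K` consisting of all infinite places and of the finite places in `S`. -/
abbrev SPlace (S : Finset (HeightOneSpectrum (𝓞 K))) : Type u :=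
  InfinitePlace K ⊕ {P : HeightOneSpectrum (𝓞 K) // P ∈ S}

/-- The number `s` of those places. -/
noncomputable def numPlaces (S : Finset (HeightOneSpectrum (𝓞 K))) : ℕ :=
  Fintype.card (SPlace S)

/-- The rank `s - 1` of the group of `S`-units (there is at least one infinite place). -/
noncomputable def sRank (S : Finset (HeightOneSpectrum (𝓞 K))) : ℕ :=
  numPlaces S - 1

/-- The normalised valuations: `|σ x|` at a real place, `|σ x| ^ 2` at a complex place and
`Norm(P) ^ (- ord_P x)` at the finite place `P`. -/
noncomputable def absV {S : Finset (HeightOneSpectrum (𝓞 K))} : SPlace S → K → ℝ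
  | Sum.inl v, x => v x ^ v.mult
  | Sum.inr P, x => HeightOneSpectrum.adicAbv K P.1 x

/-- `F` is a system of fundamental `S`-units: every `F i` is an `S`-unit, and every `S`-unit is a
root of unity times a product of powers of the `F i` with uniquely determined exponents. -/
def IsFundamentalSystem (S : Finset (HeightOneSpectrum (𝓞 K))) (F : Fin (sRank S) → Kˣ) : Prop :=
  (∀ i, F i ∈ (S : Set (HeightOneSpectrum (𝓞 K))).unit K) ∧
  ∀ x ∈ (S : Set (HeightOneSpectrum (𝓞 K))).unit K,
    ∃! b : Fin (sRank S) → ℤ, ∃ ζ ∈ CommGroup.torsion Kˣ, x = ζ * ∏ i, F i ^ b i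

/-- The matrix `R_F` of the logarithms `log |F j|_v`. -/
noncomputable def logMatrix (S : Finset (HeightOneSpectrum (𝓞 K))) (F : Fin (sRank S) → Kˣ) :
    Matrix (SPlace S) (Fin (sRank S)) ℝ :=
  Matrix.of fun v j => Real.log (absV v (F j : K))

/-- The row norm `max_i ∑_j |a i j|` (it is `0` for a matrix without rows). -/
noncomputable def rowNorm {m n : Type*} [Fintype n] (A : Matrix m n ℝ) : ℝ :=
  ⨆ i, ∑ j, |A i j|

/-- The row norms of all left inverses of `R_F`. -/
def leftInverseNorms (S : Finset (HeightOneSpectrum (𝓞 K))) (F : Fin (sRank S) → Kˣ) : Set ℝ :=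
  {t | ∃ R' : Matrix (Fin (sRank S)) (SPlace S) ℝ, R' * logMatrix S F = 1 ∧ t = rowNorm R'}

/-- The norm `N(F)`: the smallest row norm of a left inverse of `R_F`. -/
noncomputable def sysNorm (S : Finset (HeightOneSpectrum (𝓞 K))) (F : Fin (sRank S) → Kˣ) : ℝ :=
  sInf (leftInverseNorms S F)

/-- `F` is optimal: `N(F)` is minimal among all systems of fundamental `S`-units. -/
def IsOptimal (S : Finset (HeightOneSpectrum (𝓞 K))) (F : Fin (sRank S) → Kˣ) : Prop :=
  IsFundamentalSystem S F ∧ ∀ G, IsFundamentalSystem S G → sysNorm S F ≤ sysNorm S G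

end SUnits

/-! ### Finite descriptions used by the algorithms -/

/-- The pair `(a, b)` stands for the rational number `a / (b + 1)`. -/
abbrev RatCode : Type := ℤ × ℕ

/-- The number described by a `RatCode`. -/
noncomputable def RatCode.toReal (q : RatCode) : ℝ := (q.1 : ℝ) / ((q.2 : ℝ) + 1)

/-- A polynomial with integer coefficients (constant term first) and two rational numbers. -/
abbrev AlgCode : Type := List ℤ × RatCode × RatCode

/-- The value at `x` of the polynomial with the given coefficients, constant term first. -/
def evalPoly (p : List ℤ) (x : ℝ) : ℝ := p.foldr (fun a y => (a : ℝ) + x * y) 0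

/-- `(p, lo, hi)` describes the real algebraic number `x` by an isolating interval: `x` is the only
root of `p` strictly between `lo` and `hi`, and `p` has opposite signs at `lo` and `hi`. -/
def Describes (d : AlgCode) (x : ℝ) : Prop :=
  d.2.1.toReal < x ∧ x < d.2.2.toReal ∧ evalPoly d.1 x = 0 ∧
  (∀ y, d.2.1.toReal < y → y < d.2.2.toReal → evalPoly d.1 y = 0 → y = x) ∧
  evalPoly d.1 d.2.1.toReal * evalPoly d.1 d.2.2.toReal < 0

/-- An integer matrix as the list of its rows. -/
def matCode {m n : ℕ} {α : Type} (A : Fin m → Fin n → α) : List (List α) :=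
  List.ofFn fun i => List.ofFn (A i)

section Systems

variable {K : Type u} [Field K] [NumberField K]

/-- `tab` is a table of the valuations of the units `T j` at the places under consideration (in some
order), every entry being given as a real algebraic number. -/
def IsValuationTable (S : Finset (HeightOneSpectrum (𝓞 K))) (T : Fin (sRank S) → Kˣ)
    (tab : List (List AlgCode)) : Prop :=
  ∃ (e : Fin (numPlaces S) ≃ SPlace S) (code : Fin (numPlaces S) → Fin (sRank S) → AlgCode),
    tab = matCode code ∧ ∀ i j, Describes (code i j) (absV (e i) (T j : K))

/-- The systems `F` described by the list `L` of integer matrices in terms of the system `T`: for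
some `A` in the list, `F j` is a root of unity times `∏ i, T i ^ A i j`. -/
def systemsOf (S : Finset (HeightOneSpectrum (𝓞 K))) (T : Fin (sRank S) → Kˣ)
    (L : List (List (List ℤ))) : Set (Fin (sRank S) → Kˣ) :=
  {F | ∃ A : Fin (sRank S) → Fin (sRank S) → ℤ, matCode A ∈ L ∧
    ∀ j, ∃ ζ ∈ CommGroup.torsion Kˣ, F j = ζ * ∏ i, T i ^ A i j}

/-- The systems of fundamental `S`-units with `N(F) ≤ c`. -/
def systemsUpTo (S : Finset (HeightOneSpectrum (𝓞 K))) (c : ℝ) : Set (Fin (sRank S) → Kˣ) :=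
  {F | IsFundamentalSystem S F ∧ sysNorm S F ≤ c}

end Systems

/-! Fix one fundamental system `T` with logarithm matrix `R`. Every other system is, up to roots of
unity, `T` raised to a unimodular integral matrix `A`, and its logarithm matrix is `R * A`. With `B
= A⁻¹`, the left inverses of `R * A` are the solutions of `R' * R = B`, a condition on each row
separately. By Hahn-Banach (`DualLE.exists_vecMul`) the least ℓ¹-norm of a row `r` with `r ᵥ* R = b`
is the dual norm `coNorm R b` of the form `b` with respect to the norm `‖R *ᵥ x‖`. Hence `N(F)` is
attained and equals the largest dual norm of a row of `B` (`isLeast_leftInverseNorms`). A bound for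
these dual norms bounds the entries of `B`, and there are only finitely many roots of unity; this
gives finiteness and optimal systems.

For the algorithms, strict inequalities have finite certificates: `coNorm R b > c` is shown by one
integral vector violating the bound, and `coNorm R b < c` by finitely many inequalities, with room
to spare, on the boundary of an integral cube. Both survive replacing `m • R` by a nearby integral
matrix, which is verified by rational bounds for the exponential function. If no `N(F)` lies in the
given interval, each candidate `B` is certified to be small, large or not invertible, so the search
succeeds (`exists_separates`); it uses only the table. Applied at a rational number in the gap above
the minimum, and if necessary at one just below the minimum, it produces the optimal systems
(`exists_nearlyOptimal`).

For fixed `K`, `S`, `T` the case `coNorm R b = c` has to be recognised as well. On integral vectors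
the dual norm is a maximum of finitely many linear forms `b ↦ b ⬝ᵥ x`. In a minimal family each `x`
is the slope of the dual norm at an integral vector `β` (`exists_exposed_points`), so `b ⬝ᵥ x < c`
again has certificates, while `b ⬝ᵥ x = c` amounts to finitely many integral linear equations
(`exists_linear_equations`). The vectors `β` and the equations are constants built into the
algorithm; they are shown to exist but not computed from the table, which is why this algorithm is
not uniform. -/

/-! ### Primitive recursive functions and predicates -/

/-- A predicate holds for all elements of a list. -/
def AllMem {β : Type*} (l : List β) (p : β → Prop) : Prop := ∀ x ∈ l, p x

/-- A predicate holds for some element of a list. -/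
def ExMem {β : Type*} (l : List β) (p : β → Prop) : Prop := ∃ x ∈ l, p x

/-- A predicate holds for all numbers below a bound. -/
def AllLt (n : ℕ) (p : ℕ → Prop) : Prop := ∀ i < n, p i

/-- A predicate holds for some number below a bound. -/
def ExLt (n : ℕ) (p : ℕ → Prop) : Prop := ∃ i < n, p i

/-- All lists of length `k` with entries in a given list. -/
def listTuples {β : Type*} (X : List β) : ℕ → List (List β) :=
  Nat.rec [[]] fun _ l => X.flatMap fun x => l.map fun t => x :: t

theorem mem_listTuples {β : Type*} {X : List β} {k : ℕ} {l : List β} :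
    l ∈ listTuples X k ↔ l.length = k ∧ ∀ x ∈ l, x ∈ X := by
  induction k generalizing l with
  | zero => 
    show l ∈ [[]] ↔ _
    rw [List.mem_singleton, List.length_eq_zero_iff]
    constructor
    · rintro rfl; simp
    · exact fun h => h.1
  | succ k ih =>
    show l ∈ X.flatMap (fun x => (listTuples X k).map fun t => x :: t) ↔ _
    cases l with
    | nil => simp
    | cons a l => 
      simp [ih]
      tauto

section PrimitiveRecursion

-- The closure rules below reduce primitive recursiveness to the shape of an expression. The bounded
-- quantifiers `AllMem`, `ExMem`, `AllLt`, `ExLt` carry names so that they have such rules too.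
attribute [fun_prop] Primrec
attribute [fun_prop] PrimrecPred

variable {α β γ : Type*} [Primcodable α] [Primcodable β] [Primcodable γ]

@[fun_prop] theorem primrec_id : Primrec fun a : α => a := Primrec.id

@[fun_prop] theorem primrec_const (b : β) : Primrec fun _ : α => b := Primrec.const b

@[fun_prop] theorem primrec_comp {f : β → γ} {g : α → β} (hf : Primrec f) (hg : Primrec g) :
    Primrec fun a => f (g a) := hf.comp hg

@[fun_prop] theorem primrec_mk {f : α → β} {g : α → γ} (hf : Primrec f) (hg : Primrec g) :
    Primrec fun a => (f a, g a) := hf.pair hg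

@[fun_prop] theorem primrec_fst {f : α → β × γ} (hf : Primrec f) : Primrec fun a => (f a).1 :=
  Primrec.fst.comp hf

@[fun_prop] theorem primrec_snd {f : α → β × γ} (hf : Primrec f) : Primrec fun a => (f a).2 :=
  Primrec.snd.comp hf

@[fun_prop] theorem primrec_nat_add {f g : α → ℕ} (hf : Primrec f) (hg : Primrec g) :
    Primrec fun a => f a + g a := Primrec.nat_add.comp hf hg

@[fun_prop] theorem primrec_nat_sub {f g : α → ℕ} (hf : Primrec f) (hg : Primrec g) :
    Primrec fun a => f a - g a := Primrec.nat_sub.comp hf hg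

@[fun_prop] theorem primrec_nat_mul {f g : α → ℕ} (hf : Primrec f) (hg : Primrec g) :
    Primrec fun a => f a * g a := Primrec.nat_mul.comp hf hg

@[fun_prop] theorem primrec_nat_div {f g : α → ℕ} (hf : Primrec f) (hg : Primrec g) :
    Primrec fun a => f a / g a := Primrec.nat_div.comp hf hg

@[fun_prop] theorem primrec_nat_mod {f g : α → ℕ} (hf : Primrec f) (hg : Primrec g) :
    Primrec fun a => f a % g a := Primrec.nat_mod.comp hf hg

@[fun_prop] theorem primrecPred_nat_lt {f g : α → ℕ} (hf : Primrec f) (hg : Primrec g) :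
    PrimrecPred fun a => f a < g a := Primrec.nat_lt.comp hf hg

@[fun_prop] theorem primrecPred_nat_le {f g : α → ℕ} (hf : Primrec f) (hg : Primrec g) :
    PrimrecPred fun a => f a ≤ g a := Primrec.nat_le.comp hf hg

@[fun_prop] theorem primrecPred_eq {f g : α → β} (hf : Primrec f) (hg : Primrec g) :
    PrimrecPred fun a => f a = g a := Primrec.eq.comp hf hg

@[fun_prop] theorem primrecPred_and {p q : α → Prop} (hp : PrimrecPred p) (hq : PrimrecPred q) :
    PrimrecPred fun a => p a ∧ q a := hp.and hq

@[fun_prop] theorem primrecPred_or {p q : α → Prop} (hp : PrimrecPred p) (hq : PrimrecPred q) :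
    PrimrecPred fun a => p a ∨ q a := hp.or hq

@[fun_prop] theorem primrecPred_not {p : α → Prop} (hp : PrimrecPred p) :
    PrimrecPred fun a => ¬ p a := hp.not

@[fun_prop] theorem primrec_ite {p : α → Prop} [DecidablePred p] {f g : α → β}
    (hp : PrimrecPred p) (hf : Primrec f) (hg : Primrec g) :
    Primrec fun a => if p a then f a else g a := Primrec.ite hp hf hg

@[fun_prop] theorem primrec_list_getD {f : α → List β} {g : α → ℕ} (d : β) (hf : Primrec f)
    (hg : Primrec g) : Primrec fun a => (f a).getD (g a) d := (Primrec.list_getD d).comp hf hg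

@[fun_prop] theorem primrec_list_length {f : α → List β} (hf : Primrec f) :
    Primrec fun a => (f a).length := Primrec.list_length.comp hf

@[fun_prop] theorem primrec_list_cons {f : α → β} {g : α → List β} (hf : Primrec f)
    (hg : Primrec g) : Primrec fun a => f a :: g a := Primrec.list_cons.comp hf hg

@[fun_prop] theorem primrec_list_range {f : α → ℕ} (hf : Primrec f) :
    Primrec fun a => List.range (f a) := Primrec.list_range.comp hf

@[fun_prop] theorem primrec_list_map {f : α → List β} {g : α → β → γ} (hf : Primrec f)
    (hg : Primrec fun q : α × β => g q.1 q.2) : Primrec fun a => (f a).map (g a) :=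
  Primrec.list_map hf hg

@[fun_prop] theorem primrec_list_flatMap {f : α → List β} {g : α → β → List γ} (hf : Primrec f)
    (hg : Primrec fun q : α × β => g q.1 q.2) : Primrec fun a => (f a).flatMap (g a) :=
  Primrec.list_flatMap hf hg

theorem primrec_natRec {f : α → ℕ} {g : α → β} {h : α → ℕ → β → β} (hf : Primrec f)
    (hg : Primrec g) (hh : Primrec fun q : α × (ℕ × β) => h q.1 q.2.1 q.2.2) :
    Primrec fun a => Nat.rec (motive := fun _ => β) (g a) (h a) (f a) :=
  Primrec.nat_rec' (h := fun a q => h a q.1 q.2) hf hg hh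

@[fun_prop] theorem primrecPred_allMem {l : α → List β} {p : α → β → Prop} (hl : Primrec l)
    (hp : PrimrecPred fun q : α × β => p q.1 q.2) : PrimrecPred fun a => AllMem (l a) (p a) := by
  have h : PrimrecRel fun (b : β) (a : α) => p a b :=
    hp.comp (f := fun q : β × α => (q.2, q.1)) (by fun_prop)
  exact h.forall_mem_list.comp hl Primrec.id

@[fun_prop] theorem primrecPred_exMem {l : α → List β} {p : α → β → Prop} (hl : Primrec l)
    (hp : PrimrecPred fun q : α × β => p q.1 q.2) : PrimrecPred fun a => ExMem (l a) (p a) := by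
  have h : PrimrecRel fun (b : β) (a : α) => p a b :=
    hp.comp (f := fun q : β × α => (q.2, q.1)) (by fun_prop)
  exact h.exists_mem_list.comp hl Primrec.id

@[fun_prop] theorem primrecPred_allLt {n : α → ℕ} {p : α → ℕ → Prop} (hn : Primrec n)
    (hp : PrimrecPred fun q : α × ℕ => p q.1 q.2) : PrimrecPred fun a => AllLt (n a) (p a) :=
  (primrecPred_allMem (primrec_list_range hn) hp).of_eq fun a => by simp [AllMem, AllLt]

@[fun_prop] theorem primrecPred_exLt {n : α → ℕ} {p : α → ℕ → Prop} (hn : Primrec n)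
    (hp : PrimrecPred fun q : α × ℕ => p q.1 q.2) : PrimrecPred fun a => ExLt (n a) (p a) :=
  (primrecPred_exMem (primrec_list_range hn) hp).of_eq fun a => by simp [ExMem, ExLt]

/-- Searching for a witness of a primitive recursive predicate. -/
theorem exists_partrec_search {P : α → β → γ → Prop}
    (hP : PrimrecPred fun q : α × β × γ => P q.1 q.2.1 q.2.2) :
    ∃ Φ : α →. β, Partrec Φ ∧ (∀ a, ∀ b ∈ Φ a, ∃ c, P a b c) ∧
      ∀ a, (∃ b c, P a b c) → (Φ a).Dom := by
  classical
  -- The number `k` codes an output together with its witness; only the output is returned.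
  let f : α → ℕ → Option β := fun a k =>
    (Encodable.decode (α := β × γ) k).bind fun q => if P a q.1 q.2 then some q.1 else none
  have hf : Primrec₂ f := by
    refine Primrec.option_bind (Primrec.decode.comp Primrec.snd) ?_
    refine Primrec.ite (c := fun q : (α × ℕ) × (β × γ) => P q.1.1 q.2.1 q.2.2) ?_ ?_ ?_
    · exact hP.comp (f := fun q : (α × ℕ) × (β × γ) => (q.1.1, q.2)) (by fun_prop)
    · exact Primrec.option_some.comp (by fun_prop)
    · exact Primrec.const none
  have hmem : ∀ a k b, b ∈ f a k → ∃ c, P a b c := by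
    intro a k b h
    simp only [f, Option.mem_def, Option.bind_eq_some_iff] at h
    obtain ⟨q, -, h⟩ := h
    split_ifs at h with hq
    exact ⟨q.2, by rw [← Option.some.inj h]; exact hq⟩
  refine ⟨fun a => Nat.rfindOpt (f a), Partrec.rfindOpt hf.to_comp, ?_, ?_⟩
  · intro a b hb
    obtain ⟨k, hk⟩ := Nat.rfindOpt_spec hb
    exact hmem a k b hk
  · rintro a ⟨b, c, h⟩
    exact Nat.rfindOpt_dom.2 ⟨Encodable.encode (b, c), b, by simp [f, h]⟩

/-! ### Arithmetic of integers and lists -/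

/-- The difference of two natural numbers as an integer. -/
theorem primrec_natSubNat {f g : α → ℕ} (hf : Primrec f) (hg : Primrec g) :
    Primrec fun a => ((f a : ℤ) - (g a : ℤ)) := by
  rw [← Primrec.encode_iff]
  -- The integer `z ≥ 0` has code `2 * z` and `-(z + 1)` has code `2 * z + 1`, hence the shift by
  -- one in the second branch.
  have h : Primrec fun a => if g a ≤ f a then 2 * (f a - g a) else 2 * (g a - f a - 1) + 1 := by
    fun_prop
  refine h.of_eq fun a => ?_
  have e1 : ∀ z : ℕ, Encodable.encode (z : ℤ) = 2 * z := fun _ => rfl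
  have e2 : ∀ z : ℕ, Encodable.encode (Int.negSucc z) = 2 * z + 1 := fun _ => rfl
  split_ifs with hle
  · rw [← e1, Nat.cast_sub hle]
  · rw [← e2]
    congr 1
    omega

@[fun_prop] theorem primrec_int_natCast {f : α → ℕ} (hf : Primrec f) :
    Primrec fun a => (f a : ℤ) :=
  (primrec_natSubNat hf (primrec_const 0)).of_eq fun a => by simp

@[fun_prop] theorem primrec_int_toNat {f : α → ℤ} (hf : Primrec f) :
    Primrec fun a => (f a).toNat := by
  have h : Primrec fun a => if Encodable.encode (f a) % 2 = 0 then Encodable.encode (f a) / 2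
      else 0 := by
    have := Primrec.encode.comp hf
    fun_prop
  refine h.of_eq fun a => ?_
  have e1 : ∀ z : ℕ, Encodable.encode (Int.ofNat z) = 2 * z := fun _ => rfl
  have e2 : ∀ z : ℕ, Encodable.encode (Int.negSucc z) = 2 * z + 1 := fun _ => rfl
  rcases f a with z | z
  · rw [e1]; simp
  · rw [e2, if_neg (by omega)]; simp

theorem primrec_int_toNat_neg {f : α → ℤ} (hf : Primrec f) :
    Primrec fun a => (-f a).toNat := by
  have h : Primrec fun a => if Encodable.encode (f a) % 2 = 0 then 0 else
      Encodable.encode (f a) / 2 + 1 := by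
    have := Primrec.encode.comp hf
    fun_prop
  refine h.of_eq fun a => ?_
  have e1 : ∀ z : ℕ, Encodable.encode (Int.ofNat z) = 2 * z := fun _ => rfl
  have e2 : ∀ z : ℕ, Encodable.encode (Int.negSucc z) = 2 * z + 1 := fun _ => rfl
  rcases f a with z | z
  · rw [e1, if_pos (by omega)]; simp
  · rw [e2, if_neg (by omega)]; simp; omega

@[fun_prop] theorem primrec_int_neg {f : α → ℤ} (hf : Primrec f) : Primrec fun a => -f a :=
  (primrec_natSubNat (primrec_int_toNat_neg hf) (primrec_int_toNat hf)).of_eq fun a => by omega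

-- An integer is the difference of its positive and negative parts, and both are primitive
-- recursive. Sums and products become differences of natural numbers built from these parts.
@[fun_prop] theorem primrec_int_add {f g : α → ℤ} (hf : Primrec f) (hg : Primrec g) :
    Primrec fun a => f a + g a :=
  (primrec_natSubNat (primrec_nat_add (primrec_int_toNat hf) (primrec_int_toNat hg))
    (primrec_nat_add (primrec_int_toNat_neg hf) (primrec_int_toNat_neg hg))).of_eq fun a => by
      omega

@[fun_prop] theorem primrec_int_sub {f g : α → ℤ} (hf : Primrec f) (hg : Primrec g) :
    Primrec fun a => f a - g a :=
  (primrec_int_add hf (primrec_int_neg hg)).of_eq fun a => by omega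

@[fun_prop] theorem primrec_int_mul {f g : α → ℤ} (hf : Primrec f) (hg : Primrec g) :
    Primrec fun a => f a * g a := by
  have hf1 := primrec_int_toNat hf
  have hf2 := primrec_int_toNat_neg hf
  have hg1 := primrec_int_toNat hg
  have hg2 := primrec_int_toNat_neg hg
  refine (primrec_natSubNat (f := fun a => (f a).toNat * (g a).toNat +
    (-f a).toNat * (-g a).toNat) (g := fun a => (f a).toNat * (-g a).toNat +
    (-f a).toNat * (g a).toNat) (by fun_prop) (by fun_prop)).of_eq fun a => ?_
  have h1 : f a = (f a).toNat - (-f a).toNat := by omega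
  have h2 : g a = (g a).toNat - (-g a).toNat := by omega
  conv_rhs => rw [h1, h2]
  push_cast
  ring

@[fun_prop] theorem primrec_int_abs {f : α → ℤ} (hf : Primrec f) : Primrec fun a => |f a| :=
  (primrec_int_natCast (primrec_nat_add (primrec_int_toNat hf) (primrec_int_toNat_neg hf))).of_eq
    fun a => by rcases abs_cases (f a) with h | h <;> omega

@[fun_prop] theorem primrec_int_pow {f : α → ℤ} {g : α → ℕ} (hf : Primrec f) (hg : Primrec g) :
    Primrec fun a => f a ^ g a := by
  refine (primrec_natRec (h := fun a _ z => z * f a) hg (primrec_const (1 : ℤ))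
    (by fun_prop)).of_eq fun a => ?_
  induction g a with
  | zero => simp
  | succ n ih => rw [pow_succ, ← ih]

@[fun_prop] theorem primrecPred_int_le {f g : α → ℤ} (hf : Primrec f) (hg : Primrec g) :
    PrimrecPred fun a => f a ≤ g a :=
  (primrecPred_eq (primrec_int_toNat (primrec_int_sub hf hg)) (primrec_const 0)).of_eq
    fun a => by omega

@[fun_prop] theorem primrecPred_int_lt {f g : α → ℤ} (hf : Primrec f) (hg : Primrec g) :
    PrimrecPred fun a => f a < g a :=
  (primrecPred_not (primrecPred_int_le hg hf)).of_eq fun a => by omega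

@[fun_prop] theorem primrecPred_int_dvd {f : α → ℕ} {g : α → ℤ} (hf : Primrec f)
    (hg : Primrec g) : PrimrecPred fun a => (f a : ℤ) ∣ g a := by
  refine (primrecPred_eq (primrec_nat_mod (primrec_nat_add (primrec_int_toNat hg)
    (primrec_int_toNat_neg hg)) hf) (primrec_const 0)).of_eq fun a => ?_
  rw [← Nat.dvd_iff_mod_eq_zero, ← Int.natCast_dvd_natCast]
  rcases le_total 0 (g a) with h | h
  · rw [show (-g a).toNat = 0 by omega, add_zero, Int.toNat_of_nonneg h]
  · rw [show (g a).toNat = 0 by omega, zero_add, Int.toNat_of_nonneg (by omega), dvd_neg]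

@[fun_prop] theorem primrec_sum_range {n : α → ℕ} {f : α → ℕ → ℤ} (hn : Primrec n)
    (hf : Primrec fun q : α × ℕ => f q.1 q.2) :
    Primrec fun a => ∑ i ∈ Finset.range (n a), f a i := by
  have hf' : Primrec fun q : α × (ℕ × ℤ) => f q.1 q.2.1 :=
    hf.comp (g := fun q : α × (ℕ × ℤ) => (q.1, q.2.1)) (by fun_prop)
  refine (primrec_natRec (h := fun a i z => z + f a i) hn (primrec_const (0 : ℤ))
    (by fun_prop)).of_eq fun a => ?_
  induction n a with
  | zero => simp
  | succ n ih => rw [Finset.sum_range_succ, ← ih]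

@[fun_prop] theorem primrec_listTuples {X : α → List β} {k : α → ℕ} (hX : Primrec X)
    (hk : Primrec k) : Primrec fun a => listTuples (X a) (k a) := by
  unfold listTuples
  refine primrec_natRec hk (primrec_const _) ?_
  fun_prop

/-- The integers of absolute value at most `M`. -/
def intBox (M : ℕ) : List ℤ := (List.range (2 * M + 1)).map fun i : ℕ => (i : ℤ) - M

theorem mem_intBox {M : ℕ} {z : ℤ} : z ∈ intBox M ↔ |z| ≤ M := by
  simp only [intBox, List.mem_map, List.mem_range, abs_le]
  constructor
  · rintro ⟨i, hi, rfl⟩; omega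
  · intro h; exact ⟨(z + M).toNat, by omega, by omega⟩

@[fun_prop] theorem primrec_intBox {M : α → ℕ} (hM : Primrec M) :
    Primrec fun a => intBox (M a) := by
  unfold intBox
  fun_prop

end PrimitiveRecursion


/-! ### Semidecidable predicates -/

/-- A predicate is semidecidable if it asks for a witness of a primitive recursive relation. -/
def SemiDec {α : Type*} [Primcodable α] (p : α → Prop) : Prop :=
  ∃ A : α → ℕ → Prop, (PrimrecPred fun q : α × ℕ => A q.1 q.2) ∧ ∀ a, p a ↔ ∃ w, A a w

section Semidecidable

variable {α β γ : Type*} [Primcodable α] [Primcodable β] [Primcodable γ]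

theorem PrimrecPred.semiDec {p : α → Prop} (hp : PrimrecPred p) : SemiDec p :=
  ⟨fun a _ => p a, hp.comp Primrec.fst, fun a => by simp⟩

theorem SemiDec.of_iff {p q : α → Prop} (hp : SemiDec p) (h : ∀ a, q a ↔ p a) : SemiDec q := by
  obtain ⟨A, hA, hp⟩ := hp
  exact ⟨A, hA, fun a => (h a).trans (hp a)⟩

theorem SemiDec.comp {p : β → Prop} {f : α → β} (hp : SemiDec p) (hf : Primrec f) :
    SemiDec fun a => p (f a) := by
  obtain ⟨A, hA, hp⟩ := hp
  exact ⟨fun a w => A (f a) w, hA.comp (f := fun q : α × ℕ => (f q.1, q.2)) (by fun_prop),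
    fun a => hp _⟩

/-- It suffices to have witnesses in any type of finite descriptions. -/
theorem SemiDec.of_exists {p : α → Prop} (A : α → β → Prop)
    (hA : PrimrecPred fun q : α × β => A q.1 q.2) (h : ∀ a, p a ↔ ∃ w, A a w) : SemiDec p := by
  classical
  let d : α × ℕ → Bool := fun q =>
    ((Encodable.decode (α := β) q.2).map fun b => decide (A q.1 b)).getD false
  have hd : Primrec d := by
    refine Primrec.option_getD.comp (Primrec.option_map (Primrec.decode.comp Primrec.snd) ?_)
      (Primrec.const false)
    exact (hA.comp (f := fun q : (α × ℕ) × β => (q.1.1, q.2)) (by fun_prop)).decide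
  refine ⟨fun a w => d (a, w) = true, by fun_prop, fun a => (h a).trans ⟨?_, ?_⟩⟩
  · rintro ⟨b, hb⟩
    exact ⟨Encodable.encode b, by simp [d, hb]⟩
  · rintro ⟨w, hw⟩
    cases hdec : Encodable.decode (α := β) w with
    | none => simp [d, hdec] at hw
    | some b => exact ⟨b, by simpa [d, hdec] using hw⟩

theorem SemiDec.exists {p : α → β → Prop} (hp : SemiDec fun q : α × β => p q.1 q.2) :
    SemiDec fun a => ∃ b, p a b := by
  obtain ⟨A, hA, hp⟩ := hp
  refine SemiDec.of_exists (β := β × ℕ) (fun a w => A (a, w.1) w.2)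
    (hA.comp (f := fun q : α × (β × ℕ) => ((q.1, q.2.1), q.2.2)) (by fun_prop)) fun a => ?_
  simp only [Prod.exists]
  exact exists_congr fun b => hp (a, b)

theorem SemiDec.and {p q : α → Prop} (hp : SemiDec p) (hq : SemiDec q) :
    SemiDec fun a => p a ∧ q a := by
  obtain ⟨A, hA, hp⟩ := hp
  obtain ⟨B, hB, hq⟩ := hq
  have hA' := hA.comp (f := fun q : α × (ℕ × ℕ) => (q.1, q.2.1)) (by fun_prop)
  have hB' := hB.comp (f := fun q : α × (ℕ × ℕ) => (q.1, q.2.2)) (by fun_prop)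
  refine SemiDec.of_exists (β := ℕ × ℕ) (fun a w => A a w.1 ∧ B a w.2) (hA'.and hB') fun a => ?_
  simp only [Prod.exists, hp, hq]
  tauto

theorem SemiDec.or {p q : α → Prop} (hp : SemiDec p) (hq : SemiDec q) :
    SemiDec fun a => p a ∨ q a := by
  obtain ⟨A, hA, hp⟩ := hp
  obtain ⟨B, hB, hq⟩ := hq
  refine ⟨fun a w => A a w ∨ B a w, hA.or hB, fun a => ?_⟩
  simp only [hp, hq, exists_or]

theorem SemiDec.exMem {l : α → List β} {p : α → β → Prop} (hl : Primrec l)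
    (hp : SemiDec fun q : α × β => p q.1 q.2) : SemiDec fun a => ExMem (l a) (p a) := by
  have h : PrimrecPred fun q : α × β => ExMem (l q.1) fun b => b = q.2 := by fun_prop
  refine (SemiDec.exists (p := fun a b => (ExMem (l a) fun c => c = b) ∧ p a b)
    (h.semiDec.and hp)).of_iff fun a => ?_
  simp [ExMem]

/-- The entries of a finite list need only finitely many witnesses, and a common strict bound for
them serves as a single witness. -/
theorem SemiDec.allMem {l : α → List β} {p : α → β → Prop} (hl : Primrec l)
    (hp : SemiDec fun q : α × β => p q.1 q.2) : SemiDec fun a => AllMem (l a) (p a) := by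
  obtain ⟨A, hA, hp⟩ := hp
  have hA' := hA.comp (f := fun q : ((α × ℕ) × β) × ℕ => ((q.1.1.1, q.1.2), q.2)) (by fun_prop)
  refine ⟨fun a w => AllMem (l a) fun b => ExLt w fun v => A (a, b) v,
    primrecPred_allMem (hl.comp Primrec.fst) (primrecPred_exLt (by fun_prop) hA'), fun a => ?_⟩
  constructor
  · intro h
    have h' : ∀ b : β, ∃ v, b ∈ l a → A (a, b) v := fun b => by
      by_cases hb : b ∈ l a
      · obtain ⟨v, hv⟩ := (hp (a, b)).1 (h b hb)
        exact ⟨v, fun _ => hv⟩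
      · exact ⟨0, fun h => absurd h hb⟩
    choose v hv using h'
    refine ⟨((l a).map v).sum + 1, fun b hb => ⟨v b, ?_, hv b hb⟩⟩
    exact Nat.lt_succ_of_le (List.le_sum_of_mem (List.mem_map_of_mem hb))
  · rintro ⟨w, hw⟩ b hb
    obtain ⟨v, -, hv⟩ := hw b hb
    exact (hp (a, b)).2 ⟨v, hv⟩

theorem SemiDec.allLt {n : α → ℕ} {p : α → ℕ → Prop} (hn : Primrec n)
    (hp : SemiDec fun q : α × ℕ => p q.1 q.2) : SemiDec fun a => AllLt (n a) (p a) :=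
  (SemiDec.allMem (primrec_list_range hn) hp).of_iff fun a => by simp [AllMem, AllLt]

/-- A finite conjunction of semidecidable predicates is semidecidable. -/
theorem SemiDec.forall_finset {ι : Type*} (s : Finset ι) {p : ι → α → Prop}
    (hp : ∀ i ∈ s, SemiDec (p i)) : SemiDec fun a => ∀ i ∈ s, p i a := by
  classical
  induction s using Finset.induction_on with
  | empty => exact PrimrecPred.semiDec ((primrecPred_eq (primrec_const 0)
      (primrec_const 0)).of_eq fun a => by simp)
  | insert i s _ ih =>
    refine ((hp i (by simp)).and (ih fun j hj => hp j (by simp [hj]))).of_iff fun a => ?_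
    simp

/-- Searching for a solution of a semidecidable condition. -/
theorem SemiDec.exists_partrec {p : α → β → Prop} (hp : SemiDec fun q : α × β => p q.1 q.2) :
    ∃ Φ : α →. β, Partrec Φ ∧ (∀ a, ∀ b ∈ Φ a, p a b) ∧ ∀ a, (∃ b, p a b) → (Φ a).Dom := by
  obtain ⟨A, hA, hp⟩ := hp
  obtain ⟨Φ, h1, h2, h3⟩ := exists_partrec_search (P := fun a b w => A (a, b) w)
    (hA.comp (f := fun q : α × β × ℕ => ((q.1, q.2.1), q.2.2)) (by fun_prop))
  refine ⟨Φ, h1, fun a b hb => (hp (a, b)).2 (h2 a b hb), fun a ⟨b, hb⟩ => h3 a ⟨b, ?_⟩⟩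
  exact (hp (a, b)).1 hb

end Semidecidable

/-! ### Comparing described algebraic numbers with rational numbers -/

/-- Numerator and denominator of the value of a polynomial at `a / d`. -/
def polyFrac (p : List ℤ) (a d : ℤ) : ℤ × ℤ :=
  p.foldr (fun c q => (c * (d * q.2) + a * q.1, d * q.2)) (0, 1)

theorem polyFrac_snd_pos (p : List ℤ) (a : ℤ) {d : ℤ} (hd : 0 < d) : 0 < (polyFrac p a d).2 := by
  induction p with
  | nil => simp [polyFrac]
  | cons c p ih => exact mul_pos hd ih

theorem evalPoly_div (p : List ℤ) (a : ℤ) {d : ℤ} (hd : 0 < d) :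
    evalPoly p (a / d) = (polyFrac p a d).1 / (polyFrac p a d).2 := by
  induction p with
  | nil => simp [polyFrac, evalPoly]
  | cons c p ih =>
    have h1 : evalPoly (c :: p) ((a : ℝ) / d) = c + a / d * evalPoly p (a / d) := rfl
    have h2 : polyFrac (c :: p) a d = (c * (d * (polyFrac p a d).2) + a * (polyFrac p a d).1,
      d * (polyFrac p a d).2) := rfl
    have h3 : ((polyFrac p a d).2 : ℝ) ≠ 0 := by
      exact_mod_cast (polyFrac_snd_pos p a hd).ne'
    have h4 : (d : ℝ) ≠ 0 := by exact_mod_cast hd.ne'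
    rw [h1, h2, ih]
    push_cast
    field_simp

theorem continuous_evalPoly (p : List ℤ) : Continuous (evalPoly p) := by
  induction p with
  | nil => exact continuous_const
  | cons c p ih => exact continuous_const.add (continuous_id.mul ih)

/-- The number with the given description is smaller than `a / d`. -/
def codeLt (c : AlgCode) (a d : ℤ) : Prop :=
  c.2.2.1 * d ≤ a * (c.2.2.2 + 1 : ℕ) ∨ (c.2.1.1 * d < a * (c.2.1.2 + 1 : ℕ) ∧
    0 < (polyFrac c.1 a d).1 * (polyFrac c.1 c.2.2.1 (c.2.2.2 + 1 : ℕ)).1)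

theorem RatCode.toReal_eq (q : RatCode) : q.toReal = (q.1 : ℝ) / ((q.2 + 1 : ℕ) : ℤ) := by
  simp [RatCode.toReal]

/-- Since `x` is the only root in the isolating interval and the signs at its ends differ, the
polynomial has the sign of its value at `hi` to the right of `x` and the sign of its value at `lo`
to the left. Denominators are positive, so the numerators decide. -/
theorem codeLt_iff {c : AlgCode} {x : ℝ} (h : Describes c x) (a : ℤ) {d : ℤ} (hd : 0 < d) :
    codeLt c a d ↔ x < a / d := by
  obtain ⟨p, lo, hi⟩ := c
  obtain ⟨hlo, hhi, hx, huniq, hsign⟩ := h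
  simp only at hlo hhi hx huniq hsign
  have hd' : (0 : ℝ) < d := by exact_mod_cast hd
  have hcmp : ∀ q : RatCode, (q.1 * d ≤ a * (q.2 + 1 : ℕ) ↔ q.toReal ≤ a / d) := fun q => by
    rw [RatCode.toReal, div_le_div_iff₀ (by positivity) hd']
    norm_cast
  have hcmp' : ∀ q : RatCode, (q.1 * d < a * (q.2 + 1 : ℕ) ↔ q.toReal < a / d) := fun q => by
    rw [RatCode.toReal, div_lt_div_iff₀ (by positivity) hd']
    norm_cast
  have hpos : (0 < (polyFrac p a d).1 * (polyFrac p hi.1 (hi.2 + 1 : ℕ)).1 ↔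
      0 < evalPoly p (a / d) * evalPoly p hi.toReal) := by
    have h1 := polyFrac_snd_pos p a hd
    have h2 := polyFrac_snd_pos p hi.1 (d := (hi.2 + 1 : ℕ)) (by positivity)
    rw [RatCode.toReal_eq, evalPoly_div p a hd, evalPoly_div p hi.1 (by positivity),
      div_mul_div_comm, div_pos_iff_of_pos_right (by exact_mod_cast mul_pos h1 h2)]
    norm_cast
  unfold codeLt
  simp only [hcmp, hcmp', hpos]
  have hc := continuous_evalPoly p
  constructor
  · rintro (h | ⟨h1, h2⟩)
    · exact hhi.trans_le h
    · by_contra hle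
      push Not at hle
      have h3 : (a / d : ℝ) < hi.toReal := hle.trans_lt hhi
      rcases hle.eq_or_lt with he | hlt
      · rw [he, hx] at h2; simp at h2
      -- The value at `a / d` has the sign of that at `hi`, opposite to that at `lo`; a second root
      -- between `lo` and `a / d < x` would follow.
      have h4 : evalPoly p lo.toReal * evalPoly p (a / d) < 0 := by
        nlinarith [mul_self_nonneg (evalPoly p hi.toReal), mul_pos h2 (neg_pos.2 hsign)]
      have : (0 : ℝ) ∈ (fun y => evalPoly p lo.toReal * evalPoly p y) ''
          Set.Icc lo.toReal (a / d) := by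
        apply intermediate_value_Icc' h1.le (continuous_const.mul hc).continuousOn
        exact ⟨h4.le, mul_self_nonneg _⟩
      obtain ⟨y, ⟨hy1, hy2⟩, hy⟩ := this
      have hlo0 : evalPoly p lo.toReal ≠ 0 := fun h0 => by simp [h0] at hsign
      have hy0 : evalPoly p y = 0 := (mul_eq_zero.1 hy).resolve_left hlo0
      have hylo : lo.toReal ≠ y := fun h => hlo0 (h ▸ hy0)
      have := huniq y (lt_of_le_of_ne hy1 hylo) (hy2.trans_lt h3) hy0
      linarith
  · intro hlt
    rcases le_or_gt hi.toReal (a / d) with h | h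
    · exact Or.inl h
    refine Or.inr ⟨hlo.trans hlt, ?_⟩
    by_contra hle
    push Not at hle
    have : (0 : ℝ) ∈ (fun y => evalPoly p y * evalPoly p hi.toReal) ''
        Set.Icc (a / d : ℝ) hi.toReal := by
      apply intermediate_value_Icc h.le (hc.mul continuous_const).continuousOn
      exact ⟨hle, mul_self_nonneg _⟩
    obtain ⟨y, ⟨hy1, hy2⟩, hy⟩ := this
    have hhi0 : evalPoly p hi.toReal ≠ 0 := fun h0 => by simp [h0] at hsign
    have hy0 : evalPoly p y = 0 := (mul_eq_zero.1 hy).resolve_right hhi0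
    have hyhi : y ≠ hi.toReal := fun h => hhi0 (h ▸ hy0)
    have := huniq y ((hlo.trans hlt).trans_le hy1) (lt_of_le_of_ne hy2 hyhi) hy0
    linarith

section

variable {α : Type*} [Primcodable α]

@[fun_prop] theorem primrec_polyFrac {p : α → List ℤ} {a d : α → ℤ} (hp : Primrec p)
    (ha : Primrec a) (hd : Primrec d) : Primrec fun x => polyFrac (p x) (a x) (d x) := by
  unfold polyFrac
  refine Primrec.list_foldr (h := fun x (q : ℤ × (ℤ × ℤ)) =>
    (q.1 * (d x * q.2.2) + a x * q.2.1, d x * q.2.2)) hp (primrec_const _) ?_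
  unfold Primrec₂
  fun_prop

@[fun_prop] theorem primrecPred_codeLt {c : α → AlgCode} {a d : α → ℤ} (hc : Primrec c)
    (ha : Primrec a) (hd : Primrec d) : PrimrecPred fun x => codeLt (c x) (a x) (d x) := by
  unfold codeLt
  fun_prop

end

/-! ### Comparing logarithms with rational numbers -/

/-- A sufficient condition for `log x < t / m`. -/
def codeLogLt (c : AlgCode) (t : ℤ) (m N : ℕ) : Prop :=
  0 < (m * N : ℕ) + t ∧ codeLt c (((m * N : ℕ) + t) ^ N) ((m * N : ℕ) ^ N)

/-- A sufficient condition for `t / m ≤ log x`. -/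
def codeLeLog (c : AlgCode) (t : ℤ) (m N : ℕ) : Prop :=
  0 < (m * N : ℕ) - t ∧ ¬ codeLt c ((m * N : ℕ) ^ N) (((m * N : ℕ) - t) ^ N)

section

variable {α : Type*} [Primcodable α]

@[fun_prop] theorem primrecPred_codeLogLt {c : α → AlgCode} {t : α → ℤ} {m N : α → ℕ}
    (hc : Primrec c) (ht : Primrec t) (hm : Primrec m) (hN : Primrec N) :
    PrimrecPred fun x => codeLogLt (c x) (t x) (m x) (N x) := by
  unfold codeLogLt
  fun_prop

@[fun_prop] theorem primrecPred_codeLeLog {c : α → AlgCode} {t : α → ℤ} {m N : α → ℕ}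
    (hc : Primrec c) (ht : Primrec t) (hm : Primrec m) (hN : Primrec N) :
    PrimrecPred fun x => codeLeLog (c x) (t x) (m x) (N x) := by
  unfold codeLeLog
  fun_prop

end

theorem one_add_div_pow_le_exp {t : ℝ} {N : ℕ} (hN : 0 < N) (h : 0 ≤ 1 + t / N) :
    (1 + t / N) ^ N ≤ Real.exp t := by
  have hN' : (N : ℝ) ≠ 0 := by positivity
  calc (1 + t / N) ^ N ≤ Real.exp (t / N) ^ N := by
        gcongr
        rw [add_comm]
        exact Real.add_one_le_exp _
    _ = Real.exp t := by rw [← Real.exp_nat_mul, mul_div_cancel₀ _ hN']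

theorem frac_pow_eq {m N : ℕ} (hm : 0 < m) (hN : 0 < N) (t : ℤ) :
    ((((m * N : ℕ) + t) ^ N : ℤ) : ℝ) / (((m * N : ℕ) ^ N : ℤ) : ℝ) =
      (1 + (t / m : ℝ) / N) ^ N := by
  push_cast
  rw [← div_pow]
  congr 1
  field_simp

/-- With `u = t / m`, the number described is compared with the rational number `(1 + u / N) ^ N`,
which is at most `exp u`. -/
theorem log_lt_of_codeLogLt {c : AlgCode} {x : ℝ} (h : Describes c x) (hx : 0 < x) {t : ℤ}
    {m N : ℕ} (hm : 0 < m) (hN : 0 < N) (hc : codeLogLt c t m N) : Real.log x < t / m := by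
  obtain ⟨h1, h2⟩ := hc
  rw [codeLt_iff h _ (by positivity), frac_pow_eq hm hN] at h2
  rw [Real.log_lt_iff_lt_exp hx]
  refine h2.trans_le (one_add_div_pow_le_exp hN ?_)
  have : (1 + (t / m : ℝ) / N) = ((m * N : ℕ) + t : ℤ) / (m * N : ℕ) := by
    push_cast
    field_simp
  rw [this]
  have h1' : (0 : ℝ) < ((m * N : ℕ) + t : ℤ) := by exact_mod_cast h1
  positivity

/-- An upper bound for `exp u` is the reciprocal of the lower bound `(1 - u / N) ^ N` for `exp
(-u)`. -/
theorem le_log_of_codeLeLog {c : AlgCode} {x : ℝ} (h : Describes c x) (hx : 0 < x) {t : ℤ}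
    {m N : ℕ} (hm : 0 < m) (hN : 0 < N) (hc : codeLeLog c t m N) : t / m ≤ Real.log x := by
  obtain ⟨h1, h2⟩ := hc
  have h1' : (0 : ℝ) < (((m * N : ℕ) - t : ℤ) : ℝ) := by exact_mod_cast h1
  rw [codeLt_iff h _ (by positivity), not_lt] at h2
  rw [Real.le_log_iff_exp_le hx]
  refine le_trans ?_ h2
  have h3 := frac_pow_eq hm hN (-t)
  rw [← sub_eq_add_neg] at h3
  rw [← inv_div (_ : ℝ) (((m * N : ℕ) ^ N : ℤ) : ℝ), h3, ← inv_inv (Real.exp _), ← Real.exp_neg]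
  have h4 : (1 + (((-t : ℤ) : ℝ) / m : ℝ) / N) = (((m * N : ℕ) - t : ℤ) : ℝ) / (m * N : ℕ) := by
    push_cast
    field_simp
    ring
  have h5 : 0 < (1 + (((-t : ℤ) : ℝ) / m : ℝ) / N) := by
    rw [h4]; positivity
  gcongr
  have := one_add_div_pow_le_exp hN h5.le
  rwa [show (((-t : ℤ) : ℝ) / m : ℝ) = -(t / m) by push_cast; ring] at this ⊢

/-- The bounds `(1 + u / N) ^ N` converge to `exp u`, so a strict inequality is detected by all
large `N`. -/
theorem eventually_codeLogLt {c : AlgCode} {x : ℝ} (h : Describes c x) (hx : 0 < x) {t : ℤ}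
    {m : ℕ} (hm : 0 < m) (hlt : Real.log x < t / m) :
    ∀ᶠ N in Filter.atTop, codeLogLt c t m N := by
  rw [Real.log_lt_iff_lt_exp hx] at hlt
  have h1 := (Real.tendsto_one_add_div_pow_exp (t / m)).eventually (lt_mem_nhds hlt)
  -- The condition `N > |t|` makes `m * N + t` positive.
  filter_upwards [h1, Filter.eventually_gt_atTop 0, Filter.eventually_gt_atTop t.natAbs]
    with N hN h0 ht
  have : N ≤ m * N := Nat.le_mul_of_pos_left N hm
  refine ⟨by omega, ?_⟩
  rwa [codeLt_iff h _ (by positivity), frac_pow_eq hm h0]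

theorem eventually_codeLeLog {c : AlgCode} {x : ℝ} (h : Describes c x) (hx : 0 < x) {t : ℤ}
    {m : ℕ} (hm : 0 < m) (hlt : t / m < Real.log x) :
    ∀ᶠ N in Filter.atTop, codeLeLog c t m N := by
  rw [Real.lt_log_iff_exp_lt hx] at hlt
  have hlt' : x⁻¹ < Real.exp (((-t : ℤ) : ℝ) / m) := by
    rw [show (((-t : ℤ) : ℝ) / m : ℝ) = -(t / m) by push_cast; ring, Real.exp_neg]
    gcongr
  have h1 := (Real.tendsto_one_add_div_pow_exp (((-t : ℤ) : ℝ) / m)).eventually (lt_mem_nhds hlt')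
  filter_upwards [h1, Filter.eventually_gt_atTop 0, Filter.eventually_gt_atTop t.natAbs]
    with N hN h0 ht
  have : N ≤ m * N := Nat.le_mul_of_pos_left N hm
  have hpos : 0 < ((m * N : ℕ) - t : ℤ) := by omega
  refine ⟨hpos, ?_⟩
  have h3 := frac_pow_eq hm h0 (-t)
  rw [← sub_eq_add_neg] at h3
  rw [codeLt_iff h _ (by positivity), not_lt, ← inv_div, h3]
  exact (inv_le_comm₀ hx ((inv_pos.2 hx).trans hN)).1 hN.le


/-! ### The norm dual to the maximum norm of the image under a matrix -/

section DualNorm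

open Matrix

variable {ι : Type*} [Fintype ι] {n : ℕ}

/-- The linear form `x ↦ b ⬝ᵥ x` is bounded by `c` times the maximum norm of `R *ᵥ x`. -/
def DualLE (R : Matrix ι (Fin n) ℝ) (b : Fin n → ℝ) (c : ℝ) : Prop :=
  ∀ x : Fin n → ℝ, b ⬝ᵥ x ≤ c * ‖R *ᵥ x‖

/-- The dual norm of the linear form `x ↦ b ⬝ᵥ x`. -/
noncomputable def coNorm (R : Matrix ι (Fin n) ℝ) (b : Fin n → ℝ) : ℝ :=
  sInf {c | 0 ≤ c ∧ DualLE R b c}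

variable {R : Matrix ι (Fin n) ℝ} {b : Fin n → ℝ} {c : ℝ}

theorem DualLE.mono {c' : ℝ} (h : DualLE R b c) (hc : c ≤ c') : DualLE R b c' := fun x =>
  (h x).trans (mul_le_mul_of_nonneg_right hc (norm_nonneg _))

theorem abs_dotProduct_le (v w : ι → ℝ) : |v ⬝ᵥ w| ≤ (∑ i, |v i|) * ‖w‖ := by
  rw [Finset.sum_mul]
  refine (Finset.abs_sum_le_sum_abs _ _).trans (Finset.sum_le_sum fun i _ => ?_)
  rw [abs_mul]
  gcongr
  exact norm_le_pi_norm w i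

theorem dualLE_of_vecMul {r : ι → ℝ} (hr : r ᵥ* R = b) (hc : ∑ i, |r i| ≤ c) : DualLE R b c := by
  intro x
  rw [← hr, ← dotProduct_mulVec]
  exact (le_abs_self _).trans ((abs_dotProduct_le _ _).trans
    (mul_le_mul_of_nonneg_right hc (norm_nonneg _)))

/-- The Hahn-Banach theorem for the maximum norm. -/
theorem DualLE.exists_vecMul (hR : Function.Injective R.mulVec) (hc : 0 ≤ c)
    (h : DualLE R b c) : ∃ r : ι → ℝ, r ᵥ* R = b ∧ ∑ i, |r i| ≤ c := by
  classical
  let e := LinearEquiv.ofInjective R.mulVecLin hR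
  -- By injectivity, `x ↦ b ⬝ᵥ x` is a linear form on the range of `R`, bounded by `c` there; it is
  -- extended to the whole space with the same norm.
  let φ : (LinearMap.range R.mulVecLin) →ₗ[ℝ] ℝ :=
    (dotProductBilin ℝ ℝ b).comp e.symm.toLinearMap
  have hφ : ∀ x, φ (e x) = b ⬝ᵥ x := fun x => by simp [φ, dotProductBilin]
  have hbound : ∀ y, ‖φ y‖ ≤ c * ‖y‖ := by
    intro y
    obtain ⟨x, rfl⟩ := e.surjective y
    rw [hφ, Real.norm_eq_abs, abs_le']
    have he : ‖e x‖ = ‖R *ᵥ x‖ := rfl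
    rw [he]
    refine ⟨h x, ?_⟩
    have := h (-x)
    rwa [dotProduct_neg, mulVec_neg, norm_neg] at this
  let f : StrongDual ℝ (LinearMap.range R.mulVecLin) := φ.mkContinuous c hbound
  obtain ⟨g, hg, hgn⟩ := _root_.exists_extension_norm_eq _ f
  have hgc : ‖g‖ ≤ c := hgn ▸ φ.mkContinuous_norm_le hc hbound
  have hgr : ∀ y : ι → ℝ, g y = (fun i => g (Pi.single i 1)) ⬝ᵥ y := by
    intro y
    conv_lhs => rw [← Finset.univ_sum_single y]
    rw [map_sum]
    refine Finset.sum_congr rfl fun i _ => ?_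
    rw [mul_comm, ← smul_eq_mul, ← map_smul]
    congr 1
    rw [← Pi.single_smul, smul_eq_mul, mul_one]
  refine ⟨fun i => g (Pi.single i 1), ?_, ?_⟩
  · refine dotProduct_eq _ _ fun x => ?_
    rw [← dotProduct_mulVec, ← hgr]
    have := hg (e x)
    rw [show ((e x : LinearMap.range R.mulVecLin) : ι → ℝ) = R *ᵥ x from rfl] at this
    rw [this]
    exact hφ x
  -- The vector of signs has maximum norm at most `1`, and the extension takes there the ℓ¹-norm of
  -- its coefficients as value.
  · let σ : ι → ℝ := fun i => SignType.sign (g (Pi.single i 1))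
    have h1 : g σ = ∑ i, |g (Pi.single i 1)| := by
      rw [hgr]
      exact Finset.sum_congr rfl fun i _ => self_mul_sign _
    have h2 : ‖σ‖ ≤ 1 := by
      rw [pi_norm_le_iff_of_nonneg zero_le_one]
      intro i
      simp only [σ]
      rcases SignType.sign (g (Pi.single i 1)) with _ | _ | _ <;> simp
    rw [← h1]
    calc g σ ≤ ‖g σ‖ := le_abs_self _
      _ ≤ ‖g‖ * ‖σ‖ := g.le_opNorm σ
      _ ≤ c * 1 := mul_le_mul hgc h2 (norm_nonneg _) hc
      _ = c := mul_one c

theorem exists_mul_norm_le (hR : Function.Injective R.mulVec) :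
    ∃ κ : ℝ, 0 < κ ∧ ∀ x, κ * ‖x‖ ≤ ‖R *ᵥ x‖ := by
  obtain ⟨K, hK, h⟩ := R.mulVecLin.exists_antilipschitzWith (LinearMap.ker_eq_bot.2 hR)
  have hK' : (0 : ℝ) < K := by exact_mod_cast hK
  refine ⟨(K : ℝ)⁻¹, inv_pos.2 hK', fun x => ?_⟩
  have := h.le_mul_dist x 0
  rw [dist_zero_right, map_zero, dist_zero_right] at this
  rw [inv_mul_le_iff₀ hK']
  exact this

theorem exists_dualLE (hR : Function.Injective R.mulVec) (b : Fin n → ℝ) :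
    ∃ c, 0 ≤ c ∧ DualLE R b c := by
  obtain ⟨κ, hκ, h⟩ := exists_mul_norm_le hR
  refine ⟨(∑ j, |b j|) / κ, by positivity, fun x => ?_⟩
  refine (le_abs_self _).trans ((abs_dotProduct_le b x).trans ?_)
  rw [div_mul_eq_mul_div, le_div_iff₀ hκ, mul_assoc]
  gcongr
  rw [mul_comm]
  exact h x

theorem coNorm_nonneg (R : Matrix ι (Fin n) ℝ) (b : Fin n → ℝ) : 0 ≤ coNorm R b :=
  Real.sInf_nonneg fun _ h => h.1

/-- The infimum is itself admissible: where `R *ᵥ x` is nonzero, every admissible constant is at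
least the quotient of `b ⬝ᵥ x` by `‖R *ᵥ x‖`; where it vanishes, the inequality does not involve the
constant. -/
theorem dualLE_coNorm (hR : Function.Injective R.mulVec) (b : Fin n → ℝ) :
    DualLE R b (coNorm R b) := by
  obtain ⟨c₀, hc₀⟩ := exists_dualLE hR b
  intro x
  rcases (norm_nonneg (R *ᵥ x)).eq_or_lt with h | h
  · have := hc₀.2 x
    rwa [← h, mul_zero] at this ⊢
  · rw [← div_le_iff₀ h]
    refine le_csInf ⟨c₀, hc₀⟩ fun c hc => ?_
    rw [div_le_iff₀ h]
    exact hc.2 x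

theorem dualLE_iff (hR : Function.Injective R.mulVec) (hc : 0 ≤ c) :
    DualLE R b c ↔ coNorm R b ≤ c :=
  ⟨fun h => csInf_le ⟨0, fun _ h => h.1⟩ ⟨hc, h⟩, fun h => (dualLE_coNorm hR b).mono h⟩

/-- The form is tested on plus and minus the unit vectors, whose images have norm at most `G`. This
leaves finitely many integral vectors below any bound for the dual norm. -/
theorem abs_le_of_dualLE [Nonempty ι] {G : ℝ} (hG : ∀ i, ∑ j, |R i j| ≤ G) (hc : 0 ≤ c) (h : DualLE R b c)
    (j : Fin n) : |b j| ≤ c * G := by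
  classical
  have hG0 : ‖R *ᵥ Pi.single j 1‖ ≤ max G 0 := by
    rw [pi_norm_le_iff_of_nonneg (le_max_right _ _)]
    intro i
    rw [mulVec_single_one]
    exact (Finset.single_le_sum (f := fun j => |R i j|) (fun _ _ => abs_nonneg _)
      (Finset.mem_univ j)).trans ((hG i).trans (le_max_left _ _))
  have key : |b j| ≤ c * ‖R *ᵥ Pi.single j 1‖ := by
    have h1 := h (Pi.single j 1)
    have h2 := h (-Pi.single j 1)
    rw [dotProduct_neg, mulVec_neg, norm_neg] at h2
    rw [dotProduct_single_one] at h1 h2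
    exact abs_le'.2 ⟨h1, h2⟩
  have : 0 ≤ G := le_trans (Finset.sum_nonneg fun _ _ => abs_nonneg _) (hG (Classical.arbitrary ι))
  rw [max_eq_left this] at hG0
  exact key.trans (mul_le_mul_of_nonneg_left hG0 hc)

theorem tendsto_round_mul_div (x : ℝ) :
    Filter.Tendsto (fun N : ℕ => ((round (x * N) : ℤ) : ℝ) / N) Filter.atTop (nhds x) := by
  rw [tendsto_iff_dist_tendsto_zero]
  refine squeeze_zero' (Filter.Eventually.of_forall fun _ => dist_nonneg) ?_
    tendsto_one_div_atTop_nhds_zero_nat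
  filter_upwards [Filter.eventually_gt_atTop 0] with N hN
  have hN' : (0 : ℝ) < N := by exact_mod_cast hN
  rw [dist_comm, Real.dist_eq, le_div_iff₀ hN']
  rw [← abs_of_pos hN', ← abs_mul, abs_of_pos hN', sub_mul, div_mul_cancel₀ _ hN'.ne']
  exact (abs_sub_round _).trans (by norm_num)

/-- The failure of an upper bound for the dual norm is witnessed by an integral vector. -/
theorem exists_int_of_not_dualLE (h : ¬ DualLE R b c) :
    ∃ y : Fin n → ℤ, c * ‖R *ᵥ fun j => (y j : ℝ)‖ < b ⬝ᵥ fun j => (y j : ℝ) := by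
  unfold DualLE at h
  push Not at h
  obtain ⟨x, hx⟩ := h
  have hcont : Continuous fun x : Fin n → ℝ => b ⬝ᵥ x - c * ‖R *ᵥ x‖ := by
    have h1 : Continuous fun x : Fin n → ℝ => R *ᵥ x := R.mulVecLin.continuous_of_finiteDimensional
    exact (Continuous.dotProduct continuous_const continuous_id).sub
      (continuous_const.mul h1.norm)
  -- A strict inequality persists at a nearby rational vector with denominator `N`, and by
  -- homogeneity the denominator can be cleared.
  have hlim : Filter.Tendsto (fun N : ℕ => fun j => ((round (x j * N) : ℤ) : ℝ) / N) Filter.atTop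
      (nhds x) := by
    rw [tendsto_pi_nhds]
    intro j
    exact tendsto_round_mul_div (x j)
  have := ((hcont.tendsto x).comp hlim).eventually (lt_mem_nhds (sub_pos.2 hx))
  obtain ⟨N, hN, hpos⟩ := (this.and (Filter.eventually_gt_atTop 0)).exists
  refine ⟨fun j => round (x j * N), ?_⟩
  have hN' : (0 : ℝ) < N := by exact_mod_cast hpos
  have hv : (fun j => ((round (x j * N) : ℤ) : ℝ) / N) = (N : ℝ)⁻¹ • fun j => ((round (x j * N) : ℤ) : ℝ) := by
    ext j
    simp [div_eq_inv_mul]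
  simp only [Function.comp] at hN
  rw [hv, dotProduct_smul, mulVec_smul, norm_smul, norm_inv, Real.norm_natCast, smul_eq_mul,
    mul_left_comm, ← mul_sub] at hN
  exact sub_pos.1 (pos_of_mul_pos_right hN (inv_pos.2 hN').le)

/-- An upper bound for the dual norm follows from finitely many inequalities for integral vectors. -/
theorem dualLE_of_box {G : ℝ} (hG : ∀ i, ∑ j, |R i j| ≤ G) (hc : 0 ≤ c) {D : ℕ} (hD : 0 < D)
    (h : ∀ y : Fin n → ℤ, (∀ j, |y j| ≤ D) → (∃ j, |y j| = D) →
      ∃ i, (b ⬝ᵥ fun j => (y j : ℝ)) + ∑ j, |b j| ≤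
        c * (|(R *ᵥ fun j => (y j : ℝ)) i| - G)) : DualLE R b c := by
  intro x
  rcases eq_or_ne x 0 with rfl | hx
  · simp
  have hn : 0 < ‖x‖ := norm_pos_iff.2 hx
  have hD' : (0 : ℝ) < D := by exact_mod_cast hD
  -- After scaling to maximum norm exactly `D`, the coordinate of absolute value `D` is an integer
  -- and survives rounding, so the rounded vector lies on the boundary of the cube.
  set a : ℝ := D / ‖x‖ with ha
  have ha0 : 0 < a := by positivity
  set z : Fin n → ℝ := a • x with hz
  have hzn : ‖z‖ = D := by
    rw [hz, norm_smul, Real.norm_of_nonneg ha0.le, ha, div_mul_cancel₀ _ hn.ne']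
  let y : Fin n → ℤ := fun j => round (z j)
  have hy : ∀ j, |z j - y j| ≤ 1 / 2 := fun j => abs_sub_round _
  have hzj : ∀ j, |z j| ≤ D := fun j => hzn ▸ norm_le_pi_norm z j
  have hyD : ∀ j, |y j| ≤ D := by
    intro j
    have h1 : |(y j : ℝ)| < D + 1 := by
      have := abs_sub_abs_le_abs_sub (y j : ℝ) (z j)
      rw [abs_sub_comm] at this
      linarith [hy j, hzj j]
    have h2 : |y j| < (D : ℤ) + 1 := by exact_mod_cast h1
    omega
  have hyE : ∃ j, |y j| = D := by
    have : ∃ j, |z j| = D := by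
      by_contra hne
      push Not at hne
      have : ‖z‖ < D := by
        rw [pi_norm_lt_iff hD']
        exact fun j => lt_of_le_of_ne (hzj j) (hne j)
      exact this.ne hzn
    obtain ⟨j, hj⟩ := this
    refine ⟨j, ?_⟩
    rcases eq_or_eq_neg_of_abs_eq hj with hj | hj
    · simp only [y, hj, round_natCast]; simp
    · have : z j = ((-D : ℤ) : ℝ) := by rw [hj]; simp
      simp only [y, this, round_intCast]; simp
  obtain ⟨i, hi⟩ := h y hyD hyE
  -- Rounding therefore changes `b ⬝ᵥ z` by at most `∑ j, |b j|` and each coordinate of `R *ᵥ z` by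
  -- at most `G`, the two margins in the hypothesis.
  have hzy : ‖z - fun j => (y j : ℝ)‖ ≤ 1 := by
    rw [pi_norm_le_iff_of_nonneg zero_le_one]
    exact fun j => (hy j).trans (by norm_num)
  have h1 : b ⬝ᵥ z ≤ (b ⬝ᵥ fun j => (y j : ℝ)) + ∑ j, |b j| := by
    have := (le_abs_self _).trans (abs_dotProduct_le b (z - fun j => (y j : ℝ)))
    rw [dotProduct_sub] at this
    have h2 : (∑ j, |b j|) * ‖z - fun j => (y j : ℝ)‖ ≤ ∑ j, |b j| :=
      mul_le_of_le_one_right (Finset.sum_nonneg fun _ _ => abs_nonneg _) hzy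
    linarith
  have h2 : |(R *ᵥ fun j => (y j : ℝ)) i| - G ≤ ‖R *ᵥ z‖ := by
    have h3 := abs_dotProduct_le (R i) ((fun j => (y j : ℝ)) - z)
    rw [dotProduct_sub, ← norm_neg, neg_sub] at h3
    have h4 : (∑ j, |R i j|) * ‖z - fun j => (y j : ℝ)‖ ≤ ∑ j, |R i j| :=
      mul_le_of_le_one_right (Finset.sum_nonneg fun _ _ => abs_nonneg _) hzy
    have h5 := abs_sub_abs_le_abs_sub (R i ⬝ᵥ fun j => (y j : ℝ)) (R i ⬝ᵥ z)
    have h6 : |R i ⬝ᵥ z| ≤ ‖R *ᵥ z‖ := norm_le_pi_norm (R *ᵥ z) i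
    have h7 : (R *ᵥ fun j => (y j : ℝ)) i = R i ⬝ᵥ fun j => (y j : ℝ) := rfl
    rw [h7]
    linarith [hG i]
  have h3 : b ⬝ᵥ z ≤ c * ‖R *ᵥ z‖ := h1.trans (hi.trans (mul_le_mul_of_nonneg_left h2 hc))
  rw [hz, dotProduct_smul, mulVec_smul, norm_smul, Real.norm_of_nonneg ha0.le, smul_eq_mul,
    mul_left_comm] at h3
  exact le_of_mul_le_mul_left h3 ha0

/-- The finitely many inequalities in `dualLE_of_box` hold, with room to spare, if the dual norm is
smaller than the bound. -/
theorem exists_box_of_dualLE [Nonempty ι] (hR : Function.Injective R.mulVec) {c' : ℝ}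
    (h : DualLE R b c') (hc : c' < c) (G : ℝ) :
    ∃ D : ℕ, 0 < D ∧ ∀ y : Fin n → ℤ, (∃ j, |y j| = D) →
      ∃ i, (b ⬝ᵥ fun j => (y j : ℝ)) + ∑ j, |b j| < c * (|(R *ᵥ fun j => (y j : ℝ)) i| - G) := by
  obtain ⟨κ, hκ, hκR⟩ := exists_mul_norm_le hR
  have hd : 0 < (c - c') * κ := mul_pos (sub_pos.2 hc) hκ
  -- The available gap `(c - c') * ‖R *ᵥ y‖` is at least `(c - c') * κ * ‖y‖`; on a large cube it
  -- exceeds the fixed margins.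
  obtain ⟨D, hD⟩ := exists_nat_gt ((∑ j, |b j| + c * G) / ((c - c') * κ))
  rw [div_lt_iff₀ hd] at hD
  refine ⟨D + 1, Nat.succ_pos _, fun y ⟨j, hj⟩ => ?_⟩
  set v : Fin n → ℝ := fun j => (y j : ℝ) with hv
  obtain ⟨i, hi⟩ := Finite.exists_max fun i => |(R *ᵥ v) i|
  refine ⟨i, ?_⟩
  have h1 : ‖R *ᵥ v‖ = |(R *ᵥ v) i| := by
    refine le_antisymm ?_ (norm_le_pi_norm (R *ᵥ v) i)
    rw [pi_norm_le_iff_of_nonneg (abs_nonneg _)]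
    exact hi
  have h2 : ((D + 1 : ℕ) : ℝ) ≤ ‖v‖ := by
    refine le_trans (le_of_eq ?_) (norm_le_pi_norm v j)
    rw [hv, Real.norm_eq_abs, ← Int.cast_abs, hj]
    simp
  rw [← h1]
  have h3 : κ * (D + 1 : ℕ) ≤ ‖R *ᵥ v‖ := (mul_le_mul_of_nonneg_left h2 hκ.le).trans (hκR v)
  have h4 := mul_le_mul_of_nonneg_left h3 (sub_pos.2 hc).le
  push_cast at h4
  nlinarith [h v]

end DualNorm


/-! ### Approximations of a table of logarithms -/

section Tables

open Matrix

variable {s n : ℕ}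

theorem getD_ofFn {α : Type*} (f : Fin n → α) (d : α) (i : Fin n) :
    (List.ofFn f).getD i d = f i := by
  simp [List.getD_eq_getElem?_getD]

theorem matCode_getD {α : Type} (A : Fin s → Fin n → α) (i : Fin s) (j : Fin n) (d : α) :
    ((matCode A).getD i []).getD j d = A i j := by
  rw [matCode, getD_ofFn, getD_ofFn]

/-- The real matrix `R` consists of the logarithms of the numbers described in the table. -/
def TableOf (R : Matrix (Fin s) (Fin n) ℝ) (tab : List (List AlgCode)) : Prop :=
  tab.length = s ∧ (tab.getD 0 []).length = n ∧ ∀ (i : Fin s) (j : Fin n), ∃ x : ℝ, 0 < x ∧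
    Describes ((tab.getD i []).getD j ([], (0, 0), (0, 0))) x ∧ R i j = Real.log x

/-- The integral matrix `Q` is an approximation of `m` times the matrix of the logarithms of the
numbers described in the table. -/
def Approx (tab : List (List AlgCode)) (m : ℕ) (Q : List (List ℤ)) : Prop :=
  0 < m ∧ AllLt tab.length fun i => AllLt (tab.getD 0 []).length fun j => ∃ N, 0 < N ∧
    codeLogLt ((tab.getD i []).getD j ([], (0, 0), (0, 0))) ((Q.getD i []).getD j 0 + 1) m N ∧
    codeLeLog ((tab.getD i []).getD j ([], (0, 0), (0, 0))) ((Q.getD i []).getD j 0 - 1) m N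

theorem semiDec_approx :
    SemiDec fun q : List (List AlgCode) × ℕ × List (List ℤ) => Approx q.1 q.2.1 q.2.2 := by
  unfold Approx
  refine SemiDec.and (PrimrecPred.semiDec (by fun_prop)) ?_
  refine SemiDec.allLt (by fun_prop) (SemiDec.allLt (by fun_prop) (SemiDec.exists ?_))
  exact PrimrecPred.semiDec (by fun_prop)

theorem Approx.abs_sub_le {R : Matrix (Fin s) (Fin n) ℝ} {tab : List (List AlgCode)}
    (ht : TableOf R tab) {m : ℕ} {Q : List (List ℤ)} (h : Approx tab m Q) (i : Fin s)
    (j : Fin n) : |m * R i j - (Q.getD i []).getD j 0| ≤ 1 := by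
  obtain ⟨rfl, rfl, ht⟩ := ht
  obtain ⟨hm, h⟩ := h
  obtain ⟨N, hN, h1, h2⟩ := h i i.2 j j.2
  obtain ⟨x, hx, hd, hR⟩ := ht i j
  have hm' : (0 : ℝ) < m := by exact_mod_cast hm
  have h1 := (log_lt_of_codeLogLt hd hx hm hN h1).le
  have h2 := le_log_of_codeLeLog hd hx hm hN h2
  rw [le_div_iff₀ hm', ← hR] at h1
  rw [div_le_iff₀ hm', ← hR] at h2
  push_cast at h1 h2
  rw [abs_le]
  constructor <;> linarith

theorem exists_approx {R : Matrix (Fin s) (Fin n) ℝ} {tab : List (List AlgCode)}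
    (ht : TableOf R tab) {m : ℕ} (hm : 0 < m) : ∃ Q, Approx tab m Q := by
  obtain ⟨rfl, rfl, ht⟩ := ht
  -- Rounding errs by at most `1 / 2`, so both inequalities with margin `1` are strict and can be
  -- certified.
  refine ⟨matCode fun i j => round (m * R i j), hm, fun i hi j hj => ?_⟩
  obtain ⟨x, hx, hd, hR⟩ := ht ⟨i, hi⟩ ⟨j, hj⟩
  have hm' : (0 : ℝ) < m := by exact_mod_cast hm
  have hr := abs_le.1 (abs_sub_round (m * R ⟨i, hi⟩ ⟨j, hj⟩))
  have e := matCode_getD (fun i j => round (m * R i j)) ⟨i, hi⟩ ⟨j, hj⟩ 0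
  simp only at e hd
  rw [e]
  have h1 := eventually_codeLogLt hd hx hm (t := round (m * R ⟨i, hi⟩ ⟨j, hj⟩) + 1) (by
    rw [← hR, lt_div_iff₀ hm']
    push_cast
    linarith)
  have h2 := eventually_codeLeLog hd hx hm (t := round (m * R ⟨i, hi⟩ ⟨j, hj⟩) - 1) (by
    rw [← hR, div_lt_iff₀ hm']
    push_cast
    linarith)
  obtain ⟨N, ⟨h1, h2⟩, hN⟩ := ((h1.and h2).and (Filter.eventually_gt_atTop 0)).exists
  exact ⟨N, hN, h1, h2⟩

/-- The scalar product of the first `n` entries of two lists. -/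
def listDot (n : ℕ) (b y : List ℤ) : ℤ := ∑ j ∈ Finset.range n, b.getD j 0 * y.getD j 0

/-- The sum of the absolute values of the first `n` entries of a list. -/
def listAbs (n : ℕ) (y : List ℤ) : ℤ := ∑ j ∈ Finset.range n, |y.getD j 0|

section

variable {α : Type*} [Primcodable α]

@[fun_prop] theorem primrec_listDot {n : α → ℕ} {b y : α → List ℤ} (hn : Primrec n)
    (hb : Primrec b) (hy : Primrec y) : Primrec fun a => listDot (n a) (b a) (y a) := by
  unfold listDot
  fun_prop

@[fun_prop] theorem primrec_listAbs {n : α → ℕ} {y : α → List ℤ} (hn : Primrec n)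
    (hy : Primrec y) : Primrec fun a => listAbs (n a) (y a) := by
  unfold listAbs
  fun_prop

end

theorem cast_listDot (b y : List ℤ) : (listDot n b y : ℝ) =
    (fun j : Fin n => ((b.getD j 0 : ℤ) : ℝ)) ⬝ᵥ fun j : Fin n => ((y.getD j 0 : ℤ) : ℝ) := by
  simp [listDot, dotProduct, Finset.sum_range]

theorem cast_listAbs (y : List ℤ) :
    (listAbs n y : ℝ) = ∑ j : Fin n, |((y.getD j 0 : ℤ) : ℝ)| := by
  simp [listAbs, Finset.sum_range]

theorem Approx.abs_listDot_sub_le {R : Matrix (Fin s) (Fin n) ℝ} {tab : List (List AlgCode)}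
    (ht : TableOf R tab) {m : ℕ} {Q : List (List ℤ)} (h : Approx tab m Q) (i : Fin s)
    (y : List ℤ) : |m * (R *ᵥ fun j => ((y.getD j 0 : ℤ) : ℝ)) i - listDot n (Q.getD i []) y| ≤
      listAbs n y := by
  rw [cast_listDot, cast_listAbs, mulVec, dotProduct, dotProduct, Finset.mul_sum,
    ← Finset.sum_sub_distrib]
  refine (Finset.abs_sum_le_sum_abs _ _).trans (Finset.sum_le_sum fun j _ => ?_)
  rw [← mul_assoc, ← sub_mul, abs_mul]
  exact mul_le_of_le_one_left (abs_nonneg _) (h.abs_sub_le ht i j)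

/-! ### Certificates for bounds of dual norms -/

/-- A semidecidable form of the statement that the dual norm of `b` is larger than `c`. -/
def LargeNorm (tab : List (List AlgCode)) (b : List ℤ) (c : RatCode) : Prop :=
  ∃ w : ℕ × List (List ℤ) × List ℤ, Approx tab w.1 w.2.1 ∧ AllLt tab.length fun i =>
    c.1 * (|listDot (tab.getD 0 []).length (w.2.1.getD i []) w.2.2| +
      listAbs (tab.getD 0 []).length w.2.2) <
      (c.2 + 1 : ℕ) * w.1 * listDot (tab.getD 0 []).length b w.2.2

theorem semiDec_largeNorm :
    SemiDec fun q : List (List AlgCode) × List ℤ × RatCode => LargeNorm q.1 q.2.1 q.2.2 := by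
  unfold LargeNorm
  refine SemiDec.exists (SemiDec.and ?_ (PrimrecPred.semiDec (by fun_prop)))
  exact semiDec_approx.comp (f := fun q : (List (List AlgCode) × List ℤ × RatCode) ×
    ℕ × List (List ℤ) × List ℤ => (q.1.1, q.2.1, q.2.2.1)) (by fun_prop)

/-- The integral matrix `Q` certifies that `G` is an upper bound for the row norm. -/
def RowBound (tab : List (List AlgCode)) (G m : ℕ) (Q : List (List ℤ)) : Prop :=
  AllLt tab.length fun i =>
    listAbs (tab.getD 0 []).length (Q.getD i []) + (tab.getD 0 []).length ≤ (G * m : ℕ)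

@[fun_prop] theorem primrecPred_rowBound {α : Type*} [Primcodable α]
    {tab : α → List (List AlgCode)} {G m : α → ℕ} {Q : α → List (List ℤ)} (ht : Primrec tab)
    (hG : Primrec G) (hm : Primrec m) (hQ : Primrec Q) :
    PrimrecPred fun a => RowBound (tab a) (G a) (m a) (Q a) := by
  unfold RowBound
  fun_prop

/-- A semidecidable form of the statement that the dual norm of `b` is smaller than `c`. -/
def SmallNorm (tab : List (List AlgCode)) (b : List ℤ) (c : RatCode) : Prop :=
  ∃ w : ℕ × List (List ℤ) × ℕ × ℕ, Approx tab w.1 w.2.1 ∧ RowBound tab w.2.2.1 w.1 w.2.1 ∧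
    0 < w.2.2.2 ∧ AllMem (listTuples (intBox w.2.2.2) (tab.getD 0 []).length) fun y =>
      (¬ ExLt (tab.getD 0 []).length fun j => |y.getD j 0| = w.2.2.2) ∨
      ExLt tab.length fun i => (c.2 + 1 : ℕ) * w.1 * (listDot (tab.getD 0 []).length b y +
        listAbs (tab.getD 0 []).length b) <
        c.1 * (|listDot (tab.getD 0 []).length (w.2.1.getD i []) y| -
          listAbs (tab.getD 0 []).length y - w.2.2.1 * w.1)

theorem semiDec_smallNorm :
    SemiDec fun q : List (List AlgCode) × List ℤ × RatCode => SmallNorm q.1 q.2.1 q.2.2 := by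
  unfold SmallNorm
  refine SemiDec.exists (SemiDec.and ?_ (PrimrecPred.semiDec (by fun_prop)))
  exact semiDec_approx.comp (f := fun q : (List (List AlgCode) × List ℤ × RatCode) ×
    ℕ × List (List ℤ) × ℕ × ℕ => (q.1.1, q.2.1, q.2.2.1)) (by fun_prop)

variable {R : Matrix (Fin s) (Fin n) ℝ} {tab : List (List AlgCode)}

theorem RowBound.sum_le (ht : TableOf R tab) {G m : ℕ} {Q : List (List ℤ)} (h : Approx tab m Q)
    (hG : RowBound tab G m Q) (i : Fin s) : ∑ j, |R i j| ≤ G := by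
  have h1 := hG i (by rw [ht.1]; exact i.2)
  rw [ht.2.1] at h1
  have h2 : (listAbs n (Q.getD i []) : ℝ) + n ≤ G * m := by exact_mod_cast h1
  have hm : (0 : ℝ) < m := by exact_mod_cast h.1
  rw [cast_listAbs] at h2
  have h3 : ∑ j, m * |R i j| ≤ ∑ j : Fin n, (|(((Q.getD i []).getD j 0 : ℤ) : ℝ)| + 1) := by
    refine Finset.sum_le_sum fun j _ => ?_
    have := h.abs_sub_le ht i j
    have h4 := abs_sub_abs_le_abs_sub ((m : ℝ) * R i j) ((Q.getD i []).getD j 0 : ℤ)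
    rw [abs_mul, abs_of_pos hm] at h4
    linarith
  rw [Finset.sum_add_distrib, ← Finset.mul_sum] at h3
  simp only [Finset.sum_const, Finset.card_univ, Fintype.card_fin, nsmul_eq_mul, mul_one] at h3
  refine le_of_mul_le_mul_left ?_ hm
  linarith

theorem exists_rowBound (ht : TableOf R tab) :
    ∃ G : ℕ, ∀ m Q, Approx tab m Q → RowBound tab G m Q := by
  -- One `n` is for the entrywise error of `Q`, the other for the margin in `RowBound`; as `m ≥ 1`,
  -- multiplication by `m` preserves both.
  obtain ⟨G, hG⟩ := exists_nat_ge (∑ i, ∑ j, |R i j| + 2 * n)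
  refine ⟨G, fun m Q h i hi => ?_⟩
  rw [ht.1] at hi
  have hm : (1 : ℝ) ≤ m := by exact_mod_cast h.1
  have h3 : ∑ j : Fin n, |(((Q.getD i []).getD j 0 : ℤ) : ℝ)| ≤
      ∑ j, (m * |R ⟨i, hi⟩ j| + 1) := by
    refine Finset.sum_le_sum fun j _ => ?_
    have := h.abs_sub_le ht ⟨i, hi⟩ j
    have h4 := abs_sub_abs_le_abs_sub (((Q.getD i []).getD j 0 : ℤ) : ℝ) ((m : ℝ) * R ⟨i, hi⟩ j)
    rw [abs_mul, abs_of_nonneg (by linarith : (0 : ℝ) ≤ m), abs_sub_comm] at h4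
    simp only at this
    linarith
  rw [Finset.sum_add_distrib, ← Finset.mul_sum] at h3
  simp only [Finset.sum_const, Finset.card_univ, Fintype.card_fin, nsmul_eq_mul, mul_one] at h3
  have h5 : ∑ j, |R ⟨i, hi⟩ j| ≤ ∑ i, ∑ j, |R i j| :=
    Finset.single_le_sum (f := fun i => ∑ j, |R i j|)
      (fun _ _ => Finset.sum_nonneg fun _ _ => abs_nonneg _) (Finset.mem_univ _)
  have h6 : (0 : ℝ) ≤ n := by positivity
  rw [ht.2.1]
  have : (listAbs n (Q.getD i []) : ℝ) + n ≤ G * m := by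
    rw [cast_listAbs]
    nlinarith
  exact_mod_cast this

theorem RatCode.toReal_pos_iff {c : RatCode} : 0 < c.toReal ↔ 0 < c.1 := by
  rw [RatCode.toReal, div_pos_iff_of_pos_right (by positivity)]
  norm_cast

/-- As `Q` is within `1` of `m • R`, the quantity `|Q_i · y| + ∑ j, |y j|` is an upper bound for `m
* |(R *ᵥ y) i|`. Applied to a row where the maximum norm is attained, the certificate shows that the
bound fails at `y`. -/
theorem LargeNorm.not_dualLE [NeZero s] (ht : TableOf R tab) {b : Fin n → ℤ} {c : RatCode}
    (h : LargeNorm tab (List.ofFn b) c) (hc : 0 < c.toReal) :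
    ¬ DualLE R (fun j => (b j : ℝ)) c.toReal := by
  obtain ⟨⟨m, Q, y⟩, ha, h⟩ := h
  rw [ht.1, ht.2.1] at h
  simp only at ha h
  intro hd
  have hm : (0 : ℝ) < m := by exact_mod_cast ha.1
  have hd := hd fun j => ((y.getD j 0 : ℤ) : ℝ)
  obtain ⟨i, hi⟩ := Finite.exists_max fun i => |(R *ᵥ fun j => ((y.getD j 0 : ℤ) : ℝ)) i|
  have h1 : ‖R *ᵥ fun j => ((y.getD j 0 : ℤ) : ℝ)‖ ≤
      |(R *ᵥ fun j => ((y.getD j 0 : ℤ) : ℝ)) i| := by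
    rw [pi_norm_le_iff_of_nonneg (abs_nonneg _)]
    exact hi
  have h2 : (c.1 : ℝ) * (|(listDot n (Q.getD i []) y : ℝ)| + listAbs n y) <
      (c.2 + 1) * m * listDot n (List.ofFn b) y := by exact_mod_cast h i i.2
  rw [cast_listDot (List.ofFn b)] at h2
  simp only [getD_ofFn] at h2
  have h3 := ha.abs_listDot_sub_le ht i y
  have h4 := abs_sub_abs_le_abs_sub (m * (R *ᵥ fun j => ((y.getD j 0 : ℤ) : ℝ)) i)
    (listDot n (Q.getD i []) y)
  rw [abs_mul, abs_of_pos hm] at h4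
  have h5 : (m : ℝ) * ‖R *ᵥ fun j => ((y.getD j 0 : ℤ) : ℝ)‖ ≤
      |(listDot n (Q.getD i []) y : ℝ)| + listAbs n y := by
    have := mul_le_mul_of_nonneg_left h1 hm.le
    linarith
  have hk : (0 : ℝ) < (c.2 : ℝ) + 1 := by positivity
  have hc1 : (0 : ℝ) < c.1 := by exact_mod_cast RatCode.toReal_pos_iff.1 hc
  rw [RatCode.toReal, div_mul_eq_mul_div, le_div_iff₀ hk] at hd
  have h6 := mul_le_mul_of_nonneg_left h5 hc1.le
  have h7 := mul_le_mul_of_nonneg_left hd hm.le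
  linarith

theorem largeNorm_of_not_dualLE (ht : TableOf R tab) {b : Fin n → ℤ} {c : RatCode}
    (hc : 0 < c.toReal) (h : ¬ DualLE R (fun j => (b j : ℝ)) c.toReal) :
    LargeNorm tab (List.ofFn b) c := by
  obtain ⟨y, hy⟩ := exists_int_of_not_dualLE h
  have hk : (0 : ℝ) < (c.2 : ℝ) + 1 := by positivity
  have hc1 : (0 : ℝ) < c.1 := by exact_mod_cast RatCode.toReal_pos_iff.1 hc
  rw [RatCode.toReal, div_mul_eq_mul_div, div_lt_iff₀ hk] at hy
  -- Passing from `m • R` to `Q` costs `∑ j, |y j|`, and the certificate demands as much again,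
  -- while the gap at `y` grows linearly in `m`.
  obtain ⟨m, hm⟩ := exists_nat_gt (2 * c.1 * listAbs n (List.ofFn y) /
    ((((fun j => (b j : ℝ)) ⬝ᵥ fun j => (y j : ℝ)) * (c.2 + 1)) -
      c.1 * ‖R *ᵥ fun j => (y j : ℝ)‖))
  rw [div_lt_iff₀ (sub_pos.2 hy)] at hm
  have habs : (0 : ℝ) ≤ listAbs n (List.ofFn y) := by
    rw [cast_listAbs]
    exact Finset.sum_nonneg fun _ _ => abs_nonneg _
  have hm0 : 0 < m := by
    rcases Nat.eq_zero_or_pos m with rfl | h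
    · simp only [Nat.cast_zero, zero_mul] at hm
      have : 0 ≤ 2 * c.1 * (listAbs n (List.ofFn y) : ℝ) := by positivity
      linarith
    · exact h
  have hm' : (0 : ℝ) < m := by exact_mod_cast hm0
  obtain ⟨Q, hQ⟩ := exists_approx ht hm0
  refine ⟨⟨m, Q, List.ofFn y⟩, hQ, fun i hi => ?_⟩
  rw [ht.1] at hi
  rw [ht.2.1]
  have h3 := hQ.abs_listDot_sub_le ht ⟨i, hi⟩ (List.ofFn y)
  simp only [getD_ofFn] at h3
  have h4 := abs_sub_abs_le_abs_sub (listDot n (Q.getD i []) (List.ofFn y) : ℝ)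
    (m * (R *ᵥ fun j => (y j : ℝ)) ⟨i, hi⟩)
  rw [abs_mul, abs_of_pos hm', abs_sub_comm] at h4
  have h5 : |(R *ᵥ fun j => (y j : ℝ)) ⟨i, hi⟩| ≤ ‖R *ᵥ fun j => (y j : ℝ)‖ :=
    norm_le_pi_norm (R *ᵥ fun j => (y j : ℝ)) _
  have h6 : |(listDot n (Q.getD i []) (List.ofFn y) : ℝ)| + listAbs n (List.ofFn y) ≤
      m * ‖R *ᵥ fun j => (y j : ℝ)‖ + 2 * listAbs n (List.ofFn y) := by
    have := mul_le_mul_of_nonneg_left h5 hm'.le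
    linarith
  have h7 := mul_le_mul_of_nonneg_left h6 hc1.le
  have : (c.1 : ℝ) * (|(listDot n (Q.getD i []) (List.ofFn y) : ℝ)| + listAbs n (List.ofFn y)) <
      (c.2 + 1) * m * listDot n (List.ofFn b) (List.ofFn y) := by
    rw [cast_listDot (List.ofFn b)]
    simp only [getD_ofFn]
    linarith
  exact_mod_cast this

theorem SmallNorm.dualLE (ht : TableOf R tab) {b : Fin n → ℤ} {c : RatCode}
    (h : SmallNorm tab (List.ofFn b) c) (hc : 0 < c.toReal) :
    DualLE R (fun j => (b j : ℝ)) c.toReal := by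
  obtain ⟨⟨m, Q, G, D⟩, ha, hG, hD, h⟩ := h
  rw [ht.1, ht.2.1] at h
  simp only at ha hG hD h
  have hm : (0 : ℝ) < m := by exact_mod_cast ha.1
  have hk : (0 : ℝ) < (c.2 : ℝ) + 1 := by positivity
  have hc1 : (0 : ℝ) < c.1 := by exact_mod_cast RatCode.toReal_pos_iff.1 hc
  refine dualLE_of_box (hG.sum_le ht ha) hc.le hD fun y hy ⟨j, hj⟩ => ?_
  have hmem : List.ofFn y ∈ listTuples (intBox D) n := by
    rw [mem_listTuples]
    refine ⟨by simp, fun z hz => ?_⟩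
    obtain ⟨j, rfl⟩ := (List.mem_ofFn' y z).1 hz
    exact mem_intBox.2 (hy j)
  have hex : ExLt n fun j => |(List.ofFn y).getD j 0| = (D : ℤ) :=
    ⟨j, j.2, by simpa only [getD_ofFn] using hj⟩
  obtain ⟨i, hi, hlt⟩ := (h _ hmem).resolve_left (not_not_intro hex)
  refine ⟨⟨i, hi⟩, ?_⟩
  have h1 : ((c.2 : ℝ) + 1) * m * (listDot n (List.ofFn b) (List.ofFn y) +
      listAbs n (List.ofFn b)) < c.1 * (|(listDot n (Q.getD i []) (List.ofFn y) : ℝ)| -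
        listAbs n (List.ofFn y) - G * m) := by exact_mod_cast hlt
  rw [cast_listDot (List.ofFn b), cast_listAbs (List.ofFn b)] at h1
  simp only [getD_ofFn] at h1
  have h3 := ha.abs_listDot_sub_le ht ⟨i, hi⟩ (List.ofFn y)
  simp only [getD_ofFn] at h3
  have h4 := abs_sub_abs_le_abs_sub (listDot n (Q.getD i []) (List.ofFn y) : ℝ)
    (m * (R *ᵥ fun j => (y j : ℝ)) ⟨i, hi⟩)
  rw [abs_mul, abs_of_pos hm, abs_sub_comm] at h4
  rw [RatCode.toReal, div_mul_eq_mul_div, le_div_iff₀ hk]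
  refine le_of_mul_le_mul_left ?_ hm
  have h5 : |(listDot n (Q.getD i []) (List.ofFn y) : ℝ)| - listAbs n (List.ofFn y) - G * m ≤
      m * (|(R *ᵥ fun j => (y j : ℝ)) ⟨i, hi⟩| - G) := by linarith
  have h6 := mul_le_mul_of_nonneg_left h5 hc1.le
  linarith

theorem smallNorm_of_coNorm_lt [NeZero s] (hR : Function.Injective R.mulVec) (ht : TableOf R tab)
    {b : Fin n → ℤ} {c : RatCode} (h : coNorm R (fun j => (b j : ℝ)) < c.toReal) :
    SmallNorm tab (List.ofFn b) c := by
  have hc : 0 < c.toReal := (coNorm_nonneg _ _).trans_lt h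
  obtain ⟨G, hG⟩ := exists_rowBound ht
  -- The box is chosen for `G + 1` instead of `G`; the extra `1` will absorb the approximation
  -- error.
  obtain ⟨D, hD, hbox⟩ := exists_box_of_dualLE hR (dualLE_coNorm hR _) h (G + 1 : ℝ)
  -- On the box `∑ j, |y j| ≤ n * D`, so twice this error is less than `m`.
  obtain ⟨Q, hQ⟩ := exists_approx ht (m := 2 * n * D + 1) (Nat.succ_pos _)
  refine ⟨⟨2 * n * D + 1, Q, G, D⟩, hQ, hG _ _ hQ, hD, fun y hy => ?_⟩
  rw [mem_listTuples, ht.2.1] at hy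
  obtain ⟨hlen, hy⟩ := hy
  rw [ht.1, ht.2.1, or_iff_not_imp_left, not_not]
  rintro ⟨j, hj, hjD⟩
  set m : ℕ := 2 * n * D + 1 with hm
  have hm0 : (0 : ℝ) < m := by positivity
  obtain ⟨i, hi⟩ := hbox (fun j => y.getD j 0) ⟨⟨j, hj⟩, hjD⟩
  refine ⟨i, i.2, ?_⟩
  have hk : (0 : ℝ) < (c.2 : ℝ) + 1 := by positivity
  have hc1 : (0 : ℝ) < c.1 := by exact_mod_cast RatCode.toReal_pos_iff.1 hc
  have habs : (listAbs n y : ℝ) ≤ n * D := by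
    rw [cast_listAbs]
    refine (Finset.sum_le_card_nsmul _ _ (D : ℝ) fun j _ => ?_).trans (by simp)
    have : |y.getD j 0| ≤ D := by
      refine mem_intBox.1 (hy _ ?_)
      rw [List.getD_eq_getElem _ _ (by rw [hlen]; exact j.2)]
      exact List.getElem_mem _
    exact_mod_cast this
  have h3 := hQ.abs_listDot_sub_le ht i y
  have h4 := abs_sub_abs_le_abs_sub (m * (R *ᵥ fun j => ((y.getD j 0 : ℤ) : ℝ)) i)
    (listDot n (Q.getD i []) y)
  rw [abs_mul, abs_of_pos hm0] at h4
  have h5 : (m : ℝ) = 2 * n * D + 1 := by rw [hm]; push_cast; ring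
  have h6 : m * (|(R *ᵥ fun j => ((y.getD j 0 : ℤ) : ℝ)) i| - (G + 1)) ≤
      |(listDot n (Q.getD i []) y : ℝ)| - listAbs n y - G * m := by linarith
  rw [RatCode.toReal, div_mul_eq_mul_div, lt_div_iff₀ hk] at hi
  have h7 := mul_le_mul_of_nonneg_left h6 hc1.le
  have h8 := mul_lt_mul_of_pos_left hi hm0
  have h9 : ((c.2 : ℝ) + 1) * m * (listDot n (List.ofFn b) y +
      listAbs n (List.ofFn b)) < c.1 * (|(listDot n (Q.getD i []) y : ℝ)| -
        listAbs n y - G * m) := by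
    rw [cast_listDot (List.ofFn b), cast_listAbs (List.ofFn b)]
    simp only [getD_ofFn]
    linarith
  exact_mod_cast h9

/-- A semidecidable form of the statement that the entries of an integral vector with dual norm at
most `c` have absolute value at most `M`. -/
def EntryBound (tab : List (List AlgCode)) (c : RatCode) (M : ℕ) : Prop :=
  ∃ w : ℕ × List (List ℤ) × ℕ, Approx tab w.1 w.2.1 ∧ RowBound tab w.2.2 w.1 w.2.1 ∧
    c.1 * w.2.2 ≤ M * (c.2 + 1 : ℕ)

theorem semiDec_entryBound :
    SemiDec fun q : List (List AlgCode) × RatCode × ℕ => EntryBound q.1 q.2.1 q.2.2 := by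
  unfold EntryBound
  refine SemiDec.exists (SemiDec.and ?_ (PrimrecPred.semiDec (by fun_prop)))
  exact semiDec_approx.comp (f := fun q : (List (List AlgCode) × RatCode × ℕ) ×
    ℕ × List (List ℤ) × ℕ => (q.1.1, q.2.1, q.2.2.1)) (by fun_prop)

theorem EntryBound.abs_le [NeZero s] (ht : TableOf R tab) {c : RatCode} {M : ℕ}
    (h : EntryBound tab c M) {b : Fin n → ℤ} {c' : ℝ} (hc0 : 0 < c') (hc : c' ≤ c.toReal)
    (hb : DualLE R (fun j => (b j : ℝ)) c') (j : Fin n) : |b j| ≤ M := by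
  obtain ⟨⟨m, Q, G⟩, ha, hG, hM⟩ := h
  have h1 := abs_le_of_dualLE (hG.sum_le ht ha) (hc0.le.trans hc) (hb.mono hc) j
  have hk : (0 : ℝ) < (c.2 : ℝ) + 1 := by positivity
  have h2 : (c.1 : ℝ) * G ≤ M * (c.2 + 1) := by exact_mod_cast hM
  have h3 : c.toReal * G ≤ M := by
    rw [RatCode.toReal, div_mul_eq_mul_div, div_le_iff₀ hk]
    exact h2
  exact_mod_cast h1.trans h3

theorem exists_entryBound (ht : TableOf R tab) (c : RatCode) : ∃ M, EntryBound tab c M := by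
  obtain ⟨G, hG⟩ := exists_rowBound ht
  obtain ⟨Q, hQ⟩ := exists_approx ht one_pos
  refine ⟨c.1.natAbs * G, ⟨1, Q, G⟩, hQ, hG _ _ hQ, ?_⟩
  push_cast
  have h1 : c.1 * G ≤ |c.1| * G := mul_le_mul_of_nonneg_right (le_abs_self _) (by positivity)
  have h2 : 0 ≤ |c.1| * (G : ℤ) := by positivity
  nlinarith

end Tables


/-! ### Lists of integral matrices -/

section MatrixLists

open Matrix

variable {n : ℕ}

/-- The list is the list of rows of a matrix of size `n`. -/
def IsMatrixCode (n : ℕ) (A : List (List ℤ)) : Prop :=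
  A.length = n ∧ AllMem A fun r => r.length = n

/-- The product of the matrices `A` and `B` of size `n` is the identity matrix. -/
def ListMulEqOne (n : ℕ) (A B : List (List ℤ)) : Prop :=
  AllLt n fun i => AllLt n fun j => ∑ k ∈ Finset.range n,
    (A.getD i []).getD k 0 * (B.getD k []).getD j 0 = if i = j then 1 else 0

/-- The matrix `B` of size `n` is singular modulo some number greater than `1`. -/
def SingularMod (n : ℕ) (B : List (List ℤ)) : Prop :=
  ∃ w : ℕ × List ℤ, (ExLt n fun i => ¬ (w.1 : ℤ) ∣ w.2.getD i 0) ∧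
    AllLt n fun i => (w.1 : ℤ) ∣ listDot n (B.getD i []) w.2

/-- All matrices of size `n` with entries of absolute value at most `M`. -/
def matBox (n M : ℕ) : List (List (List ℤ)) := listTuples (listTuples (intBox M) n) n

section

variable {α : Type*} [Primcodable α]

@[fun_prop] theorem primrecPred_isMatrixCode {n : α → ℕ} {A : α → List (List ℤ)} (hn : Primrec n)
    (hA : Primrec A) : PrimrecPred fun a => IsMatrixCode (n a) (A a) := by
  unfold IsMatrixCode
  fun_prop

@[fun_prop] theorem primrecPred_listMulEqOne {n : α → ℕ} {A B : α → List (List ℤ)}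
    (hn : Primrec n) (hA : Primrec A) (hB : Primrec B) :
    PrimrecPred fun a => ListMulEqOne (n a) (A a) (B a) := by
  unfold ListMulEqOne
  fun_prop

theorem SemiDec.singularMod {n : α → ℕ} {B : α → List (List ℤ)}
    (hn : Primrec n) (hB : Primrec B) : SemiDec fun a => SingularMod (n a) (B a) := by
  unfold SingularMod
  exact SemiDec.exists (PrimrecPred.semiDec (by fun_prop))

@[fun_prop] theorem primrec_matBox {n M : α → ℕ} (hn : Primrec n) (hM : Primrec M) :
    Primrec fun a => matBox (n a) (M a) := by
  unfold matBox
  fun_prop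

end

theorem isMatrixCode_iff {A : List (List ℤ)} : IsMatrixCode n A ↔ ∃ A' : Fin n → Fin n → ℤ,
    A = matCode A' := by
  constructor
  · rintro ⟨rfl, h⟩
    refine ⟨fun i j => (A.get i).getD j 0, ?_⟩
    rw [matCode]
    conv_lhs => rw [← List.ofFn_get A]
    congr 1
    ext1 i
    have hi : (A.get i).length = A.length := h _ (List.get_mem A i)
    refine List.ext_getElem (by rw [hi]; simp) fun j h1 h2 => ?_
    simp only [List.getElem_ofFn]
    rw [List.getD_eq_getElem]
  · rintro ⟨A', rfl⟩
    refine ⟨by simp [matCode], fun r hr => ?_⟩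
    obtain ⟨i, rfl⟩ := (List.mem_ofFn' _ r).1 hr
    simp

theorem mem_matBox_iff {M : ℕ} {B : List (List ℤ)} : B ∈ matBox n M ↔
    ∃ B' : Fin n → Fin n → ℤ, B = matCode B' ∧ ∀ i j, |B' i j| ≤ M := by
  constructor
  · intro h
    rw [matBox, mem_listTuples] at h
    obtain ⟨B', rfl⟩ := isMatrixCode_iff.1 (⟨h.1, fun r hr => (mem_listTuples.1 (h.2 r hr)).1⟩ :
      IsMatrixCode n B)
    refine ⟨B', rfl, fun i j => ?_⟩
    have h1 := (mem_listTuples.1 (h.2 (List.ofFn (B' i)) ((List.mem_ofFn' _ _).2 ⟨i, rfl⟩))).2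
    exact mem_intBox.1 (h1 _ ((List.mem_ofFn' _ _).2 ⟨j, rfl⟩))
  · rintro ⟨B', rfl, h⟩
    rw [matBox, mem_listTuples]
    refine ⟨by simp [matCode], fun r hr => ?_⟩
    obtain ⟨i, rfl⟩ := (List.mem_ofFn' _ r).1 hr
    rw [mem_listTuples]
    refine ⟨by simp, fun z hz => ?_⟩
    obtain ⟨j, rfl⟩ := (List.mem_ofFn' _ z).1 hz
    exact mem_intBox.2 (h i j)

theorem listMulEqOne_matCode {A B : Fin n → Fin n → ℤ} :
    ListMulEqOne n (matCode A) (matCode B) ↔ Matrix.of A * Matrix.of B = 1 := by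
  simp only [ListMulEqOne, AllLt, ← Matrix.ext_iff, Matrix.mul_apply, Matrix.one_apply,
    Matrix.of_apply, Finset.sum_range]
  constructor
  · intro h i j
    have := h i i.2 j j.2
    simpa only [matCode_getD, Fin.val_inj] using this
  · intro h i hi j hj
    have := h ⟨i, hi⟩ ⟨j, hj⟩
    have e1 := fun k : Fin n => matCode_getD A ⟨i, hi⟩ k 0
    have e2 := fun k : Fin n => matCode_getD B k ⟨j, hj⟩ 0
    simp only at e1 e2
    simpa only [e1, e2, Fin.mk.injEq] using this

/-- An inverse would force every `y` with `B y` divisible by `k` to be divisible by `k`. Conversely,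
a prime dividing the determinant gives a nonzero kernel vector modulo that prime. Thus
non-invertibility has finite witnesses, like invertibility. -/
theorem singularMod_matCode {B : Fin n → Fin n → ℤ} :
    SingularMod n (matCode B) ↔ ¬ IsUnit (Matrix.of B) := by
  constructor
  · rintro ⟨⟨k, y⟩, ⟨i, hi, hk⟩, h⟩ hu
    simp only at hk h
    obtain ⟨A, hA⟩ := hu.exists_left_inv
    apply hk
    set v : Fin n → ℤ := fun j => y.getD j 0 with hv
    have h1 : (A *ᵥ (Matrix.of B *ᵥ v)) ⟨i, hi⟩ = y.getD i 0 := by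
      rw [Matrix.mulVec_mulVec, hA, Matrix.one_mulVec]
    rw [← h1, mulVec, dotProduct]
    refine Finset.dvd_sum fun j _ => Dvd.dvd.mul_left ?_ _
    have h2 := h j j.2
    simp only [listDot, Finset.sum_range, matCode_getD] at h2
    exact h2
  · intro hu
    rw [Matrix.isUnit_iff_isUnit_det, Int.isUnit_iff_natAbs_eq] at hu
    -- This covers determinant `0`, which every prime divides.
    obtain ⟨p, hp, hdvd⟩ := Nat.exists_prime_and_dvd hu
    have := Fact.mk hp
    have hdet : ((Matrix.of B).map (Int.castRingHom (ZMod p))).det = 0 := by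
      have := RingHom.map_det (Int.castRingHom (ZMod p)) (Matrix.of B)
      rw [RingHom.mapMatrix_apply] at this
      rw [← this, eq_intCast, ZMod.intCast_zmod_eq_zero_iff_dvd]
      exact Int.natCast_dvd.2 hdvd
    obtain ⟨v, hv0, hv⟩ := Matrix.exists_mulVec_eq_zero_iff.2 hdet
    obtain ⟨i, hi⟩ := Function.ne_iff.1 hv0
    refine ⟨⟨p, List.ofFn fun j => ((v j).val : ℤ)⟩, ⟨i, i.2, ?_⟩, fun i hi => ?_⟩
    · simp only [getD_ofFn]
      rw [← ZMod.intCast_zmod_eq_zero_iff_dvd]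
      simpa using hi
    · have h1 := congrFun hv ⟨i, hi⟩
      have e := fun k : Fin n => matCode_getD B ⟨i, hi⟩ k 0
      simp only at e
      simp only [listDot, Finset.sum_range, getD_ofFn, e]
      rw [← ZMod.intCast_zmod_eq_zero_iff_dvd]
      simpa [mulVec, dotProduct] using h1

/-- The list `L` of matrices of size `n` consists of inverses of matrices with small rows, and every
invertible matrix with entries bounded by `M` has an inverse in `L` or a large row. -/
def ListsSmall (n M : ℕ) (Sm La : List ℤ → Prop) (L : List (List (List ℤ))) : Prop :=
  (AllMem L fun A => IsMatrixCode n A ∧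
    ExMem (matBox n M) fun B => ListMulEqOne n A B ∧ AllMem B Sm) ∧
  AllMem (matBox n M) fun B => (ExMem L fun A => IsMatrixCode n A ∧ ListMulEqOne n A B) ∨
    ExMem B La ∨ SingularMod n B

theorem SemiDec.listsSmall {α : Type*} [Primcodable α] {n M : α → ℕ} {Sm La : α → List ℤ → Prop}
    {L : α → List (List (List ℤ))} (hn : Primrec n) (hM : Primrec M)
    (hSm : SemiDec fun q : α × List ℤ => Sm q.1 q.2)
    (hLa : SemiDec fun q : α × List ℤ => La q.1 q.2) (hL : Primrec L) :
    SemiDec fun a => ListsSmall (n a) (M a) (Sm a) (La a) (L a) := by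
  unfold ListsSmall
  refine SemiDec.and (SemiDec.allMem hL (SemiDec.and (PrimrecPred.semiDec (by fun_prop))
    (SemiDec.exMem (by fun_prop) (SemiDec.and (PrimrecPred.semiDec (by fun_prop))
      (SemiDec.allMem (by fun_prop) ?_)))))
    (SemiDec.allMem (by fun_prop) (SemiDec.or (PrimrecPred.semiDec (by fun_prop))
      (SemiDec.or (SemiDec.exMem (by fun_prop) ?_)
        (SemiDec.singularMod (by fun_prop) (by fun_prop)))))
  · exact hSm.comp (f := fun q : ((α × List (List ℤ)) × List (List ℤ)) × List ℤ =>
      (q.1.1.1, q.2)) (by fun_prop)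
  · exact hLa.comp (f := fun q : (α × List (List ℤ)) × List ℤ => (q.1.1, q.2)) (by fun_prop)

variable {ι : Type*} [Fintype ι] {R : Matrix ι (Fin n) ℝ} {c : ℝ} {M : ℕ}
  {Sm La : List ℤ → Prop}

/-- The matrix `A` has an inverse all of whose rows have dual norm at most `c`. -/
def InverseLE (R : Matrix ι (Fin n) ℝ) (c : ℝ) (A : Matrix (Fin n) (Fin n) ℤ) : Prop :=
  ∃ B : Matrix (Fin n) (Fin n) ℤ, A * B = 1 ∧ ∀ i, DualLE R (fun j => (B i j : ℝ)) c

/-- The first clause of `ListsSmall` gives soundness. For completeness, the inverse `B` of an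
admissible `A` lies in the box and has neither a large row nor a singular reduction; so the list
contains an inverse of `B`, which is `A`. -/
theorem ListsSmall.mem_iff (hSm : ∀ b : Fin n → ℤ, Sm (List.ofFn b) →
      DualLE R (fun j => (b j : ℝ)) c)
    (hLa : ∀ b : Fin n → ℤ, La (List.ofFn b) → ¬ DualLE R (fun j => (b j : ℝ)) c)
    (hM : ∀ b : Fin n → ℤ, DualLE R (fun j => (b j : ℝ)) c → ∀ j, |b j| ≤ M)
    {L : List (List (List ℤ))} (h : ListsSmall n M Sm La L) (A : Fin n → Fin n → ℤ) :
    matCode A ∈ L ↔ InverseLE R c (Matrix.of A) := by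
  constructor
  · intro hA
    obtain ⟨-, B, hB, hAB, hS⟩ := h.1 _ hA
    obtain ⟨B, rfl, -⟩ := mem_matBox_iff.1 hB
    exact ⟨Matrix.of B, listMulEqOne_matCode.1 hAB, fun i =>
      hSm _ (hS _ ((List.mem_ofFn' _ _).2 ⟨i, rfl⟩))⟩
  · rintro ⟨B, hAB, hB⟩
    have hBA : B * Matrix.of A = 1 := mul_eq_one_comm.1 hAB
    rcases h.2 _ (mem_matBox_iff.2 ⟨B, rfl, fun i => hM _ (hB i)⟩) with h1 | h1 | h1
    · obtain ⟨A', hA', hsq, hinv⟩ := h1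
      obtain ⟨A', rfl⟩ := isMatrixCode_iff.1 hsq
      have hinv : Matrix.of A' * B = 1 := listMulEqOne_matCode.1 hinv
      have : Matrix.of A' = Matrix.of A := left_inv_eq_right_inv hinv hBA
      rwa [← Matrix.of.injective this]
    · obtain ⟨r, hr, hr'⟩ := h1
      obtain ⟨i, rfl⟩ := (List.mem_ofFn' _ r).1 hr
      exact absurd (hB i) (hLa _ hr')
    · have h2 : ¬ IsUnit B := singularMod_matCode.1 h1
      exact absurd (IsUnit.of_mul_eq_one _ hBA) h2

/-- The inverses of those matrices in the box whose rows all satisfy `Sm` form such a list; any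
other matrix in the box has a row satisfying `La` or is singular modulo a prime. -/
theorem exists_listsSmall (n M : ℕ) {Sm La : List ℤ → Prop}
    (h : ∀ B : Fin n → Fin n → ℤ, IsUnit (Matrix.of B) →
      (∀ i, Sm (List.ofFn (B i))) ∨ ∃ i, La (List.ofFn (B i))) :
    ∃ L, ListsSmall n M Sm La L := by
  classical
  let inv : List (List ℤ) → List (List ℤ) := fun B =>
    if h : ∃ A, IsMatrixCode n A ∧ ListMulEqOne n A B then h.choose else []
  refine ⟨((matBox n M).filter fun B => (∃ A, IsMatrixCode n A ∧ ListMulEqOne n A B) ∧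
    AllMem B Sm).map inv, fun A hA => ?_, fun B hB => ?_⟩
  · obtain ⟨B, hB, rfl⟩ := List.mem_map.1 hA
    rw [List.mem_filter, decide_eq_true_iff] at hB
    obtain ⟨hB, hex, hS⟩ := hB
    have : inv B = hex.choose := dif_pos hex
    rw [this]
    exact ⟨hex.choose_spec.1, B, hB, hex.choose_spec.2, hS⟩
  · obtain ⟨B', rfl, -⟩ := mem_matBox_iff.1 hB
    by_cases hu : IsUnit (Matrix.of B')
    · rcases h B' hu with h1 | ⟨i, hi⟩
      · left
        obtain ⟨A, hA⟩ := hu.exists_left_inv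
        have hex : ∃ A, IsMatrixCode n A ∧ ListMulEqOne n A (matCode B') :=
          ⟨matCode A, isMatrixCode_iff.2 ⟨A, rfl⟩, listMulEqOne_matCode.2 hA⟩
        refine ⟨inv (matCode B'), List.mem_map_of_mem (List.mem_filter.2 ⟨hB, ?_⟩), ?_⟩
        · rw [decide_eq_true_iff]
          refine ⟨hex, fun r hr => ?_⟩
          obtain ⟨i, rfl⟩ := (List.mem_ofFn' _ r).1 hr
          exact h1 i
        · have : inv (matCode B') = hex.choose := dif_pos hex
          rw [this]
          exact hex.choose_spec
      · exact Or.inr (Or.inl ⟨_, (List.mem_ofFn' _ _).2 ⟨i, rfl⟩, hi⟩)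
    · exact Or.inr (Or.inr (singularMod_matCode.2 hu))

end MatrixLists


/-! ### Logarithms of `S`-units and fundamental systems -/

section ModTorsion

variable {K : Type u} [Field K]

/-- The class of a unit modulo roots of unity. -/
def modTorsion : Additive Kˣ →+ Additive (Kˣ ⧸ CommGroup.torsion Kˣ) :=
  MonoidHom.toAdditive (QuotientGroup.mk' (CommGroup.torsion Kˣ))

theorem exists_torsion_iff {x y : Kˣ} : (∃ ζ ∈ CommGroup.torsion Kˣ, x = ζ * y) ↔
    modTorsion (Additive.ofMul x) = modTorsion (Additive.ofMul y) := by
  change _ ↔ (QuotientGroup.mk x : Kˣ ⧸ CommGroup.torsion Kˣ) = QuotientGroup.mk y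
  rw [eq_comm (a := (QuotientGroup.mk x : Kˣ ⧸ CommGroup.torsion Kˣ)), QuotientGroup.eq]
  constructor
  · rintro ⟨ζ, hζ, rfl⟩
    rwa [mul_comm ζ, inv_mul_cancel_left]
  · intro h
    exact ⟨y⁻¹ * x, h, by rw [mul_comm, mul_inv_cancel_left]⟩

/-- In the additive group of units modulo roots of unity, exponents become coefficients, so that
changes of fundamental systems become products of integral matrices. -/
theorem exists_torsion_prod_iff {ι : Type*} [Fintype ι] {x : Kˣ} {T : ι → Kˣ} {b : ι → ℤ} :
    (∃ ζ ∈ CommGroup.torsion Kˣ, x = ζ * ∏ i, T i ^ b i) ↔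
      modTorsion (Additive.ofMul x) = ∑ i, b i • modTorsion (Additive.ofMul (T i)) := by
  rw [exists_torsion_iff, ofMul_prod, map_sum]
  simp only [ofMul_zpow, map_zsmul]

end ModTorsion

section SUnitLogs

variable {K : Type u} [Field K] [NumberField K]

theorem absV_pos {S : Finset (HeightOneSpectrum (𝓞 K))} (v : SPlace S) (x : Kˣ) :
    0 < absV v (x : K) := by
  rcases v with v | P
  · exact pow_pos (InfinitePlace.pos_iff.2 x.ne_zero) _
  · exact AbsoluteValue.pos _ x.ne_zero

theorem absV_mul {S : Finset (HeightOneSpectrum (𝓞 K))} (v : SPlace S) (x y : K) :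
    absV v (x * y) = absV v x * absV v y := by
  rcases v with v | P
  · simp [absV, mul_pow]
  · simp [absV]

theorem absV_one {S : Finset (HeightOneSpectrum (𝓞 K))} (v : SPlace S) :
    absV v (1 : K) = 1 := by
  rcases v with v | P
  · simp [absV]
  · simp [absV]

/-- The vector of the logarithms of the valuations. -/
noncomputable def logVec (S : Finset (HeightOneSpectrum (𝓞 K))) :
    Additive Kˣ →+ (SPlace S → ℝ) where
  toFun x v := Real.log (absV v ((x.toMul : Kˣ) : K))
  map_zero' := by
    ext v
    simp [absV_one]
  map_add' x y := by
    ext v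
    simp [absV_mul, Real.log_mul (absV_pos v _).ne' (absV_pos v _).ne']

theorem logVec_apply (S : Finset (HeightOneSpectrum (𝓞 K))) (x : Kˣ) (v : SPlace S) :
    logVec S (Additive.ofMul x) v = Real.log (absV v (x : K)) := rfl

theorem logVec_torsion (S : Finset (HeightOneSpectrum (𝓞 K))) {ζ : Kˣ}
    (hζ : ζ ∈ CommGroup.torsion Kˣ) : logVec S (Additive.ofMul ζ) = 0 := by
  obtain ⟨n, hn, h⟩ := (isOfFinOrder_iff_pow_eq_one.1 hζ)
  have h1 : n • logVec S (Additive.ofMul ζ) = 0 := by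
    rw [← map_nsmul, ← ofMul_pow, h, ofMul_one, map_zero]
  exact (smul_eq_zero.1 h1).resolve_left hn.ne'

/-- The exponents of the prime ideals in `S`. -/
noncomputable def ordVec (S : Finset (HeightOneSpectrum (𝓞 K))) :
    Additive Kˣ →+ ({P : HeightOneSpectrum (𝓞 K) // P ∈ S} → ℤ) where
  toFun x P := (P.1.valuationOfNeZero x.toMul).toAdd
  map_zero' := by
    ext P
    simp
  map_add' x y := by
    ext P
    simp

/-- The exponent carries no sign because the multiplicative valuation already records `-ord_P`. -/
theorem absV_inr (S : Finset (HeightOneSpectrum (𝓞 K))) (x : Kˣ)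
    (P : {P : HeightOneSpectrum (𝓞 K) // P ∈ S}) : absV (S := S) (Sum.inr P) (x : K) =
      (Ideal.absNorm P.1.asIdeal : ℝ) ^ (ordVec S (Additive.ofMul x) P) := by
  simp only [absV, NumberField.HeightOneSpectrum.adicAbv_def]
  rw [← HeightOneSpectrum.valuationOfNeZero_eq, WithZeroMulInt.toNNReal_neg_apply _ (by simp),
    WithZero.unzero_coe]
  simp [ordVec]

theorem logVec_inr (S : Finset (HeightOneSpectrum (𝓞 K))) (x : Kˣ)
    (P : {P : HeightOneSpectrum (𝓞 K) // P ∈ S}) :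
    logVec S (Additive.ofMul x) (Sum.inr P) =
      ordVec S (Additive.ofMul x) P * Real.log (Ideal.absNorm P.1.asIdeal) := by
  rw [logVec_apply, absV_inr, Real.log_zpow]

theorem logVec_eq_of_modTorsion_eq (S : Finset (HeightOneSpectrum (𝓞 K))) {x y : Kˣ}
    (h : modTorsion (Additive.ofMul x) = modTorsion (Additive.ofMul y)) :
    logVec S (Additive.ofMul x) = logVec S (Additive.ofMul y) := by
  obtain ⟨ζ, hζ, rfl⟩ := exists_torsion_iff.2 h
  rw [ofMul_mul, map_add, logVec_torsion S hζ, zero_add]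

theorem logVec_eq_sum (S : Finset (HeightOneSpectrum (𝓞 K))) {ι : Type*} [Fintype ι] {x : Kˣ}
    {T : ι → Kˣ} {b : ι → ℤ}
    (h : modTorsion (Additive.ofMul x) = ∑ i, b i • modTorsion (Additive.ofMul (T i))) :
    logVec S (Additive.ofMul x) = ∑ i, b i • logVec S (Additive.ofMul (T i)) := by
  have : modTorsion (Additive.ofMul x) = modTorsion (Additive.ofMul (∏ i, T i ^ b i)) := by
    rw [h, ofMul_prod, map_sum]
    simp only [ofMul_zpow, map_zsmul]
  rw [logVec_eq_of_modTorsion_eq S this, ofMul_prod, map_sum]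
  simp only [ofMul_zpow, map_zsmul]

theorem isFundamentalSystem_iff (S : Finset (HeightOneSpectrum (𝓞 K)))
    (F : Fin (sRank S) → Kˣ) : IsFundamentalSystem S F ↔
      (∀ i, F i ∈ (S : Set (HeightOneSpectrum (𝓞 K))).unit K) ∧
      ∀ x ∈ (S : Set (HeightOneSpectrum (𝓞 K))).unit K, ∃! b : Fin (sRank S) → ℤ,
        modTorsion (Additive.ofMul x) = ∑ i, b i • modTorsion (Additive.ofMul (F i)) := by
  simp only [IsFundamentalSystem, exists_torsion_prod_iff]

theorem mem_unit_iff {S : Finset (HeightOneSpectrum (𝓞 K))} {x : Kˣ} :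
    x ∈ (S : Set (HeightOneSpectrum (𝓞 K))).unit K ↔
      ∀ v ∉ S, HeightOneSpectrum.valuation K v (x : K) = 1 := by
  rfl

theorem torsion_le_unit (S : Finset (HeightOneSpectrum (𝓞 K))) :
    CommGroup.torsion Kˣ ≤ (S : Set (HeightOneSpectrum (𝓞 K))).unit K := by
  intro ζ hζ
  obtain ⟨n, hn, h⟩ := isOfFinOrder_iff_pow_eq_one.1 hζ
  rw [mem_unit_iff]
  intro v _
  have h1 : (HeightOneSpectrum.valuation K v (ζ : K)) ^ n = 1 := by
    rw [← map_pow, ← Units.val_pow_eq_pow_val, h, Units.val_one, map_one]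
  exact (pow_eq_one_iff_of_nonneg zero_le hn.ne').1 h1

/-- Some power of a prime ideal is principal, so there are elements divisible only by this ideal. -/
theorem exists_unit_at_prime (P : HeightOneSpectrum (𝓞 K)) : ∃ x : Kˣ,
    HeightOneSpectrum.valuation K P (x : K) ≠ 1 ∧
      ∀ Q, Q ≠ P → HeightOneSpectrum.valuation K Q (x : K) = 1 := by
  have hP0 : P.asIdeal ∈ nonZeroDivisors (Ideal (𝓞 K)) := mem_nonZeroDivisors_of_ne_zero P.ne_bot
  obtain ⟨n, hn, h⟩ := isOfFinOrder_iff_pow_eq_one.1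
    (isOfFinOrder_of_finite (ClassGroup.mk0 ⟨P.asIdeal, hP0⟩))
  rw [← map_pow, show (⟨P.asIdeal, hP0⟩ : nonZeroDivisors (Ideal (𝓞 K))) ^ n =
    ⟨P.asIdeal ^ n, pow_mem hP0 n⟩ from rfl, ClassGroup.mk0_eq_one_iff] at h
  obtain ⟨π, hπ⟩ := h.principal
  rw [← Ideal.span] at hπ
  have hπ0 : π ≠ 0 := by
    rintro rfl
    rw [Ideal.span_singleton_zero] at hπ
    exact pow_ne_zero n P.ne_bot hπ
  have hπ0' : algebraMap (𝓞 K) K π ≠ 0 := by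
    simpa using hπ0
  refine ⟨Units.mk0 _ hπ0', ?_, fun Q hQ => ?_⟩
  · rw [Units.val_mk0]
    refine (((HeightOneSpectrum.valuation_lt_one_iff_mem (K := K) P π).2 ?_)).ne
    exact Ideal.pow_le_self hn.ne' (hπ ▸ Ideal.mem_span_singleton_self π)
  · rw [Units.val_mk0, HeightOneSpectrum.valuation_eq_one_iff_notMem]
    intro hmem
    apply hQ
    have h1 : P.asIdeal ^ n ≤ Q.asIdeal := by
      rw [hπ, Ideal.span_singleton_le_iff_mem]
      exact hmem
    have h2 := Q.isPrime.le_of_pow_le h1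
    exact HeightOneSpectrum.ext (P.isMaximal.eq_of_le Q.isPrime.ne_top h2).symm

theorem ordVec_eq_zero_iff {S : Finset (HeightOneSpectrum (𝓞 K))} {x : Kˣ}
    {P : {P : HeightOneSpectrum (𝓞 K) // P ∈ S}} :
    ordVec S (Additive.ofMul x) P = 0 ↔ HeightOneSpectrum.valuation K P.1 (x : K) = 1 := by
  rw [← HeightOneSpectrum.valuationOfNeZero_eq, ← WithZero.coe_one, WithZero.coe_inj]
  exact toAdd_eq_zero

/-- There are `S`-units whose exponent vectors are a basis of the lattice of all exponent vectors
of `S`-units, and this lattice has full rank. -/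
theorem exists_ordVec_basis (S : Finset (HeightOneSpectrum (𝓞 K))) :
    ∃ G : {P : HeightOneSpectrum (𝓞 K) // P ∈ S} → Kˣ,
      (∀ P, G P ∈ (S : Set (HeightOneSpectrum (𝓞 K))).unit K) ∧
      (∀ x ∈ (S : Set (HeightOneSpectrum (𝓞 K))).unit K, ∃ b : _ → ℤ,
        ordVec S (Additive.ofMul x) = ∑ P, b P • ordVec S (Additive.ofMul (G P))) ∧
      ∀ b : {P : HeightOneSpectrum (𝓞 K) // P ∈ S} → ℝ,
        (∀ Q, ∑ P, b P * ordVec S (Additive.ofMul (G P)) Q = 0) → b = 0 := by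
  classical
  let U : Submodule ℤ (Additive Kˣ) :=
    ((S : Set (HeightOneSpectrum (𝓞 K))).unit K).toAddSubgroup.toIntSubmodule
  let I : Submodule ℤ ({P : HeightOneSpectrum (𝓞 K) // P ∈ S} → ℤ) :=
    U.map (ordVec S).toIntLinearMap
  choose p hp1 hp2 using exists_unit_at_prime (K := K)
  have hpU : ∀ P ∈ S, p P ∈ (S : Set (HeightOneSpectrum (𝓞 K))).unit K := fun P hP =>
    mem_unit_iff.2 fun v hv => hp2 P v fun h => hv (h ▸ hP)
  let a : {P : HeightOneSpectrum (𝓞 K) // P ∈ S} → ℤ := fun P =>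
    ordVec S (Additive.ofMul (p P.1)) P
  have ha : ∀ P, a P ≠ 0 := fun P h => hp1 P.1 (ordVec_eq_zero_iff.1 h)
  have hap : ∀ P, ordVec S (Additive.ofMul (p P.1)) = Pi.single P (a P) := fun P => by
    ext Q
    rcases eq_or_ne Q P with rfl | hne
    · simp [a]
    · rw [Pi.single_eq_of_ne hne]
      exact ordVec_eq_zero_iff.2 (hp2 P.1 Q.1 fun h => hne (Subtype.ext h))
  have haI : ∀ P, Pi.single P (a P) ∈ I := fun P =>
    ⟨Additive.ofMul (p P.1), hpU P.1 P.2, hap P⟩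
  have hsumI : ∀ x : {P : HeightOneSpectrum (𝓞 K) // P ∈ S} → ℤ, (fun P => x P * a P) ∈ I := by
    intro x
    have : (fun P => x P * a P) = ∑ P, x P • (Pi.single P (a P) : _ → ℤ) := by
      ext Q
      simp [Finset.sum_apply, Pi.single_apply]
    rw [this]
    exact Submodule.sum_mem _ fun P _ => I.smul_mem _ (haI P)
  -- The lattice `I` of exponent vectors contains a nonzero multiple `a P` of each unit vector, so
  -- its rank is full.
  have hrank : Module.finrank ℤ I = Fintype.card {P : HeightOneSpectrum (𝓞 K) // P ∈ S} := by
    refine le_antisymm ?_ ?_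
    · exact (Submodule.finrank_le I).trans (by simp)
    · let f : ({P : HeightOneSpectrum (𝓞 K) // P ∈ S} → ℤ) →ₗ[ℤ] I :=
        { toFun := fun x => ⟨fun P => x P * a P, hsumI x⟩
          map_add' := fun x y => by ext; simp [add_mul]
          map_smul' := fun x y => by ext; simp [mul_assoc] }
      have hf : Function.Injective f := fun x y h => by
        ext P
        exact mul_right_cancel₀ (ha P) (congrFun (Subtype.ext_iff.1 h) P)
      have := LinearMap.finrank_le_finrank_of_injective hf
      simpa using this
  let B : Module.Basis {P : HeightOneSpectrum (𝓞 K) // P ∈ S} ℤ I :=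
    (Module.finBasisOfFinrankEq ℤ I hrank).reindex (Fintype.equivFin _).symm
  choose g hgU hg using fun P => (B P).2
  refine ⟨fun P => (g P).toMul, hgU, fun x hx => ?_, fun b hb => ?_⟩
  · have hxI : ordVec S (Additive.ofMul x) ∈ I := ⟨Additive.ofMul x, hx, rfl⟩
    refine ⟨fun P => B.repr ⟨_, hxI⟩ P, ?_⟩
    have := congrArg Subtype.val (B.sum_repr ⟨_, hxI⟩)
    refine this.symm.trans ?_
    simp only [Submodule.coe_sum, Submodule.coe_smul]
    exact Finset.sum_congr rfl fun P _ => by rw [← hg P]; rfl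
  -- Expanding the vectors `Pi.single P (a P)` in the basis and dividing by `a P` gives an inverse
  -- `V` of the exponent matrix `W`; this yields independence over the reals, not only over the
  -- integers.
  · let W : Matrix {P : HeightOneSpectrum (𝓞 K) // P ∈ S} {P // P ∈ S} ℝ :=
      Matrix.of fun P Q => (ordVec S (g P) Q : ℝ)
    let V : Matrix {P : HeightOneSpectrum (𝓞 K) // P ∈ S} {P // P ∈ S} ℝ :=
      Matrix.of fun P Q => (B.repr ⟨_, haI P⟩ Q : ℝ) / a P
    have hVW : V * W = 1 := by
      ext P Q
      have h1 := congrFun (congrArg Subtype.val (B.sum_repr ⟨_, haI P⟩)) Q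
      simp only [Submodule.coe_sum, Submodule.coe_smul, Finset.sum_apply, Pi.smul_apply,
        smul_eq_mul] at h1
      have h2 : ∑ R, (B.repr ⟨_, haI P⟩ R : ℝ) * (ordVec S (g R) Q : ℝ) =
          ((Pi.single P (a P) : _ → ℤ) Q : ℝ) := by
        rw [← h1]
        push_cast
        refine Finset.sum_congr rfl fun R _ => ?_
        rw [← hg R]
        rfl
      have haP : (a P : ℝ) ≠ 0 := by exact_mod_cast ha P
      rw [Matrix.mul_apply]
      simp only [V, W, Matrix.of_apply, div_mul_eq_mul_div, ← Finset.sum_div]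
      rw [h2, Matrix.one_apply]
      rcases eq_or_ne P Q with rfl | hne
      · simp [haP]
      · rw [Pi.single_eq_of_ne hne.symm, if_neg hne]
        simp
    have hWV := mul_eq_one_comm.1 hVW
    have hbW : Matrix.vecMul b W = 0 := by
      ext Q
      exact hb Q
    rw [← Matrix.vecMul_one b, ← hWV, ← Matrix.vecMul_vecMul, hbW, Matrix.zero_vecMul]

end SUnitLogs


/-! ### Fundamental systems of `S`-units -/

section FundamentalSystems

open Matrix

theorem units_map_mem_torsion {K : Type u} [Field K] {u : (𝓞 K)ˣ} (hu : u ∈ Units.torsion K) :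
    Units.map (algebraMap (𝓞 K) K).toMonoidHom u ∈ CommGroup.torsion Kˣ := by
  obtain ⟨n, hn, h⟩ := isOfFinOrder_iff_pow_eq_one.1 hu
  exact isOfFinOrder_iff_pow_eq_one.2 ⟨n, hn, by rw [← map_pow, h, map_one]⟩

variable {K : Type u} [Field K] [NumberField K]

theorem exists_unit_of_valuation_eq_one {x : Kˣ}
    (h : ∀ v : HeightOneSpectrum (𝓞 K), HeightOneSpectrum.valuation K v (x : K) = 1) :
    ∃ u : (𝓞 K)ˣ, Units.map (algebraMap (𝓞 K) K).toMonoidHom u = x := by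
  obtain ⟨a, ha⟩ := HeightOneSpectrum.mem_integers_of_valuation_le_one K (x : K) fun v => (h v).le
  obtain ⟨b, hb⟩ := HeightOneSpectrum.mem_integers_of_valuation_le_one K ((x⁻¹ : Kˣ) : K)
    fun v => by
      rw [Units.val_inv_eq_inv_val, map_inv₀, h v, inv_one]
  have hinj := FaithfulSMul.algebraMap_injective (𝓞 K) K
  have hab : a * b = 1 := hinj (by rw [map_mul, ha, hb, map_one, Units.mul_inv])
  refine ⟨⟨a, b, hab, by rw [mul_comm, hab]⟩, Units.ext ha⟩

theorem valuation_units_map (v : HeightOneSpectrum (𝓞 K)) (u : (𝓞 K)ˣ) :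
    HeightOneSpectrum.valuation K v
      ((Units.map (algebraMap (𝓞 K) K).toMonoidHom u : Kˣ) : K) = 1 := by
  have := HeightOneSpectrum.valuation_of_unit_eq (K := K) v u
  rw [← HeightOneSpectrum.valuationOfNeZero_eq]
  exact_mod_cast this

/-- Roots of unity of `K` are units of the ring of integers, whose torsion is finite. -/
theorem finite_torsion : (CommGroup.torsion Kˣ : Set Kˣ).Finite := by
  have hfin : (Set.range fun u : Units.torsion K =>
      Units.map (algebraMap (𝓞 K) K).toMonoidHom u.1).Finite := Set.finite_range _
  refine hfin.subset fun ζ hζ => ?_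
  obtain ⟨n, hn, h⟩ := isOfFinOrder_iff_pow_eq_one.1 hζ
  obtain ⟨u, rfl⟩ := exists_unit_of_valuation_eq_one (x := ζ) fun v => by
    have h1 := torsion_le_unit (K := K) ∅ hζ
    exact mem_unit_iff.1 h1 v (by simp)
  refine ⟨⟨u, isOfFinOrder_iff_pow_eq_one.2 ⟨n, hn, ?_⟩⟩, rfl⟩
  rw [← map_pow, ← map_one (Units.map (algebraMap (𝓞 K) K).toMonoidHom)] at h
  exact Units.map_injective (FaithfulSMul.algebraMap_injective (𝓞 K) K) h

theorem logVec_units_map_inr (S : Finset (HeightOneSpectrum (𝓞 K))) (u : (𝓞 K)ˣ)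
    (P : {P : HeightOneSpectrum (𝓞 K) // P ∈ S}) :
    logVec S (Additive.ofMul (Units.map (algebraMap (𝓞 K) K).toMonoidHom u)) (Sum.inr P) = 0 := by
  rw [logVec_inr, ordVec_eq_zero_iff.2 (valuation_units_map P.1 u)]
  simp

/-- There is a finite family of the right size of `S`-units generating all `S`-units up to roots of
unity, whose logarithm vectors are linearly independent. -/
theorem exists_generators (S : Finset (HeightOneSpectrum (𝓞 K))) :
    ∃ G : Fin (sRank S) → Kˣ, (∀ i, G i ∈ (S : Set (HeightOneSpectrum (𝓞 K))).unit K) ∧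
      (∀ x ∈ (S : Set (HeightOneSpectrum (𝓞 K))).unit K, ∃ b : Fin (sRank S) → ℤ,
        modTorsion (Additive.ofMul x) = ∑ i, b i • modTorsion (Additive.ofMul (G i))) ∧
      LinearIndependent ℝ fun i => logVec S (Additive.ofMul (G i)) := by
  classical
  obtain ⟨G, hGU, hG, hGind⟩ := exists_ordVec_basis S
  let E : Fin (Units.rank K) ⊕ {P : HeightOneSpectrum (𝓞 K) // P ∈ S} → Kˣ :=
    Sum.elim (fun i => Units.map (algebraMap (𝓞 K) K).toMonoidHom (Units.fundSystem K i)) G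
  -- The unit rank is the number of infinite places minus one; adding the primes in `S` gives `s -
  -- 1`.
  have hcard : Fintype.card (Fin (Units.rank K) ⊕ {P : HeightOneSpectrum (𝓞 K) // P ∈ S}) =
      Fintype.card (Fin (sRank S)) := by
    have : 0 < Fintype.card (InfinitePlace K) := Fintype.card_pos
    rw [Fintype.card_sum, Fintype.card_fin, Fintype.card_fin, sRank, numPlaces, Fintype.card_sum,
      Units.rank]
    omega
  let e := Fintype.equivOfCardEq hcard.symm
  refine ⟨fun i => E (e i), fun i => ?_, fun x hx => ?_, ?_⟩
  · have : ∀ j, E j ∈ (S : Set (HeightOneSpectrum (𝓞 K))).unit K := by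
      rintro (i | P)
      · exact mem_unit_iff.2 fun v _ => valuation_units_map v _
      · exact hGU P
    exact this _
  · suffices h : ∃ b : _ → ℤ,
        modTorsion (Additive.ofMul x) = ∑ i, b i • modTorsion (Additive.ofMul (E i)) by
      obtain ⟨b, hb⟩ := h
      refine ⟨fun i => b (e i), ?_⟩
      rw [hb]
      exact (Equiv.sum_comp e fun i => b i • modTorsion (Additive.ofMul (E i))).symm
    obtain ⟨b, hb⟩ := hG x hx
    -- Dividing by `y` removes all primes in `S`, leaving a unit of the ring of integers, to which
    -- Dirichlet's theorem applies.
    let y : Kˣ := ∏ P, G P ^ b P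
    have hyU : y ∈ (S : Set (HeightOneSpectrum (𝓞 K))).unit K :=
      Subgroup.prod_mem _ fun P _ => Subgroup.zpow_mem _ (hGU P) _
    have hy : ordVec S (Additive.ofMul (x * y⁻¹)) = 0 := by
      rw [ofMul_mul, ofMul_inv, map_add, map_neg, hb, ofMul_prod, map_sum, ← sub_eq_add_neg,
        sub_eq_zero]
      simp only [ofMul_zpow, map_zsmul]
    obtain ⟨u, hu⟩ := exists_unit_of_valuation_eq_one (x := x * y⁻¹) fun v => by
      by_cases hv : v ∈ S
      · exact ordVec_eq_zero_iff (P := ⟨v, hv⟩) |>.1 (congrFun hy _)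
      · exact mem_unit_iff.1 (Subgroup.mul_mem _ hx (Subgroup.inv_mem _ hyU)) v hv
    obtain ⟨⟨ζ, c⟩, hζ, -⟩ := Units.exist_unique_eq_mul_prod K u
    simp only at hζ
    refine ⟨Sum.elim c b, ?_⟩
    rw [← exists_torsion_prod_iff]
    refine ⟨_, units_map_mem_torsion ζ.2, ?_⟩
    have hxy : x = (x * y⁻¹) * y := by rw [inv_mul_cancel_right]
    rw [hxy, ← hu, hζ, map_mul, map_prod, Fintype.prod_sum_type, mul_assoc]
    simp only [map_zpow, E, Sum.elim_inl, Sum.elim_inr, y]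
  -- The logarithms have block triangular form: those of units vanish at finite places. So the
  -- coefficients of `G` vanish first, and the rest is a relation in a basis of the unit lattice,
  -- which omits one infinite place.
  · have hind : LinearIndependent ℝ fun i => logVec S (Additive.ofMul (E i)) := by
      rw [Fintype.linearIndependent_iff]
      intro a ha
      rw [Fintype.sum_sum_type] at ha
      have hb : (fun P => a (Sum.inr P)) = 0 := by
        refine hGind _ fun Q => ?_
        have h1 := congrFun ha (Sum.inr Q)
        simp only [E, Sum.elim_inl, Sum.elim_inr, Pi.add_apply, Finset.sum_apply, Pi.smul_apply,
          smul_eq_mul, logVec_units_map_inr, mul_zero, Finset.sum_const_zero, zero_add,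
          Pi.zero_apply] at h1
        simp only [logVec_inr, ← mul_assoc, ← Finset.sum_mul] at h1
        refine (mul_eq_zero.1 h1).resolve_right (Real.log_pos ?_).ne'
        exact_mod_cast HeightOneSpectrum.one_lt_absNorm Q.1
      have hb' : ∀ P, a (Sum.inr P) = 0 := fun P => congrFun hb P
      simp only [hb', zero_smul, Finset.sum_const_zero, add_zero] at ha
      have hu := ((Units.basisUnitLattice K).ofZLatticeBasis ℝ
        (Units.unitLattice K)).linearIndependent
      rw [Fintype.linearIndependent_iff] at hu
      have ha0 := hu (fun i => a (Sum.inl i)) (by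
        ext w
        have h1 := congrFun ha (Sum.inl w.1)
        simp only [Finset.sum_apply, Pi.smul_apply, Pi.zero_apply] at h1 ⊢
        rw [← h1]
        refine Finset.sum_congr rfl fun i _ => ?_
        rw [Module.Basis.ofZLatticeBasis_apply, ← Units.logEmbedding_fundSystem,
          Units.dirichletUnitTheorem.logEmbedding_component, logVec_apply]
        simp [E, absV])
      rintro (i | P)
      · exact ha0 i
      · exact hb' P
    exact hind.comp e e.injective

variable {S : Finset (HeightOneSpectrum (𝓞 K))} {F T : Fin (sRank S) → Kˣ}

/-- Two representations of the same unit give the same logarithm vector, so independence of the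
logarithms forces equal exponents. -/
theorem exists_isFundamentalSystem (S : Finset (HeightOneSpectrum (𝓞 K))) :
    ∃ T : Fin (sRank S) → Kˣ, IsFundamentalSystem S T ∧
      LinearIndependent ℝ fun i => logVec S (Additive.ofMul (T i)) := by
  obtain ⟨G, hGU, hG, hind⟩ := exists_generators S
  refine ⟨G, (isFundamentalSystem_iff S G).2 ⟨hGU, fun x hx => ?_⟩, hind⟩
  obtain ⟨b, hb⟩ := hG x hx
  refine ⟨b, hb, fun b' hb' => ?_⟩
  have h1 := logVec_eq_sum S hb
  rw [logVec_eq_sum S hb', ← sub_eq_zero, ← Finset.sum_sub_distrib] at h1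
  rw [Fintype.linearIndependent_iff] at hind
  have h2 := hind (fun i => ((b' i - b i : ℤ) : ℝ)) (by
    rw [← h1]
    refine Finset.sum_congr rfl fun i _ => ?_
    rw [Int.cast_smul_eq_zsmul, sub_smul])
  ext i
  have := h2 i
  rw [Int.cast_eq_zero] at this
  omega

/-! ### Change of the fundamental system and the norm `N(F)` -/

/-- The system `F` arises from the system `T` by the exponent matrix `A`, up to roots of unity. -/
def IsTransform (T F : Fin (sRank S) → Kˣ) (A : Matrix (Fin (sRank S)) (Fin (sRank S)) ℤ) : Prop :=
  ∀ j, modTorsion (Additive.ofMul (F j)) = ∑ i, A i j • modTorsion (Additive.ofMul (T i))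

theorem IsTransform.sum_smul {A : Matrix (Fin (sRank S)) (Fin (sRank S)) ℤ}
    (h : IsTransform T F A) (b : Fin (sRank S) → ℤ) :
    ∑ j, b j • modTorsion (Additive.ofMul (F j)) =
      ∑ i, (A *ᵥ b) i • modTorsion (Additive.ofMul (T i)) := by
  simp only [h _, Finset.smul_sum, mulVec, dotProduct, Finset.sum_smul]
  rw [Finset.sum_comm]
  exact Finset.sum_congr rfl fun i _ => Finset.sum_congr rfl fun j _ => by rw [smul_smul, mul_comm]

/-- Each system is expressed by the other; substituting one expression into the other, uniqueness of
the exponents of `T j` yields the identity matrix. -/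
theorem IsFundamentalSystem.exists_transform (hT : IsFundamentalSystem S T)
    (hF : IsFundamentalSystem S F) : ∃ A B, A * B = 1 ∧ IsTransform T F A := by
  rw [isFundamentalSystem_iff] at hT hF
  choose A hA _ using fun j => hT.2 (F j) (hF.1 j)
  choose B hB _ using fun j => hF.2 (T j) (hT.1 j)
  have hA' : IsTransform T F (Matrix.of fun i j => A j i) := hA
  refine ⟨Matrix.of fun i j => A j i, Matrix.of fun i j => B j i, ?_, hA'⟩
  ext i j
  obtain ⟨b, _, hb⟩ := hT.2 (T j) (hT.1 j)
  have h1 := hb (fun i => (Matrix.of (fun i j => A j i) *ᵥ B j) i) (by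
    simp only []
    rw [hB j, hA'.sum_smul])
  have h2 := hb (Pi.single j 1) (by simp [Pi.single_apply, ite_smul])
  have h3 := congrFun (h1.trans h2.symm) i
  rw [Matrix.one_apply, Matrix.mul_apply]
  simp only [Pi.single_apply, mulVec, dotProduct, Matrix.of_apply] at h3
  exact h3

theorem IsFundamentalSystem.of_transform (hT : IsFundamentalSystem S T)
    {A B : Matrix (Fin (sRank S)) (Fin (sRank S)) ℤ} (hAB : A * B = 1)
    (h : IsTransform T F A) : IsFundamentalSystem S F := by
  rw [isFundamentalSystem_iff] at hT ⊢
  refine ⟨fun j => ?_, fun x hx => ?_⟩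
  · obtain ⟨ζ, hζ, hj⟩ := exists_torsion_prod_iff.2 (h j)
    rw [hj]
    exact Subgroup.mul_mem _ (torsion_le_unit S hζ)
      (Subgroup.prod_mem _ fun i _ => Subgroup.zpow_mem _ (hT.1 i) _)
  · obtain ⟨b, hb, hbu⟩ := hT.2 x hx
    have hBA := mul_eq_one_comm.1 hAB
    refine ⟨B *ᵥ b, ?_, fun c hc => ?_⟩
    · simp only []
      rw [h.sum_smul, mulVec_mulVec, hAB, one_mulVec, hb]
    · simp only [] at hc
      rw [h.sum_smul] at hc
      rw [← hbu _ hc]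
      rw [mulVec_mulVec, hBA, one_mulVec]

theorem IsTransform.logMatrix_eq {A : Matrix (Fin (sRank S)) (Fin (sRank S)) ℤ}
    (h : IsTransform T F A) : logMatrix S F = logMatrix S T * A.map (Int.cast : ℤ → ℝ) := by
  ext v j
  have := congrFun (logVec_eq_sum S (h j)) v
  rw [Matrix.mul_apply]
  simp only [Finset.sum_apply, logVec_apply, zsmul_eq_mul] at this
  rw [logMatrix, Matrix.of_apply, this]
  exact Finset.sum_congr rfl fun i _ => mul_comm _ _

theorem map_cast_mul_eq_one {n : ℕ} {A B : Matrix (Fin n) (Fin n) ℤ} (h : A * B = 1) :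
    A.map (Int.cast : ℤ → ℝ) * B.map (Int.cast : ℤ → ℝ) = 1 := by
  have h1 : (A * B).map (Int.castRingHom ℝ) = A.map (Int.castRingHom ℝ) * B.map (Int.castRingHom ℝ) :=
    Matrix.map_mul
  rw [h] at h1
  exact h1.symm.trans (Matrix.map_one _ (map_zero _) (map_one _))

/-- The matrix of logarithms of a fundamental system has independent columns. -/
theorem IsFundamentalSystem.injective_mulVec (hF : IsFundamentalSystem S F) :
    Function.Injective (logMatrix S F).mulVec := by
  obtain ⟨T, hT, hind⟩ := exists_isFundamentalSystem S
  obtain ⟨A, B, hAB, h⟩ := hT.exists_transform hF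
  have hTinj : Function.Injective (logMatrix S T).mulVec := by
    rw [Matrix.mulVec_injective_iff]
    exact hind
  have hBA := map_cast_mul_eq_one (mul_eq_one_comm.1 hAB)
  intro x y hxy
  rw [h.logMatrix_eq, ← mulVec_mulVec, ← mulVec_mulVec] at hxy
  have := congrArg (fun z => B.map (Int.cast : ℤ → ℝ) *ᵥ z) (hTinj hxy)
  simpa [mulVec_mulVec, hBA] using this

/-- Nonnegativity of `c` covers `m = 0`, where the supremum is `0` by convention. -/
theorem rowNorm_le_iff {m : ℕ} {ι : Type*} [Fintype ι] {A : Matrix (Fin m) ι ℝ} {c : ℝ}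
    (hc : 0 ≤ c) : rowNorm A ≤ c ↔ ∀ i, ∑ j, |A i j| ≤ c :=
  ⟨fun h i => (le_ciSup (f := fun i => ∑ j, |A i j|) (Set.finite_range _).bddAbove i).trans h,
    fun h => Real.iSup_le h hc⟩

/-- The norm of the system with exponent matrix `B⁻¹` is the largest dual norm of a row of `B`. -/
theorem isLeast_leftInverseNorms (hT : IsFundamentalSystem S T)
    {A B : Matrix (Fin (sRank S)) (Fin (sRank S)) ℤ} (hAB : A * B = 1) (h : IsTransform T F A) :
    IsLeast (leftInverseNorms S F)
      (⨆ i, coNorm (logMatrix S T) fun j => (B i j : ℝ)) := by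
  have hinj := hT.injective_mulVec
  have hA := map_cast_mul_eq_one hAB
  have hA' := map_cast_mul_eq_one (mul_eq_one_comm.1 hAB)
  -- Multiplying by `B` on the right turns the condition into one on the fixed matrix of `T`, and
  -- there the rows of `R'` are independent of each other.
  have hinv : ∀ R' : Matrix (Fin (sRank S)) (SPlace S) ℝ,
      R' * logMatrix S F = 1 ↔ R' * logMatrix S T = B.map (Int.cast : ℤ → ℝ) := fun R' => by
    rw [h.logMatrix_eq, ← Matrix.mul_assoc]
    constructor
    · intro h1
      rw [← Matrix.one_mul (B.map _), ← h1, Matrix.mul_assoc, hA, Matrix.mul_one]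
    · intro h1
      rw [h1, hA']
  have hlow : ∀ R' : Matrix (Fin (sRank S)) (SPlace S) ℝ, R' * logMatrix S F = 1 →
      ⨆ i, coNorm (logMatrix S T) (fun j => (B i j : ℝ)) ≤ rowNorm R' := by
    intro R' hR'
    have h0 : 0 ≤ rowNorm R' := Real.iSup_nonneg fun i => Finset.sum_nonneg fun _ _ => abs_nonneg _
    refine Real.iSup_le (fun i => ?_) h0
    have h1 : R' i ᵥ* logMatrix S T = fun j => (B i j : ℝ) := congrFun ((hinv R').1 hR') i
    refine (dualLE_iff hinj h0).1 (dualLE_of_vecMul h1 ?_)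
    exact (rowNorm_le_iff h0).1 le_rfl i
  constructor
  -- Hahn-Banach provides for each row of `B` a solution whose ℓ¹-norm is at most the dual norm.
  · choose r hr hr' using fun i => (dualLE_coNorm hinj fun j => (B i j : ℝ)).exists_vecMul hinj
      (coNorm_nonneg _ _)
    have hmul : Matrix.of r * logMatrix S F = 1 := (hinv _).2 (by ext i j; exact congrFun (hr i) j)
    refine ⟨Matrix.of r, hmul, le_antisymm (hlow _ hmul) ?_⟩
    refine (rowNorm_le_iff (Real.iSup_nonneg fun _ => coNorm_nonneg _ _)).2 fun i => ?_
    exact (hr' i).trans (le_ciSup (f := fun i => coNorm (logMatrix S T) fun j => (B i j : ℝ))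
      (Set.finite_range _).bddAbove i)
  · rintro _ ⟨R', hR', rfl⟩
    exact hlow R' hR'

theorem sysNorm_eq (hT : IsFundamentalSystem S T)
    {A B : Matrix (Fin (sRank S)) (Fin (sRank S)) ℤ} (hAB : A * B = 1) (h : IsTransform T F A) :
    sysNorm S F = ⨆ i, coNorm (logMatrix S T) fun j => (B i j : ℝ) :=
  (isLeast_leftInverseNorms hT hAB h).csInf_eq

theorem sysNorm_nonneg (hF : IsFundamentalSystem S F) : 0 ≤ sysNorm S F := by
  obtain ⟨A, B, hAB, h⟩ := hF.exists_transform hF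
  rw [sysNorm_eq hF hAB h]
  exact Real.iSup_nonneg fun _ => coNorm_nonneg _ _

theorem sysNorm_le_iff (hT : IsFundamentalSystem S T)
    {A B : Matrix (Fin (sRank S)) (Fin (sRank S)) ℤ} (hAB : A * B = 1) (h : IsTransform T F A)
    {c : ℝ} (hc : 0 ≤ c) :
    sysNorm S F ≤ c ↔ ∀ i, DualLE (logMatrix S T) (fun j => (B i j : ℝ)) c := by
  have hinj := hT.injective_mulVec
  rw [sysNorm_eq hT hAB h]
  simp only [dualLE_iff hinj hc]
  exact ⟨fun h i => (le_ciSup (f := fun i => coNorm (logMatrix S T) fun j => (B i j : ℝ))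
      (Set.finite_range _).bddAbove i).trans h, fun h => Real.iSup_le h hc⟩

theorem mem_systemsUpTo_iff (hT : IsFundamentalSystem S T) {c : ℝ} (hc : 0 ≤ c) :
    F ∈ systemsUpTo S c ↔ ∃ A, InverseLE (logMatrix S T) c A ∧ IsTransform T F A := by
  constructor
  · rintro ⟨hF, hN⟩
    obtain ⟨A, B, hAB, h⟩ := hT.exists_transform hF
    exact ⟨A, ⟨B, hAB, (sysNorm_le_iff hT hAB h hc).1 hN⟩, h⟩
  · rintro ⟨A, ⟨B, hAB, hB⟩, h⟩
    exact ⟨hT.of_transform hAB h, (sysNorm_le_iff hT hAB h hc).2 hB⟩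

theorem mem_systemsOf_iff {L : List (List (List ℤ))} :
    F ∈ systemsOf S T L ↔ ∃ A, matCode A ∈ L ∧ IsTransform T F (Matrix.of A) := by
  simp only [systemsOf, Set.mem_ofPred_eq, exists_torsion_prod_iff]
  rfl

theorem systemsOf_eq_systemsUpTo (hT : IsFundamentalSystem S T) {c : ℝ} (hc : 0 ≤ c)
    {L : List (List (List ℤ))}
    (hL : ∀ A : Fin (sRank S) → Fin (sRank S) → ℤ,
      matCode A ∈ L ↔ InverseLE (logMatrix S T) c (Matrix.of A)) :
    systemsOf S T L = systemsUpTo S c := by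
  ext F
  rw [mem_systemsUpTo_iff hT hc, mem_systemsOf_iff]
  simp only [hL]
  rfl

instance (S : Finset (HeightOneSpectrum (𝓞 K))) : Nonempty (SPlace S) :=
  ⟨Sum.inl (Classical.arbitrary _)⟩

/-- The inverse exponent matrices have entries bounded by `c * G`, they determine the exponent
matrices, and each of these leaves only finitely many choices of roots of unity. -/
theorem finite_systemsUpTo (S : Finset (HeightOneSpectrum (𝓞 K))) {c : ℝ} (hc : 0 ≤ c) :
    (systemsUpTo S c).Finite := by
  obtain ⟨T, hT, -⟩ := exists_isFundamentalSystem S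
  obtain ⟨G, hG⟩ := exists_nat_ge (∑ i, ∑ j, |logMatrix S T i j|)
  have hG' : ∀ i, ∑ j, |logMatrix S T i j| ≤ G := fun i =>
    (Finset.single_le_sum (f := fun i => ∑ j, |logMatrix S T i j|)
      (fun _ _ => Finset.sum_nonneg fun _ _ => abs_nonneg _) (Finset.mem_univ _)).trans hG
  have hA : {A : Fin (sRank S) → Fin (sRank S) → ℤ |
      InverseLE (logMatrix S T) c (Matrix.of A)}.Finite := by
    obtain ⟨M, hM⟩ := exists_nat_ge (c * G)
    have hB : (Set.univ.pi fun _ : Fin (sRank S) => Set.univ.pi fun _ : Fin (sRank S) =>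
        Set.Icc (-(M : ℤ)) M).Finite :=
      Set.Finite.pi fun _ => Set.Finite.pi fun _ => Set.finite_Icc _ _
    refine Set.Finite.of_finite_image (f := fun A => (Matrix.of A)⁻¹) (hB.subset ?_) ?_
    · rintro _ ⟨A, ⟨B, hAB, h⟩, rfl⟩ i _ j _
      change (Matrix.of A)⁻¹ i j ∈ Set.Icc (-(M : ℤ)) M
      rw [Matrix.inv_eq_right_inv hAB, Set.mem_Icc, ← abs_le]
      have := (abs_le_of_dualLE hG' hc (h i) j).trans hM
      exact_mod_cast this
    · rintro A ⟨B, hAB, -⟩ A' ⟨B', hAB', -⟩ he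
      simp only at he
      rw [Matrix.inv_eq_right_inv hAB, Matrix.inv_eq_right_inv hAB'] at he
      subst he
      exact Matrix.of.injective (left_inv_eq_right_inv hAB (mul_eq_one_comm.1 hAB'))
  have hZ : (Set.univ.pi fun _ : Fin (sRank S) => (CommGroup.torsion Kˣ : Set Kˣ)).Finite :=
    Set.Finite.pi fun _ => finite_torsion
  refine ((hA.prod hZ).image fun q j => q.2 j * ∏ i, T i ^ q.1 i j).subset fun F hF => ?_
  obtain ⟨A, hAc, h⟩ := (mem_systemsUpTo_iff hT hc).1 hF
  choose ζ hζ hF using fun j => exists_torsion_prod_iff.2 (h j)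
  exact ⟨(A, ζ), ⟨hAc, fun j _ => hζ j⟩, (funext hF).symm⟩

theorem exists_isOptimal (S : Finset (HeightOneSpectrum (𝓞 K))) : ∃ F, IsOptimal S F := by
  obtain ⟨T, hT, -⟩ := exists_isFundamentalSystem S
  obtain ⟨F, hF, hmin⟩ := Set.exists_min_image (systemsUpTo S (sysNorm S T)) (sysNorm S)
    (finite_systemsUpTo S (sysNorm_nonneg hT)) ⟨T, hT, le_rfl⟩
  refine ⟨F, hF.1, fun G hG => ?_⟩
  rcases le_total (sysNorm S G) (sysNorm S T) with h | h
  · exact hmin G ⟨hG, h⟩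
  · exact hF.2.trans h

end FundamentalSystems


/-! ### Searching for fundamental systems of bounded norm -/

section Search

open Matrix

variable {K : Type u} [Field K] [NumberField K] {S : Finset (HeightOneSpectrum (𝓞 K))}
  {F T : Fin (sRank S) → Kˣ}

theorem numPlaces_pos (S : Finset (HeightOneSpectrum (𝓞 K))) : 0 < numPlaces S :=
  Fintype.card_pos

instance (S : Finset (HeightOneSpectrum (𝓞 K))) : NeZero (numPlaces S) :=
  ⟨(numPlaces_pos S).ne'⟩

/-- The maximum norm does not depend on the order of the coordinates. This is needed because the
table lists the places in an arbitrary order. -/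
theorem dualLE_submatrix {ι κ : Type*} [Fintype ι] [Fintype κ] {n : ℕ} (e : κ ≃ ι)
    {R : Matrix ι (Fin n) ℝ} {b : Fin n → ℝ} {c : ℝ} :
    DualLE (R.submatrix e id) b c ↔ DualLE R b c := by
  have h : ∀ x, ‖R.submatrix e id *ᵥ x‖ = ‖R *ᵥ x‖ := fun x => by
    have h1 : R.submatrix e id *ᵥ x = (R *ᵥ x) ∘ e := rfl
    rw [h1]
    refine le_antisymm ?_ ?_
    · rw [pi_norm_le_iff_of_nonneg (norm_nonneg _)]
      exact fun i => norm_le_pi_norm (R *ᵥ x) (e i)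
    · rw [pi_norm_le_iff_of_nonneg (norm_nonneg _)]
      intro i
      have := norm_le_pi_norm ((R *ᵥ x) ∘ e) (e.symm i)
      simpa using this
  simp only [DualLE, h]

theorem inverseLE_submatrix {ι κ : Type*} [Fintype ι] [Fintype κ] {n : ℕ} (e : κ ≃ ι)
    {R : Matrix ι (Fin n) ℝ} {A : Matrix (Fin n) (Fin n) ℤ} {c : ℝ} :
    InverseLE (R.submatrix e id) c A ↔ InverseLE R c A := by
  simp only [InverseLE, dualLE_submatrix]

theorem IsValuationTable.tableOf {tab : List (List AlgCode)} (h : IsValuationTable S T tab) :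
    ∃ e : Fin (numPlaces S) ≃ SPlace S, TableOf ((logMatrix S T).submatrix e id) tab := by
  obtain ⟨e, code, rfl, hcode⟩ := h
  refine ⟨e, by simp [matCode], ?_, fun i j => ⟨absV (e i) (T j : K), absV_pos _ _, ?_, rfl⟩⟩
  · have h1 := getD_ofFn (fun i => List.ofFn (code i)) [] (⟨0, numPlaces_pos S⟩ : Fin (numPlaces S))
    simp only at h1
    rw [matCode, h1]
    simp
  · rw [matCode_getD]
    exact hcode i j

theorem injective_mulVec_submatrix {ι κ : Type*} {n : ℕ} (e : κ ≃ ι)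
    {R : Matrix ι (Fin n) ℝ} (h : Function.Injective R.mulVec) :
    Function.Injective (R.submatrix e id).mulVec := by
  intro x y hxy
  refine h (funext fun i => ?_)
  have := congrFun hxy (e.symm i)
  simpa [mulVec, dotProduct] using this

/-- A semidecidable form of the statement that the systems described by the list are those with norm
at most `lo`, and that all other systems have norm larger than `hi`. -/
def Separates (tab : List (List AlgCode)) (lo hi : RatCode) (L : List (List (List ℤ))) : Prop :=
  ∃ M, EntryBound tab hi M ∧ ListsSmall (tab.getD 0 []).length M (fun b => SmallNorm tab b lo)
    (fun b => LargeNorm tab b hi) L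

theorem semiDec_separates :
    SemiDec fun q : (List (List AlgCode) × RatCode × RatCode) × List (List (List ℤ)) =>
      Separates q.1.1 q.1.2.1 q.1.2.2 q.2 := by
  unfold Separates
  refine SemiDec.exists (SemiDec.and ?_ (SemiDec.listsSmall (by fun_prop) (by fun_prop) ?_ ?_
    (by fun_prop)))
  · exact semiDec_entryBound.comp (f := fun q : ((List (List AlgCode) × RatCode × RatCode) ×
      List (List (List ℤ))) × ℕ => (q.1.1.1, q.1.1.2.2, q.2)) (by fun_prop)
  · exact semiDec_smallNorm.comp (f := fun q : (((List (List AlgCode) × RatCode × RatCode) ×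
      List (List (List ℤ))) × ℕ) × List ℤ => (q.1.1.1.1, q.2, q.1.1.1.2.1)) (by fun_prop)
  · exact semiDec_largeNorm.comp (f := fun q : (((List (List AlgCode) × RatCode × RatCode) ×
      List (List (List ℤ))) × ℕ) × List ℤ => (q.1.1.1.1, q.2, q.1.1.1.2.2)) (by fun_prop)

variable {tab : List (List AlgCode)} {lo hi : RatCode} {L : List (List (List ℤ))}

/-- Small rows are certified at `lo ≤ c` and large rows at `hi ≥ c`; both statements remain valid at
`c`, so one list serves the whole interval. -/
theorem Separates.systemsOf_eq (hT : IsFundamentalSystem S T) (ht : IsValuationTable S T tab)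
    (h : Separates tab lo hi L) (h0 : 0 < lo.toReal) {c : ℝ} (hlo : lo.toReal ≤ c)
    (hhi : c ≤ hi.toReal) : systemsOf S T L = systemsUpTo S c := by
  obtain ⟨e, he⟩ := ht.tableOf
  obtain ⟨M, hM, hL⟩ := h
  rw [he.2.1] at hL
  refine systemsOf_eq_systemsUpTo hT (h0.le.trans hlo) fun A => ?_
  rw [hL.mem_iff (R := (logMatrix S T).submatrix e id) (c := c)
    (fun b hb => (hb.dualLE he h0).mono hlo)
    (fun b hb hd => hb.not_dualLE he (h0.trans_le (hlo.trans hhi)) (hd.mono hhi))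
    (fun b hb => hM.abs_le he (h0.trans_le hlo) hhi hb), inverseLE_submatrix]

theorem exists_isTransform (T : Fin (sRank S) → Kˣ)
    (A : Matrix (Fin (sRank S)) (Fin (sRank S)) ℤ) : ∃ F, IsTransform T F A := by
  refine ⟨fun j => ∏ i, T i ^ A i j, fun j => ?_⟩
  rw [ofMul_prod, map_sum]
  simp only [ofMul_zpow, map_zsmul]

/-- Each invertible `B` is the inverse exponent matrix of a fundamental system. If its norm is below
`lo`, all rows are strictly small; if it is above `hi`, some row is strictly large. Strictness makes
both cases certifiable. -/
theorem exists_separates (hT : IsFundamentalSystem S T) (ht : IsValuationTable S T tab)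
    (h0 : 0 < lo.toReal) (hle : lo.toReal ≤ hi.toReal)
    (h : ∀ F, IsFundamentalSystem S F → sysNorm S F ∉ Set.Icc lo.toReal hi.toReal) :
    ∃ L, Separates tab lo hi L := by
  obtain ⟨e, he⟩ := ht.tableOf
  obtain ⟨M, hM⟩ := exists_entryBound he hi
  have hinj := injective_mulVec_submatrix e hT.injective_mulVec
  obtain ⟨L, hL⟩ := exists_listsSmall (sRank S) M (Sm := fun b => SmallNorm tab b lo)
    (La := fun b => LargeNorm tab b hi) (by
      intro B hB
      obtain ⟨A, hA⟩ := hB.exists_left_inv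
      obtain ⟨F, hF⟩ := exists_isTransform T A
      have hfund := hT.of_transform hA hF
      have hnot := h F hfund
      rw [Set.mem_Icc, not_and_or, not_le, not_le] at hnot
      rcases hnot with hlt | hgt
      · left
        intro i
        refine smallNorm_of_coNorm_lt hinj he (lt_of_le_of_lt ?_ hlt)
        rw [← dualLE_iff hinj (sysNorm_nonneg hfund), dualLE_submatrix]
        exact (sysNorm_le_iff hT hA hF (sysNorm_nonneg hfund)).1 le_rfl i
      · right
        rw [← not_le, sysNorm_le_iff hT hA hF (h0.le.trans hle), not_forall] at hgt
        obtain ⟨i, hi'⟩ := hgt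
        refine ⟨i, largeNorm_of_not_dualLE he (h0.trans_le hle) ?_⟩
        rw [dualLE_submatrix]
        exact hi')
  exact ⟨L, M, hM, by rwa [he.2.1]⟩

/-- The certificates mention only the table and the two rational numbers, so a single search serves
all fields, sets of places and systems. -/
theorem exists_partrec_systemsUpTo :
    ∃ Φ : List (List AlgCode) × RatCode × RatCode →. List (List (List ℤ)), Partrec Φ ∧
      ∀ (K : Type u) [Field K] [NumberField K] (S : Finset (HeightOneSpectrum (𝓞 K)))
        (T : Fin (sRank S) → Kˣ) (tab : List (List AlgCode)),
        IsFundamentalSystem S T → IsValuationTable S T tab →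
        ∀ lo hi : RatCode, 0 < lo.toReal → lo.toReal ≤ hi.toReal →
          (∀ L ∈ Φ (tab, lo, hi), ∀ c : ℝ, lo.toReal ≤ c → c ≤ hi.toReal →
            systemsOf S T L = systemsUpTo S c) ∧
          ((∀ F, IsFundamentalSystem S F → sysNorm S F ∉ Set.Icc lo.toReal hi.toReal) →
            (Φ (tab, lo, hi)).Dom) := by
  obtain ⟨Φ, h1, h2, h3⟩ := SemiDec.exists_partrec (α := List (List AlgCode) × RatCode × RatCode)
    (β := List (List (List ℤ))) (p := fun a L => Separates a.1 a.2.1 a.2.2 L) semiDec_separates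
  refine ⟨Φ, h1, fun K _ _ S T tab hT ht lo hi h0 hle => ⟨fun L hL c hlo hhi => ?_, fun h => ?_⟩⟩
  · exact (h2 _ _ hL).systemsOf_eq hT ht h0 hlo hhi
  · exact h3 (tab, lo, hi) (exists_separates hT ht h0 hle h)

/-! ### Searching for optimal systems -/

theorem exists_ratCode_btwn {x y : ℝ} (h : x < y) : ∃ q : RatCode, x < q.toReal ∧ q.toReal < y := by
  obtain ⟨q, h1, h2⟩ := exists_rat_btwn h
  -- A code stores the denominator minus one.
  have : RatCode.toReal (q.num, q.den - 1) = q := by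
    rw [RatCode.toReal, Nat.cast_sub q.den_pos]
    simp only [Nat.cast_one, sub_add_cancel]
    exact_mod_cast q.num_div_den
  exact ⟨_, by rwa [this], by rwa [this]⟩

/-- The list describes exactly the systems with norm at most `lo`, there is such a system, and all
systems have norm at least `lo - 1 / (n + 1)`. -/
def NearlyOptimal (tab : List (List AlgCode)) (n : ℕ) (L : List (List (List ℤ))) : Prop :=
  ∃ w : RatCode × RatCode, 0 < w.1.1 ∧ 0 < w.2.1 ∧ 0 < L.length ∧ Separates tab w.1 w.1 L ∧
    (w.1.1 * (n + 1 : ℕ) ≤ (w.1.2 + 1 : ℕ) ∨ (w.1.1 * (w.2.2 + 1 : ℕ) * (n + 1 : ℕ) ≤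
      w.2.1 * (w.1.2 + 1 : ℕ) * (n + 1 : ℕ) + (w.1.2 + 1 : ℕ) * (w.2.2 + 1 : ℕ) ∧
      Separates tab w.2 w.2 []))

theorem semiDec_nearlyOptimal :
    SemiDec fun q : (List (List AlgCode) × ℕ) × List (List (List ℤ)) =>
      NearlyOptimal q.1.1 q.1.2 q.2 := by
  unfold NearlyOptimal
  refine SemiDec.exists (SemiDec.and (PrimrecPred.semiDec (by fun_prop))
    (SemiDec.and (PrimrecPred.semiDec (by fun_prop)) (SemiDec.and (PrimrecPred.semiDec (by fun_prop))
    (SemiDec.and ?_ (SemiDec.or (PrimrecPred.semiDec (by fun_prop))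
    (SemiDec.and (PrimrecPred.semiDec (by fun_prop)) ?_))))))
  · exact semiDec_separates.comp (f := fun q : ((List (List AlgCode) × ℕ) ×
      List (List (List ℤ))) × (RatCode × RatCode) => ((q.1.1.1, q.2.1, q.2.1), q.1.2))
      (by fun_prop)
  · exact semiDec_separates.comp (f := fun q : ((List (List AlgCode) × ℕ) ×
      List (List (List ℤ))) × (RatCode × RatCode) => ((q.1.1.1, q.2.2, q.2.2), [])) (by fun_prop)

theorem Separates.nonempty_iff (hT : IsFundamentalSystem S T) (ht : IsValuationTable S T tab)
    (h : Separates tab lo lo L) (h0 : 0 < lo.toReal) :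
    (systemsUpTo S lo.toReal).Nonempty ↔ L ≠ [] := by
  rw [← h.systemsOf_eq hT ht h0 le_rfl le_rfl]
  constructor
  · rintro ⟨F, hF⟩ rfl
    obtain ⟨A, hA, -⟩ := mem_systemsOf_iff.1 hF
    simp at hA
  · intro hne
    obtain ⟨A, hA⟩ := List.exists_mem_of_ne_nil L hne
    obtain ⟨e, he⟩ := ht.tableOf
    obtain ⟨M, -, hL⟩ := h
    rw [he.2.1] at hL
    obtain ⟨A, rfl⟩ := isMatrixCode_iff.1 (hL.1 A hA).1
    obtain ⟨F, hF⟩ := exists_isTransform T (Matrix.of A)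
    exact ⟨F, mem_systemsOf_iff.2 ⟨A, hA, hF⟩⟩

/-- Some system has norm at most `q`, so all optimal ones do. The excess of `q` over the minimum is
at most `1 / (n + 1)`: either `q` itself is that small, or the empty list certifies that all norms
exceed some `q' ≥ q - 1 / (n + 1)`. -/
theorem NearlyOptimal.spec (hT : IsFundamentalSystem S T) (ht : IsValuationTable S T tab) {n : ℕ}
    (h : NearlyOptimal tab n L) : {F | IsOptimal S F} ⊆ systemsOf S T L ∧
      ∀ F ∈ systemsOf S T L, IsFundamentalSystem S F ∧
        ∀ G, IsFundamentalSystem S G → sysNorm S F ≤ sysNorm S G + 1 / ((n : ℝ) + 1) := by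
  obtain ⟨⟨q, q'⟩, hq, hq', hlen, hsep, hor⟩ := h
  simp only at hq hq' hsep hor
  have h0 := RatCode.toReal_pos_iff.2 hq
  have h0' := RatCode.toReal_pos_iff.2 hq'
  have hn : (0 : ℝ) < (n : ℝ) + 1 := by positivity
  rw [hsep.systemsOf_eq hT ht h0 le_rfl le_rfl]
  constructor
  · intro F hF
    obtain ⟨G, hG, hGq⟩ := (hsep.nonempty_iff hT ht h0).2 (List.length_pos_iff.1 hlen)
    exact ⟨hF.1, (hF.2 G hG).trans hGq⟩
  · rintro F ⟨hF, hFq⟩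
    refine ⟨hF, fun G hG => hFq.trans ?_⟩
    rcases hor with h1 | ⟨h1, h2⟩
    · have h3 : q.toReal ≤ 1 / ((n : ℝ) + 1) := by
        rw [RatCode.toReal, div_le_div_iff₀ (by positivity) hn, one_mul]
        exact_mod_cast h1
      linarith [sysNorm_nonneg hG]
    · have h3 : q.toReal ≤ q'.toReal + 1 / ((n : ℝ) + 1) := by
        rw [RatCode.toReal, RatCode.toReal, div_add_div _ _ (by positivity) hn.ne',
          div_le_div_iff₀ (by positivity) (by positivity)]
        have : (q.1 : ℝ) * (q'.2 + 1) * (n + 1) ≤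
            q'.1 * (q.2 + 1) * (n + 1) + (q.2 + 1) * (q'.2 + 1) := by exact_mod_cast h1
        linarith
      have h4 : q'.toReal < sysNorm S G := by
        by_contra hle
        exact (h2.nonempty_iff hT ht h0').1 ⟨G, hG, not_lt.1 hle⟩ rfl
      linarith

/-- There is a gap above the smallest norm. -/
theorem exists_gap (hF : IsOptimal S F) : ∃ δ : ℝ, 0 < δ ∧
    ∀ G, IsFundamentalSystem S G → sysNorm S G < sysNorm S F + δ → IsOptimal S G := by
  have hfin := (finite_systemsUpTo S
    (add_nonneg (sysNorm_nonneg hF.1) zero_le_one)).subset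
    (Set.sep_subset (systemsUpTo S (sysNorm S F + 1)) fun G => ¬ IsOptimal S G)
  have hopt : ∀ G, IsFundamentalSystem S G → sysNorm S G ≤ sysNorm S F → IsOptimal S G :=
    fun G hG hle => ⟨hG, fun H hH => hle.trans (hF.2 H hH)⟩
  rcases Set.eq_empty_or_nonempty
    {G ∈ systemsUpTo S (sysNorm S F + 1) | ¬ IsOptimal S G} with he | hne
  · refine ⟨1, one_pos, fun G hG hlt => ?_⟩
    by_contra hno
    have : G ∈ {G ∈ systemsUpTo S (sysNorm S F + 1) | ¬ IsOptimal S G} := ⟨⟨hG, hlt.le⟩, hno⟩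
    rw [he] at this
    exact this
  · obtain ⟨H, ⟨hH, hHno⟩, hmin⟩ := Set.exists_min_image _ (sysNorm S) hfin hne
    -- Here `H` has least norm among the non-optimal systems of norm at most the minimum plus `1`.
    refine ⟨min 1 (sysNorm S H - sysNorm S F), lt_min one_pos ?_, fun G hG hlt => ?_⟩
    · rw [sub_pos]
      by_contra hle
      exact hHno (hopt H hH.1 (not_lt.1 hle))
    · by_contra hno
      have h1 := hmin G ⟨⟨hG, (hlt.trans_le (add_le_add_right (min_le_left _ _) _)).le⟩, hno⟩
      have h2 := min_le_right 1 (sysNorm S H - sysNorm S F)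
      linarith

theorem exists_nearlyOptimal (hT : IsFundamentalSystem S T) (ht : IsValuationTable S T tab)
    (n : ℕ) : ∃ L, NearlyOptimal tab n L := by
  obtain ⟨F, hF⟩ := exists_isOptimal S
  obtain ⟨δ, hδ, hgap⟩ := exists_gap hF
  have hμ := sysNorm_nonneg hF.1
  set μ := sysNorm S F with hμdef
  have hn : (0 : ℝ) < (n : ℝ) + 1 := by positivity
  have hε : (0 : ℝ) < 1 / (2 * ((n : ℝ) + 1)) := by positivity
  have hεε : 1 / (2 * ((n : ℝ) + 1)) + 1 / (2 * ((n : ℝ) + 1)) = 1 / ((n : ℝ) + 1) := by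
    field_simp
    norm_num
  -- A number strictly inside the gap is no value of `N`, so the search at `q` succeeds. Half of the
  -- accuracy is used here, the other half for `q'`.
  obtain ⟨q, hq1, hq2⟩ := exists_ratCode_btwn
    (show μ < μ + min δ (1 / (2 * ((n : ℝ) + 1))) from lt_add_of_pos_right _ (lt_min hδ hε))
  have hq0 : 0 < q.toReal := hμ.trans_lt hq1
  have hqδ : q.toReal < μ + δ := hq2.trans_le (add_le_add_right (min_le_left _ _) _)
  have hqε : q.toReal < μ + 1 / (2 * ((n : ℝ) + 1)) :=
    hq2.trans_le (add_le_add_right (min_le_right _ _) _)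
  obtain ⟨L, hL⟩ := exists_separates hT ht hq0 le_rfl (fun G hG hmem => by
    rw [Set.Icc_self, Set.mem_singleton_iff] at hmem
    have := (hgap G hG (hmem ▸ hqδ)).2 F hF.1
    rw [hmem] at this
    linarith)
  have hlen : 0 < L.length :=
    List.length_pos_iff.2 ((hL.nonempty_iff hT ht hq0).1 ⟨F, hF.1, hq1.le⟩)
  refine ⟨L, ?_⟩
  -- A positive `q'` below the minimum need not exist, as the minimum may be `0`. If `q > 1 / (n +
  -- 1)`, then `q' > q - 1 / (n + 1)` is positive.
  by_cases hsmall : q.1 * (n + 1 : ℕ) ≤ (q.2 + 1 : ℕ)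
  · exact ⟨(q, q), RatCode.toReal_pos_iff.1 hq0, RatCode.toReal_pos_iff.1 hq0, hlen, hL,
      Or.inl hsmall⟩
  · have h1 : 1 / ((n : ℝ) + 1) < q.toReal := by
      rw [RatCode.toReal, div_lt_div_iff₀ hn (by positivity), one_mul]
      exact_mod_cast not_le.1 hsmall
    obtain ⟨q', hq'1, hq'2⟩ := exists_ratCode_btwn
      (show μ - 1 / (2 * ((n : ℝ) + 1)) < μ from sub_lt_self _ hε)
    have hq'0 : 0 < q'.toReal := by linarith
    obtain ⟨L', hL'⟩ := exists_separates hT ht hq'0 le_rfl (fun G hG hmem => by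
      rw [Set.Icc_self, Set.mem_singleton_iff] at hmem
      have := hF.2 G hG
      rw [hmem] at this
      linarith)
    have hnil : L' = [] := by
      by_contra hne
      obtain ⟨G, hG, hGle⟩ := (hL'.nonempty_iff hT ht hq'0).2 hne
      have := hF.2 G hG
      linarith
    subst hnil
    refine ⟨(q, q'), RatCode.toReal_pos_iff.1 hq0, RatCode.toReal_pos_iff.1 hq'0, hlen, hL,
      Or.inr ⟨?_, hL'⟩⟩
    have h2 : q.toReal ≤ q'.toReal + 1 / ((n : ℝ) + 1) := by linarith
    rw [RatCode.toReal, RatCode.toReal, div_add_div _ _ (by positivity) hn.ne',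
      div_le_div_iff₀ (by positivity) (by positivity)] at h2
    have : (q.1 : ℝ) * (q'.2 + 1) * (n + 1) ≤
        q'.1 * (q.2 + 1) * (n + 1) + (q.2 + 1) * (q'.2 + 1) := by linarith
    exact_mod_cast this

theorem exists_partrec_optimal :
    ∃ Ψ : List (List AlgCode) × ℕ →. List (List (List ℤ)), Partrec Ψ ∧
      ∀ (K : Type u) [Field K] [NumberField K] (S : Finset (HeightOneSpectrum (𝓞 K)))
        (T : Fin (sRank S) → Kˣ) (tab : List (List AlgCode)),
        IsFundamentalSystem S T → IsValuationTable S T tab →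
        (∀ n : ℕ, ∃ L ∈ Ψ (tab, n), {F | IsOptimal S F} ⊆ systemsOf S T L ∧
          ∀ F ∈ systemsOf S T L, IsFundamentalSystem S F ∧
            ∀ G, IsFundamentalSystem S G → sysNorm S F ≤ sysNorm S G + 1 / ((n : ℝ) + 1)) ∧
        ∃ n₀ : ℕ, ∀ n ≥ n₀, ∃ L ∈ Ψ (tab, n), systemsOf S T L = {F | IsOptimal S F} := by
  obtain ⟨Ψ, h1, h2, h3⟩ := SemiDec.exists_partrec (α := List (List AlgCode) × ℕ)
    (β := List (List (List ℤ))) (p := fun a L => NearlyOptimal a.1 a.2 L) semiDec_nearlyOptimal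
  refine ⟨Ψ, h1, fun K _ _ S T tab hT ht => ?_⟩
  have key : ∀ n, ∃ L ∈ Ψ (tab, n), NearlyOptimal tab n L := fun n => by
    have hdom := h3 (tab, n) (exists_nearlyOptimal hT ht n)
    exact ⟨_, Part.get_mem hdom, h2 _ _ (Part.get_mem hdom)⟩
  refine ⟨fun n => ?_, ?_⟩
  · obtain ⟨L, hL, hopt⟩ := key n
    exact ⟨L, hL, hopt.spec hT ht⟩
  · obtain ⟨F, hF⟩ := exists_isOptimal S
    obtain ⟨δ, hδ, hgap⟩ := exists_gap hF
    -- Once the accuracy is finer than the gap, every listed system is optimal.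
    obtain ⟨n₀, hn₀⟩ := exists_nat_one_div_lt hδ
    refine ⟨n₀, fun n hn => ?_⟩
    obtain ⟨L, hL, hopt⟩ := key n
    obtain ⟨hsub, hspec⟩ := hopt.spec hT ht
    refine ⟨L, hL, Set.Subset.antisymm (fun G hG => ?_) hsub⟩
    obtain ⟨hGf, hGle⟩ := hspec G hG
    refine hgap G hGf ((hGle F hF.1).trans_lt ?_)
    have : 1 / ((n : ℝ) + 1) ≤ 1 / ((n₀ : ℝ) + 1) := by gcongr
    linarith

end Search


/-! ### The dual norm as a maximum of finitely many linear forms -/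

section Polyhedral

open Matrix

variable {ι : Type*} [Fintype ι] {n : ℕ} {R : Matrix ι (Fin n) ℝ}

theorem DualLE.dotProduct_le {b : Fin n → ℝ} {c : ℝ} (h : DualLE R b c) (hc : 0 ≤ c)
    {x : Fin n → ℝ} (hx : ‖R *ᵥ x‖ ≤ 1) : b ⬝ᵥ x ≤ c :=
  (h x).trans (mul_le_of_le_one_right hc hx)

/-- The dual norm is attained on the unit ball. -/
theorem exists_dotProduct_eq_coNorm (hR : Function.Injective R.mulVec) (b : Fin n → ℝ) :
    ∃ x, ‖R *ᵥ x‖ ≤ 1 ∧ b ⬝ᵥ x = coNorm R b := by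
  obtain ⟨κ, hκ, hle⟩ := exists_mul_norm_le hR
  have hcont : Continuous fun x : Fin n → ℝ => ‖R *ᵥ x‖ := by fun_prop
  have hcomp : IsCompact {x : Fin n → ℝ | ‖R *ᵥ x‖ ≤ 1} := by
    refine Metric.isCompact_of_isClosed_isBounded (isClosed_le hcont continuous_const)
      ((Metric.isBounded_closedBall (x := 0) (r := κ⁻¹)).subset fun x hx => ?_)
    rw [mem_closedBall_zero_iff, ← one_mul κ⁻¹, ← div_eq_mul_inv, le_div_iff₀ hκ, mul_comm]
    exact (hle x).trans hx
  obtain ⟨x, hx, hmax⟩ := hcomp.exists_isMaxOn ⟨0, by simp⟩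
    (f := fun x => b ⬝ᵥ x) (by fun_prop)
  refine ⟨x, hx, le_antisymm ((dualLE_coNorm hR b).dotProduct_le (coNorm_nonneg _ _) hx) ?_⟩
  have h0 : 0 ≤ b ⬝ᵥ x := by simpa using hmax (show (0 : Fin n → ℝ) ∈ _ by simp)
  rw [← dualLE_iff hR h0]
  intro y
  rcases (norm_nonneg (R *ᵥ y)).eq_or_lt with h | h
  · have := dualLE_coNorm hR b y
    rwa [← h, mul_zero] at this ⊢
  · have h1 := hmax (show ‖R *ᵥ y‖⁻¹ • y ∈ {x : Fin n → ℝ | ‖R *ᵥ x‖ ≤ 1} by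
      simp [mulVec_smul, norm_smul, inv_mul_cancel₀ h.ne'])
    simp only [dotProduct_smul, smul_eq_mul, Set.mem_ofPred_eq] at h1
    rwa [inv_mul_le_iff₀ h, mul_comm] at h1

/-- The set `X` of points of the unit ball contains a maximum of each integral linear form. -/
def IsMaximizing (R : Matrix ι (Fin n) ℝ) (X : Finset (Fin n → ℝ)) : Prop :=
  (∀ x ∈ X, ‖R *ᵥ x‖ ≤ 1) ∧
    ∀ b : Fin n → ℤ, ∃ x ∈ X, (fun j => (b j : ℝ)) ⬝ᵥ x = coNorm R fun j => (b j : ℝ)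

/-- Complementary slackness: if `r` represents `b` with least ℓ¹-norm, a point of the unit ball
maximises `b` exactly when `(R *ᵥ x) i` is the sign of `r i` wherever `r i ≠ 0`. So one point for
each of the finitely many sign patterns suffices. -/
theorem exists_isMaximizing (hR : Function.Injective R.mulVec) : ∃ X, IsMaximizing R X := by
  classical
  let P : (ι → SignType) → (Fin n → ℝ) → Prop := fun σ x =>
    ‖R *ᵥ x‖ ≤ 1 ∧ ∀ i, σ i ≠ 0 → (R *ᵥ x) i = σ i
  let pt : (ι → SignType) → (Fin n → ℝ) := fun σ => if h : ∃ x, P σ x then h.choose else 0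
  refine ⟨Finset.univ.image pt, fun x hx => ?_, fun b => ?_⟩
  · obtain ⟨σ, -, rfl⟩ := Finset.mem_image.1 hx
    simp only [pt]
    split_ifs with h
    · exact h.choose_spec.1
    · simp
  · set b' : Fin n → ℝ := fun j => (b j : ℝ) with hb'
    obtain ⟨x, hx, hxb⟩ := exists_dotProduct_eq_coNorm hR b'
    obtain ⟨r, hr, hrs⟩ := (dualLE_coNorm hR b').exists_vecMul hR (coNorm_nonneg _ _)
    let σ : ι → SignType := fun i => SignType.sign (r i)
    have hdot : ∀ y, b' ⬝ᵥ y = ∑ i, r i * (R *ᵥ y) i := fun y => by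
      rw [← hr, ← dotProduct_mulVec]
      rfl
    have hle : ∀ i, r i * (R *ᵥ x) i ≤ |r i| := fun i => by
      refine (le_abs_self _).trans ?_
      rw [abs_mul]
      exact mul_le_of_le_one_right (abs_nonneg _) ((norm_le_pi_norm (R *ᵥ x) i).trans hx)
    -- The sums over both sides agree, so each of the termwise inequalities is an equality.
    have heq : ∀ i, r i * (R *ᵥ x) i = |r i| := fun i => by
      refine (Finset.sum_eq_sum_iff_of_le fun i _ => hle i).1 (le_antisymm
        (Finset.sum_le_sum fun i _ => hle i) ?_) i (Finset.mem_univ _)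
      rw [← hdot, hxb]
      exact hrs
    have hP : ∃ x, P σ x := by
      refine ⟨x, hx, fun i hi => ?_⟩
      have hri : r i ≠ 0 := by simpa [σ, sign_eq_zero_iff] using hi
      refine mul_left_cancel₀ hri ((heq i).trans ?_)
      rw [mul_comm, sign_mul_self]
    refine ⟨pt σ, Finset.mem_image_of_mem _ (Finset.mem_univ _), ?_⟩
    have hspec : P σ (pt σ) := by
      simp only [pt]
      rw [dif_pos hP]
      exact hP.choose_spec
    refine le_antisymm ((dualLE_coNorm hR b').dotProduct_le (coNorm_nonneg _ _) hspec.1) ?_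
    rw [← hxb, hdot, hdot]
    refine Finset.sum_le_sum fun i _ => ?_
    rw [heq]
    by_cases hri : r i = 0
    · simp [hri]
    · rw [hspec.2 i (by simpa [σ, sign_eq_zero_iff] using hri), mul_comm, sign_mul_self]

/-- The dual norm is, on integral vectors, the maximum of finitely many linear forms each of which is
the directional derivative of the dual norm at some integral vector. -/
theorem exists_exposed_points (hR : Function.Injective R.mulVec) :
    ∃ (X : Finset (Fin n → ℝ)) (β : (Fin n → ℝ) → Fin n → ℤ), IsMaximizing R X ∧
      ∀ x ∈ X, (fun j => (β x j : ℝ)) ⬝ᵥ x = coNorm R (fun j => (β x j : ℝ)) ∧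
        ∀ b : Fin n → ℤ, ∃ N : ℕ, coNorm R (fun j => ((N * β x j + b j : ℤ) : ℝ)) =
          N * coNorm R (fun j => (β x j : ℝ)) + (fun j => (b j : ℝ)) ⬝ᵥ x := by
  classical
  -- For an inclusion-minimal `X`, removing `x` spoils the maximum for some integral `β`, so `x` is
  -- the only maximiser of `β` in `X`.
  obtain ⟨X, hX, hmin⟩ := WellFounded.has_min (r := ((· < ·) : Finset (Fin n → ℝ) → _ → Prop))
    wellFounded_lt {X | IsMaximizing R X} (exists_isMaximizing hR)
  have hbound : ∀ x ∈ X, ∀ b, b ⬝ᵥ x ≤ coNorm R b := fun x hx b =>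
    (dualLE_coNorm hR b).dotProduct_le (coNorm_nonneg _ _) (hX.1 x hx)
  have hstrict : ∀ x, ∃ β : Fin n → ℤ, x ∈ X → ∀ y ∈ X, y ≠ x →
      (fun j => (β j : ℝ)) ⬝ᵥ y < coNorm R (fun j => (β j : ℝ)) := by
    intro x
    by_cases hx : x ∈ X
    · have h1 := fun h => hmin (X.erase x) h (Finset.erase_ssubset hx)
      have h2 : ¬ ∀ b : Fin n → ℤ, ∃ y ∈ X.erase x,
          (fun j => (b j : ℝ)) ⬝ᵥ y = coNorm R fun j => (b j : ℝ) := fun h =>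
        h1 ⟨fun y hy => hX.1 y (Finset.mem_of_mem_erase hy), h⟩
      push Not at h2
      obtain ⟨β, hβ⟩ := h2
      exact ⟨β, fun _ y hy hyx => lt_of_le_of_ne (hbound y hy _)
        (hβ y (Finset.mem_erase.2 ⟨hyx, hy⟩))⟩
    · exact ⟨0, fun h => absurd h hx⟩
  choose β hβ using hstrict
  refine ⟨X, β, hX, fun x hx => ?_⟩
  have hmax : (fun j => (β x j : ℝ)) ⬝ᵥ x = coNorm R (fun j => (β x j : ℝ)) := by
    obtain ⟨y, hy, hyb⟩ := hX.2 (β x)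
    by_cases hyx : y = x
    · rwa [hyx] at hyb
    · exact absurd hyb (hβ x hx y hy hyx).ne
  refine ⟨hmax, fun b => ?_⟩
  have hexp : ∀ (N : ℕ) (y : Fin n → ℝ), (fun j => ((N * β x j + b j : ℤ) : ℝ)) ⬝ᵥ y =
      N * ((fun j => (β x j : ℝ)) ⬝ᵥ y) + (fun j => (b j : ℝ)) ⬝ᵥ y := fun N y => by
    simp only [dotProduct, Finset.mul_sum, ← Finset.sum_add_distrib]
    exact Finset.sum_congr rfl fun j _ => by push_cast; ring
  -- The strict advantage of `x` on `β` outweighs the contribution of `b` once multiplied by a large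
  -- `N`, so `x` is also the only maximiser of `N * β + b`.
  have hev : ∀ᶠ N : ℕ in Filter.atTop, ∀ y ∈ X, y ≠ x →
      (fun j => ((N * β x j + b j : ℤ) : ℝ)) ⬝ᵥ y < (fun j => ((N * β x j + b j : ℤ) : ℝ)) ⬝ᵥ x := by
    rw [Filter.eventually_all_finset]
    intro y hy
    by_cases hyx : y = x
    · simp [hyx]
    have hpos := sub_pos.2 (hβ x hx y hy hyx)
    obtain ⟨N₀, hN₀⟩ := exists_nat_gt (((fun j => (b j : ℝ)) ⬝ᵥ y - (fun j => (b j : ℝ)) ⬝ᵥ x) /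
      (coNorm R (fun j => (β x j : ℝ)) - (fun j => (β x j : ℝ)) ⬝ᵥ y))
    filter_upwards [Filter.eventually_ge_atTop N₀] with N hN _
    have h1 : (N₀ : ℝ) ≤ N := by exact_mod_cast hN
    have h2 := (div_lt_iff₀ hpos).1 (hN₀.trans_le h1)
    rw [hexp, hexp, hmax]
    linarith
  obtain ⟨N, hN⟩ := hev.exists
  refine ⟨N, ?_⟩
  obtain ⟨y, hy, hyb⟩ := hX.2 fun j => N * β x j + b j
  by_cases hyx : y = x
  · rw [← hyb, hyx, hexp, hmax]
  · exact absurd (hyb ▸ hbound x hx _) (not_le.2 (hN y hy hyx))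

end Polyhedral

/-! ### Rational relations -/

/-- The integral relations between real numbers are the solutions of finitely many linear equations
with integral coefficients. -/
theorem exists_linear_equations {n : ℕ} (x : Fin n → ℝ) : ∃ (k : ℕ) (A : Fin k → Fin n → ℤ)
    (B : Fin k → ℤ), ∀ (b : Fin n → ℤ) (d a : ℤ),
      d * ∑ j, b j * x j = a ↔ ∀ i, d * ∑ j, b j * A i j = a * B i := by
  -- The map sends `(b, a)` to `∑ j, b j * x j - a`. Its range is finitely generated and
  -- torsion-free, hence free, and the equations say that the coordinates in a basis vanish.
  let φ : ((Fin n → ℤ) × ℤ) →ₗ[ℤ] ℝ :=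
    (Fintype.linearCombination ℤ x).coprod (LinearMap.toSpanSingleton ℤ ℝ (-1))
  let bas := Module.finBasis ℤ (LinearMap.range φ)
  let ψ := φ.rangeRestrict
  refine ⟨_, fun i j => bas.repr (ψ (Pi.single j 1, 0)) i, fun i => - bas.repr (ψ (0, 1)) i,
    fun b d a => ?_⟩
  have h1 : (d * ∑ j, b j * x j = a) ↔ ψ (d • b, a) = 0 := by
    rw [← Subtype.coe_inj]
    simp [ψ, φ, Fintype.linearCombination_apply, Finset.mul_sum, mul_assoc, ← sub_eq_add_neg,
      sub_eq_zero]
  have h2 : ψ (d • b, a) = d • ∑ j, b j • ψ (Pi.single j 1, 0) + a • ψ (0, 1) := by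
    simp only [← map_smul, ← map_sum, ← map_add]
    congr 1
    ext
    · simp [Finset.sum_apply, Prod.fst_sum, Pi.single_apply]
    · simp [Prod.snd_sum]
  rw [h1, h2, ← bas.repr.map_eq_zero_iff, Finsupp.ext_iff]
  refine forall_congr' fun i => ?_
  simp [add_eq_zero_iff_eq_neg]

/-! ### Descriptions of algebraic numbers -/

theorem evalPoly_ofFn {n : ℕ} (f : Fin n → ℤ) (x : ℝ) :
    evalPoly (List.ofFn f) x = ∑ i, (f i : ℝ) * x ^ (i : ℕ) := by
  induction n with
  | zero => simp [evalPoly]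
  | succ n ih =>
    rw [List.ofFn_succ, Fin.sum_univ_succ]
    have h1 : ∀ (a : ℤ) p, evalPoly (a :: p) x = a + x * evalPoly p x := fun _ _ => rfl
    rw [h1, ih, Finset.mul_sum]
    simp only [Fin.val_zero, pow_zero, mul_one, Fin.val_succ, pow_succ]
    congr 1
    exact Finset.sum_congr rfl fun i _ => by ring

theorem exists_evalPoly_eq (P : Polynomial ℤ) :
    ∃ p : List ℤ, ∀ x : ℝ, evalPoly p x = Polynomial.aeval x P := by
  refine ⟨List.ofFn fun i : Fin (P.natDegree + 1) => P.coeff i, fun x => ?_⟩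
  rw [evalPoly_ofFn, Polynomial.aeval_eq_sum_range, Finset.sum_range]
  simp

open Polynomial in
/-- A real algebraic number is a simple root of some polynomial. -/
theorem exists_simple_root {x : ℝ} (hx : IsAlgebraic ℤ x) : ∃ (P : ℤ[X]) (Q : ℝ[X]),
    P.map (Int.castRingHom ℝ) = (X - C x) * Q ∧ Q.eval x ≠ 0 := by
  -- For a polynomial of least degree a multiple root is impossible, since the derivative would
  -- vanish at `x` too.
  obtain ⟨P, ⟨hP0, hP⟩, hmin⟩ := WellFounded.has_min
    (r := (InvImage (· < ·) Polynomial.natDegree : ℤ[X] → ℤ[X] → Prop))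
    (InvImage.wf _ wellFounded_lt) {P | P ≠ 0 ∧ aeval x P = 0} hx
  have hroot : (P.map (Int.castRingHom ℝ)).IsRoot x := by
    rw [IsRoot.def, eval_map]
    exact hP
  obtain ⟨Q, hQ⟩ := dvd_iff_isRoot.2 hroot
  refine ⟨P, Q, hQ, fun h0 => ?_⟩
  have hder : aeval x (derivative P) = 0 := by
    have h1 : (derivative (P.map (Int.castRingHom ℝ))).eval x = 0 := by
      rw [hQ]
      simp [h0]
    rwa [derivative_map, eval_map] at h1
  have hdeg : 0 < P.natDegree := by
    rw [Nat.pos_iff_ne_zero]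
    intro h
    rw [eq_C_of_natDegree_eq_zero h] at hP hP0
    simp at hP hP0
    exact hP0 hP
  refine hmin (derivative P) ⟨fun h => ?_, hder⟩ (natDegree_derivative_lt hdeg.ne')
  exact hdeg.ne' (Polynomial.derivative_eq_zero.1 h)

/-- Near a simple root the cofactor `Q` keeps its sign, so the polynomial changes sign at `x` and
has no other root nearby; any close rational endpoints will do. -/
theorem exists_describes {x : ℝ} (hx : IsAlgebraic ℤ x) : ∃ d, Describes d x := by
  obtain ⟨P, Q, hPQ, hQ⟩ := exists_simple_root hx
  obtain ⟨p, hp⟩ := exists_evalPoly_eq P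
  have heval : ∀ y, evalPoly p y = (y - x) * Q.eval y := fun y => by
    rw [hp]
    have h1 : Polynomial.aeval y P = (P.map (Int.castRingHom ℝ)).eval y := by
      rw [Polynomial.eval_map]
      rfl
    rw [h1, hPQ]
    simp
  have hpos : ∀ᶠ y in nhds x, 0 < Q.eval y * Q.eval x :=
    (Q.continuous.mul continuous_const).continuousAt.eventually
      (lt_mem_nhds (mul_self_pos.2 hQ))
  obtain ⟨δ, hδ, h⟩ := Metric.eventually_nhds_iff.1 hpos
  obtain ⟨lo, hlo1, hlo2⟩ := exists_ratCode_btwn (sub_lt_self x hδ)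
  obtain ⟨hi, hhi1, hhi2⟩ := exists_ratCode_btwn (lt_add_of_pos_right x hδ)
  have hd : ∀ y, lo.toReal ≤ y → y ≤ hi.toReal → 0 < Q.eval y * Q.eval x := fun y h1 h2 => by
    refine h ?_
    rw [Real.dist_eq, abs_lt]
    constructor <;> linarith
  refine ⟨(p, lo, hi), hlo2, hhi1, by simp [heval], fun y h1 h2 h3 => ?_, ?_⟩
  · rw [heval] at h3
    have h4 : Q.eval y ≠ 0 := fun h0 => by
      have := hd y h1.le h2.le
      rw [h0, zero_mul] at this
      exact this.false
    exact sub_eq_zero.1 ((mul_eq_zero.1 h3).resolve_right h4)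
  · simp only [heval]
    have h1 := hd lo.toReal le_rfl (hlo2.trans hhi1).le
    have h2 := hd hi.toReal (hlo2.trans hhi1).le le_rfl
    have h3 : 0 < Q.eval lo.toReal * Q.eval hi.toReal := by
      have := mul_pos h1 h2
      have h4 : 0 < Q.eval x * Q.eval x := mul_self_pos.2 hQ
      nlinarith
    have h4 : (lo.toReal - x) * (hi.toReal - x) < 0 :=
      mul_neg_of_neg_of_pos (sub_neg.2 hlo2) (sub_pos.2 hhi1)
    have := mul_neg_of_neg_of_pos h4 h3
    linarith

/-- The square of the norm is the product of `z` with its conjugate, a root of the same polynomial.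
-/
theorem isAlgebraic_norm {z : ℂ} (hz : IsAlgebraic ℤ z) : IsAlgebraic ℤ ‖z‖ := by
  have h1 : IsAlgebraic ℤ (starRingEnd ℂ z) := by
    obtain ⟨P, h0, hP⟩ := hz
    refine ⟨P, h0, ?_⟩
    have := congrArg (starRingEnd ℂ) hP
    rw [map_zero] at this
    rw [← this]
    exact Polynomial.aeval_algHom_apply (starRingEnd ℂ).toIntAlgHom z P
  have h2 : IsAlgebraic ℤ ((‖z‖ ^ 2 : ℝ) : ℂ) := by
    have h3 : ((‖z‖ ^ 2 : ℝ) : ℂ) = z * starRingEnd ℂ z := by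
      rw [Complex.mul_conj, Complex.normSq_eq_norm_sq]
    rw [h3]
    exact hz.mul h1
  have h3 : IsAlgebraic ℤ (‖z‖ ^ 2) :=
    (isAlgebraic_algebraMap_iff (R := ℤ) (S := ℝ) (A := ℂ) (algebraMap ℝ ℂ).injective).1 h2
  exact h3.of_pow two_pos

section Table

variable {K : Type u} [Field K] [NumberField K]

theorem isAlgebraic_absV {S : Finset (HeightOneSpectrum (𝓞 K))} (v : SPlace S) (x : Kˣ) :
    IsAlgebraic ℤ (absV v (x : K)) := by
  rcases v with v | P
  · have h1 : IsAlgebraic ℤ (x : K) :=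
      (IsFractionRing.isAlgebraic_iff ℤ ℚ K).2 (Algebra.IsAlgebraic.isAlgebraic _)
    have h2 : IsAlgebraic ℤ (v.embedding (x : K)) := h1.algHom v.embedding.toIntAlgHom
    have h3 := isAlgebraic_norm h2
    rw [InfinitePlace.norm_embedding_eq] at h3
    exact h3.pow _
  · rw [absV_inr]
    have h1 : ((Ideal.absNorm P.1.asIdeal : ℝ) ^ (ordVec S (Additive.ofMul x) P)) =
        algebraMap ℚ ℝ ((Ideal.absNorm P.1.asIdeal : ℚ) ^ (ordVec S (Additive.ofMul x) P)) := by
      simp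
    rw [h1]
    exact (IsFractionRing.isAlgebraic_iff ℤ ℚ ℝ).2 (isAlgebraic_algebraMap _)

theorem exists_isValuationTable (S : Finset (HeightOneSpectrum (𝓞 K)))
    (T : Fin (sRank S) → Kˣ) : ∃ tab, IsValuationTable S T tab := by
  let e : Fin (numPlaces S) ≃ SPlace S := (Fintype.equivFin _).symm
  choose code hcode using fun i j => exists_describes (isAlgebraic_absV (e i) (T j))
  exact ⟨_, e, code, rfl, hcode⟩

end Table


/-! ### Deciding exact comparisons for a fixed table -/

section FixedTable

open Matrix

variable {s n : ℕ} {R : Matrix (Fin s) (Fin n) ℝ} {tab : List (List AlgCode)}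

/-- The list of the entries of `N • β + b`. -/
def listMulAdd (n N : ℕ) (β b : List ℤ) : List ℤ :=
  (List.range n).map fun j => N * β.getD j 0 + b.getD j 0

@[fun_prop] theorem primrec_listMulAdd {α : Type*} [Primcodable α] {n N : α → ℕ}
    {β b : α → List ℤ} (hn : Primrec n) (hN : Primrec N) (hβ : Primrec β) (hb : Primrec b) :
    Primrec fun a => listMulAdd (n a) (N a) (β a) (b a) := by
  unfold listMulAdd
  fun_prop

theorem listMulAdd_ofFn (N : ℕ) (β b : Fin n → ℤ) :
    listMulAdd n N (List.ofFn β) (List.ofFn b) = List.ofFn fun j => N * β j + b j := by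
  refine List.ext_getElem (by simp [listMulAdd]) fun j h1 h2 => ?_
  simp at h2
  simp [listMulAdd, h2]

/-- A semidecidable form of the statement that the derivative of the dual norm at `β` in the direction
of `b` is smaller than `c`. -/
def SmallSlope (tab : List (List AlgCode)) (n : ℕ) (β b : List ℤ) (c : RatCode) : Prop :=
  ∃ w : ℕ × RatCode × RatCode, 0 < w.2.1.1 ∧
    w.2.1.1 * (w.2.2.2 + 1 : ℕ) * (c.2 + 1 : ℕ) ≤ w.1 * w.2.2.1 * (w.2.1.2 + 1 : ℕ) * (c.2 + 1 : ℕ) +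
      c.1 * (w.2.1.2 + 1 : ℕ) * (w.2.2.2 + 1 : ℕ) ∧
    SmallNorm tab (listMulAdd n w.1 β b) w.2.1 ∧ (w.2.2.1 ≤ 0 ∨ LargeNorm tab β w.2.2)

theorem semiDec_smallSlope (tab : List (List AlgCode)) (n : ℕ) (β : List ℤ) :
    SemiDec fun q : List ℤ × RatCode => SmallSlope tab n β q.1 q.2 := by
  unfold SmallSlope
  refine SemiDec.exists (SemiDec.and (PrimrecPred.semiDec (by fun_prop))
    (SemiDec.and (PrimrecPred.semiDec (by fun_prop)) (SemiDec.and ?_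
    (SemiDec.or (PrimrecPred.semiDec (by fun_prop)) ?_))))
  · exact semiDec_smallNorm.comp (f := fun q : (List ℤ × RatCode) × (ℕ × RatCode × RatCode) =>
      (tab, listMulAdd n q.2.1 β q.1.1, q.2.2.1)) (by fun_prop)
  · exact semiDec_largeNorm.comp (f := fun q : (List ℤ × RatCode) × (ℕ × RatCode × RatCode) =>
      (tab, β, q.2.2.2)) (by fun_prop)

/-- The integral inequality in `SmallSlope` is this one with denominators cleared. -/
theorem le_mul_add_iff (N : ℕ) (p q c : RatCode) :
    p.1 * (q.2 + 1 : ℕ) * (c.2 + 1 : ℕ) ≤ N * q.1 * (p.2 + 1 : ℕ) * (c.2 + 1 : ℕ) +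
      c.1 * (p.2 + 1 : ℕ) * (q.2 + 1 : ℕ) ↔ p.toReal ≤ N * q.toReal + c.toReal := by
  have h1 : (0 : ℝ) < (p.2 : ℝ) + 1 := by positivity
  have h2 : (0 : ℝ) < (q.2 : ℝ) + 1 := by positivity
  have h3 : (0 : ℝ) < (c.2 : ℝ) + 1 := by positivity
  have h4 : N * q.toReal + c.toReal = (N * q.1 * (c.2 + 1) + c.1 * (q.2 + 1)) /
      (((q.2 : ℝ) + 1) * (c.2 + 1)) := by
    rw [RatCode.toReal, RatCode.toReal]
    field_simp
  rw [h4, RatCode.toReal, div_le_div_iff₀ h1 (by positivity)]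
  rw [← Int.cast_le (R := ℝ)]
  push_cast
  constructor <;> intro h <;> linarith

/-- On the unit ball `N * β + b` is at most `p`, while `β` takes its dual norm, at least `q`, at
`x`; the difference `p - N * q` is at most `c`. -/
theorem SmallSlope.dotProduct_lt [NeZero s] (hR : Function.Injective R.mulVec) (ht : TableOf R tab)
    {x : Fin n → ℝ} (hx : ‖R *ᵥ x‖ ≤ 1) {β b : Fin n → ℤ} {c : RatCode}
    (hβ : (fun j => (β j : ℝ)) ⬝ᵥ x = coNorm R fun j => (β j : ℝ))
    (h : SmallSlope tab n (List.ofFn β) (List.ofFn b) c) :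
    (fun j => (b j : ℝ)) ⬝ᵥ x ≤ c.toReal := by
  obtain ⟨⟨N, p, q⟩, hp, hle, hsm, hla⟩ := h
  rw [le_mul_add_iff] at hle
  rw [listMulAdd_ofFn] at hsm
  have hp0 := RatCode.toReal_pos_iff.2 hp
  have h1 := (hsm.dualLE ht hp0).dotProduct_le hp0.le hx
  have h2 : q.toReal ≤ (fun j => (β j : ℝ)) ⬝ᵥ x := by
    rw [hβ]
    rcases le_or_gt q.toReal 0 with h0 | h0
    · exact h0.trans (coNorm_nonneg _ _)
    · have hla := (hla.resolve_left (not_le.2 (RatCode.toReal_pos_iff.1 h0))).not_dualLE ht h0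
      rw [dualLE_iff hR h0.le, not_le] at hla
      exact hla.le
  have h3 : (fun j => ((N * β j + b j : ℤ) : ℝ)) ⬝ᵥ x =
      N * ((fun j => (β j : ℝ)) ⬝ᵥ x) + (fun j => (b j : ℝ)) ⬝ᵥ x := by
    simp only [dotProduct, Finset.mul_sum, ← Finset.sum_add_distrib]
    exact Finset.sum_congr rfl fun j _ => by push_cast; ring
  have h4 : N * q.toReal ≤ N * ((fun j => (β j : ℝ)) ⬝ᵥ x) := by gcongr
  linarith

theorem smallSlope_of_lt [NeZero s] (hR : Function.Injective R.mulVec) (ht : TableOf R tab)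
    {β b : Fin n → ℤ} {c : RatCode} {N : ℕ} (h : coNorm R (fun j => ((N * β j + b j : ℤ) : ℝ)) <
      N * coNorm R (fun j => (β j : ℝ)) + c.toReal) :
    SmallSlope tab n (List.ofFn β) (List.ofFn b) c := by
  obtain ⟨p, hp1, hp2⟩ := exists_ratCode_btwn h
  obtain ⟨q, hq1, hq2⟩ : ∃ q : RatCode, p.toReal ≤ N * q.toReal + c.toReal ∧
      q.toReal < coNorm R (fun j => (β j : ℝ)) := by
    -- The room left by `p` is divided by `N + 1` rather than `N` to allow `N = 0`.
    obtain ⟨q, hq1, hq2⟩ := exists_ratCode_btwn (sub_lt_self (coNorm R fun j => (β j : ℝ))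
      (show 0 < (N * coNorm R (fun j => (β j : ℝ)) + c.toReal - p.toReal) / (N + 1) from
        div_pos (sub_pos.2 hp2) (by positivity)))
    refine ⟨q, ?_, hq2⟩
    have h1 : (coNorm R (fun j => (β j : ℝ)) - q.toReal) * (N + 1) ≤
        N * coNorm R (fun j => (β j : ℝ)) + c.toReal - p.toReal := by
      rw [← le_div_iff₀ (by positivity)]
      linarith
    linarith
  have hp0 : 0 < p.toReal := (coNorm_nonneg _ _).trans_lt hp1
  refine ⟨(N, p, q), RatCode.toReal_pos_iff.1 hp0, (le_mul_add_iff N p q c).2 hq1, ?_, ?_⟩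
  · rw [listMulAdd_ofFn]
    exact smallNorm_of_coNorm_lt hR ht hp1
  · rcases le_or_gt q.1 0 with h0 | h0
    · exact Or.inl h0
    · have h0' := RatCode.toReal_pos_iff.2 h0
      refine Or.inr (largeNorm_of_not_dualLE ht h0' ?_)
      rw [dualLE_iff hR h0'.le, not_le]
      exact hq2

/-- Whether an integral linear combination of fixed real numbers is equal to a rational number can be
decided. -/
theorem exists_primrecPred_sum_eq (x : Fin n → ℝ) : ∃ E : List ℤ → RatCode → Prop,
    (PrimrecPred fun q : List ℤ × RatCode => E q.1 q.2) ∧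
      ∀ (b : Fin n → ℤ) c, E (List.ofFn b) c ↔ (fun j => (b j : ℝ)) ⬝ᵥ x = c.toReal := by
  -- The real numbers enter only through these equations, whose integral coefficients are constants
  -- of the test.
  obtain ⟨k, A, B, h⟩ := exists_linear_equations x
  refine ⟨fun b c => AllLt k fun i => (c.2 + 1 : ℕ) * listDot n b ((matCode A).getD i []) =
    c.1 * (List.ofFn B).getD i 0, by fun_prop, fun b c => ?_⟩
  have h1 : (fun j => (b j : ℝ)) ⬝ᵥ x = c.toReal ↔
      ((c.2 + 1 : ℕ) : ℤ) * ∑ j, b j * x j = c.1 := by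
    rw [RatCode.toReal, eq_div_iff (by positivity), mul_comm]
    simp [dotProduct]
  rw [h1, h]
  have h2 : ∀ i : Fin k, listDot n (List.ofFn b) ((matCode A).getD i []) = ∑ j, b j * A i j :=
    fun i => by
      simp only [listDot, Finset.sum_range, matCode_getD, getD_ofFn]
  constructor
  · intro hE i
    have := hE i i.2
    beta_reduce at this
    rwa [h2, getD_ofFn] at this
  · intro hE i hi
    have := hE ⟨i, hi⟩
    rwa [← h2, ← getD_ofFn B 0 ⟨i, hi⟩] at this

/-- For a fixed table, dual norms can be compared with rational numbers. -/
theorem exists_semiDec_dualLE [NeZero s] (hR : Function.Injective R.mulVec) (ht : TableOf R tab) :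
    ∃ Sm : RatCode → List ℤ → Prop, (SemiDec fun q : RatCode × List ℤ => Sm q.1 q.2) ∧
      ∀ c : RatCode, 0 < c.toReal → ∀ b : Fin n → ℤ,
        Sm c (List.ofFn b) ↔ DualLE R (fun j => (b j : ℝ)) c.toReal := by
  obtain ⟨X, β, hX, hβ⟩ := exists_exposed_points hR
  choose E hE hE' using fun x : Fin n → ℝ => exists_primrecPred_sum_eq x
  -- The dual norm is at most `c` if and only if `b ⬝ᵥ x ≤ c` for the finitely many `x ∈ X`;
  -- equality and strict inequality are tested separately.
  refine ⟨fun c b => ∀ x ∈ X, E x b c ∨ SmallSlope tab n (List.ofFn (β x)) b c,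
    SemiDec.forall_finset (p := fun (x : Fin n → ℝ) (q : RatCode × List ℤ) =>
      E x q.2 q.1 ∨ SmallSlope tab n (List.ofFn (β x)) q.2 q.1) X fun x _ => SemiDec.or ?_ ?_,
    fun c hc b => ⟨fun h => ?_, fun h x hx => ?_⟩⟩
  · exact ((hE x).comp (f := fun q : RatCode × List ℤ => (q.2, q.1)) (by fun_prop)).semiDec
  · exact (semiDec_smallSlope tab n (List.ofFn (β x))).comp
      (f := fun q : RatCode × List ℤ => (q.2, q.1)) (by fun_prop)
  · rw [dualLE_iff hR hc.le]
    obtain ⟨x, hx, hxb⟩ := hX.2 b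
    rw [← hxb]
    rcases h x hx with h1 | h1
    · exact ((hE' x b c).1 h1).le
    · exact h1.dotProduct_lt hR ht (hX.1 x hx) (hβ x hx).1
  · rcases (h.dotProduct_le hc.le (hX.1 x hx)).eq_or_lt with h1 | h1
    · exact Or.inl ((hE' x b c).2 h1)
    · obtain ⟨N, hN⟩ := (hβ x hx).2 b
      refine Or.inr (smallSlope_of_lt hR ht (N := N) ?_)
      rw [hN]
      linarith

end FixedTable

section Decision

variable {K : Type u} [Field K] [NumberField K] {S : Finset (HeightOneSpectrum (𝓞 K))}
  {T : Fin (sRank S) → Kˣ}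

/-- For a fixed table both the bound `DualLE` and its negation are semidecidable, so no candidate
escapes and the search halts even if `c` is a value of `N`. -/
theorem exists_computable_systemsUpTo (hT : IsFundamentalSystem S T) :
    ∃ φ : RatCode → List (List (List ℤ)), Computable φ ∧
      ∀ c : RatCode, 0 < c.toReal → systemsOf S T (φ c) = systemsUpTo S c.toReal := by
  obtain ⟨tab, htab⟩ := exists_isValuationTable S T
  obtain ⟨e, he⟩ := htab.tableOf
  have hinj := injective_mulVec_submatrix e hT.injective_mulVec
  obtain ⟨Sm, hSm, hSm'⟩ := exists_semiDec_dualLE hinj he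
  -- The alternative `c.1 ≤ 0` makes the search halt on non-positive inputs, where the output is
  -- irrelevant.
  let p : RatCode → List (List (List ℤ)) → Prop := fun c L => c.1 ≤ 0 ∨ ∃ M, EntryBound tab c M ∧
    ListsSmall (sRank S) M (Sm c) (fun b => LargeNorm tab b c) L
  have hp : SemiDec fun q : RatCode × List (List (List ℤ)) => p q.1 q.2 := by
    refine SemiDec.or (PrimrecPred.semiDec (by fun_prop)) (SemiDec.exists (SemiDec.and ?_
      (SemiDec.listsSmall (by fun_prop) (by fun_prop) ?_ ?_ (by fun_prop))))
    · exact semiDec_entryBound.comp (f := fun q : (RatCode × List (List (List ℤ))) × ℕ =>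
        (tab, q.1.1, q.2)) (by fun_prop)
    · exact hSm.comp (f := fun q : ((RatCode × List (List (List ℤ))) × ℕ) × List ℤ =>
        (q.1.1.1, q.2)) (by fun_prop)
    · exact semiDec_largeNorm.comp
        (f := fun q : ((RatCode × List (List (List ℤ))) × ℕ) × List ℤ => (tab, q.2, q.1.1.1))
        (by fun_prop)
  obtain ⟨Φ, h1, h2, h3⟩ := hp.exists_partrec
  have hdom : ∀ c, (Φ c).Dom := fun c => h3 c (by
    rcases le_or_gt c.1 0 with h0 | h0
    · exact ⟨[], Or.inl h0⟩
    have hc := RatCode.toReal_pos_iff.2 h0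
    obtain ⟨M, hM⟩ := exists_entryBound he c
    obtain ⟨L, hL⟩ := exists_listsSmall (sRank S) M (Sm := Sm c)
      (La := fun b => LargeNorm tab b c) (fun B _ => by
        by_contra hno
        push Not at hno
        obtain ⟨⟨i, hi⟩, hno⟩ := hno
        rw [hSm' c hc] at hi
        exact hno i (largeNorm_of_not_dualLE he hc hi))
    exact ⟨L, Or.inr ⟨M, hM, hL⟩⟩)
  refine ⟨fun c => (Φ c).get (hdom c), h1.of_eq fun c => (Part.some_get (hdom c)).symm,
    fun c hc => ?_⟩
  obtain ⟨M, hM, hL⟩ := (h2 c _ (Part.get_mem (hdom c))).resolve_left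
    (not_le.2 (RatCode.toReal_pos_iff.1 hc))
  refine systemsOf_eq_systemsUpTo hT hc.le fun A => ?_
  rw [hL.mem_iff (R := (logMatrix S T).submatrix e id) (c := c.toReal)
    (fun b => (hSm' c hc b).1) (fun b hb => hb.not_dualLE he hc)
    (fun b hb => hM.abs_le he hc le_rfl hb), inverseLE_submatrix]

theorem isLeast_sysNorm {F : Fin (sRank S) → Kˣ} (hF : IsFundamentalSystem S F) :
    IsLeast (leftInverseNorms S F) (sysNorm S F) := by
  obtain ⟨A, B, hAB, h⟩ := hF.exists_transform hF
  rw [sysNorm_eq hF hAB h]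
  exact isLeast_leftInverseNorms hF hAB h

end Decision

theorem theorem1 :
    -- For all number fields and all finite sets of places containing the infinite ones:
    (∀ (K : Type u) [Field K] [NumberField K] (S : Finset (HeightOneSpectrum (𝓞 K))),
      -- `N(F)` is a minimum;
      (∀ F, IsFundamentalSystem S F → IsLeast (leftInverseNorms S F) (sysNorm S F)) ∧
      -- there are only finitely many systems with `N(F) ≤ c`;
      (∀ c : ℝ, 0 < c → (systemsUpTo S c).Finite) ∧
      -- an optimal system exists;
      (∃ F, IsOptimal S F) ∧
      -- an algorithm computes, from a rational `c > 0`, all systems with `N(F) ≤ c`.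
      (∀ T, IsFundamentalSystem S T →
        ∃ φ : RatCode → List (List (List ℤ)), Computable φ ∧
          ∀ c : RatCode, 0 < c.toReal → systemsOf S T (φ c) = systemsUpTo S c.toReal)) ∧
    -- One algorithm works for all number fields, all sets of places, all given fundamental systems
    -- and all real `c`, enclosed between rational numbers: it never gives a wrong answer, and it
    -- halts unless the enclosing interval contains some `N(F)`.
    (∃ Φ : List (List AlgCode) × RatCode × RatCode →. List (List (List ℤ)), Partrec Φ ∧
      ∀ (K : Type u) [Field K] [NumberField K] (S : Finset (HeightOneSpectrum (𝓞 K)))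
        (T : Fin (sRank S) → Kˣ) (tab : List (List AlgCode)),
        IsFundamentalSystem S T → IsValuationTable S T tab →
        ∀ lo hi : RatCode, 0 < lo.toReal → lo.toReal ≤ hi.toReal →
          (∀ L ∈ Φ (tab, lo, hi), ∀ c : ℝ, lo.toReal ≤ c → c ≤ hi.toReal →
            systemsOf S T L = systemsUpTo S c) ∧
          ((∀ F, IsFundamentalSystem S F → sysNorm S F ∉ Set.Icc lo.toReal hi.toReal) →
            (Φ (tab, lo, hi)).Dom)) ∧
    -- One algorithm approximates the set of optimal systems: for every accuracy `1 / (n + 1)` it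
    -- finds all of them, possibly with others that are optimal up to that accuracy, and for all
    -- large `n` it finds precisely the optimal systems.
    (∃ Ψ : List (List AlgCode) × ℕ →. List (List (List ℤ)), Partrec Ψ ∧
      ∀ (K : Type u) [Field K] [NumberField K] (S : Finset (HeightOneSpectrum (𝓞 K)))
        (T : Fin (sRank S) → Kˣ) (tab : List (List AlgCode)),
        IsFundamentalSystem S T → IsValuationTable S T tab →
        (∀ n : ℕ, ∃ L ∈ Ψ (tab, n), {F | IsOptimal S F} ⊆ systemsOf S T L ∧
          ∀ F ∈ systemsOf S T L, IsFundamentalSystem S F ∧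
            ∀ G, IsFundamentalSystem S G → sysNorm S F ≤ sysNorm S G + 1 / ((n : ℝ) + 1)) ∧
        ∃ n₀ : ℕ, ∀ n ≥ n₀, ∃ L ∈ Ψ (tab, n), systemsOf S T L = {F | IsOptimal S F}) :=
  ⟨fun _ _ _ S => ⟨fun _ hF => isLeast_sysNorm hF, fun _ hc => finite_systemsUpTo S hc.le,
    exists_isOptimal S, fun _ hT => exists_computable_systemsUpTo hT⟩,
    exists_partrec_systemsUpTo, exists_partrec_optimal⟩
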